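/- Let $G$ be a compact quantum group with Hopf $*$-algebra of regular functions $(\mathbb C[G],\Delta)$ (antipode $S$), Haar state $h$ and reduced C$^*$-algebra $C(G)$ (the closure of $\mathbb C[G]$ in the GNS representation of $h$), and let $D(G)$ be its Drinfeld double. A unital Yetter--Drinfeld $G$-C$^*$-algebra (a unital C$^*$-algebra with an action of $D(G)$) is a nonzero unital C$^*$-algebra $A$ together with * a continuous left action of $G$: an injective unital $*$-homomorphism $\alpha\colon A\to C(G)\otimes A$ (minimal tensor product) with $(\Delta\otimes\iota)\alpha=(\iota\otimes\alpha)\alpha$ and $(C(G)\otimes1)\alpha(A)$ spanning a dense subspace of $C(G)\otimes A$; * a right action of the dual discrete quantum group $\hat G$, equivalently a unital left $\mathbb C[G]$-module algebra structure $x\otimes a\mapsto x\rhd a$ with $x\rhd a^*=(S(x)^*\rhd a)^*$; such that $\alpha(x\rhd a)=x_{(1)}a_{(1)}S(x_{(3)})\otimes(x_{(2)}\rhd a_{(2)})$ for all $x\in\mathbb C[G]$ and all regular $a\in A$, i.e. all $a$ such that $\alpha(a)=a_{(1)}\otimes a_{(2)}$ lies in the algebraic tensor product $\mathbb C[G]\otimes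 A$. A linear map $\phi$ between such algebras is $D(G)$-equivariant if $\phi(x\rhd a)=x\rhd\phi(a)$ and $\phi((\omega\otimes\iota)\alpha(a))=(\omega\otimes\iota)\alpha(\phi(a))$ for all $a$, all $x\in\mathbb C[G]$ and all functionals $\omega=h(\cdot\,y)$, $y\in\mathbb C[G]$; ucp means unital completely positive. An isomorphism is a $D(G)$-equivariant $*$-isomorphism. A unital Yetter--Drinfeld $G$-C$^*$-algebra $A$ is a $D(G)$-boundary if every $D(G)$-equivariant ucp map from $A$ to a unital Yetter--Drinfeld $G$-C$^*$-algebra is completely isometric. It is $D(G)$-injective if for all unital Yetter--Drinfeld $G$-C$^*$-algebras $B$, $C$, every completely isometric $D(G)$-equivariant ucp map $\phi\colon B\to C$ and every $D(G)$-equivariant ucp map $\psi\colon B\to A$ there is a $D(G)$-equivariant ucp map $\tilde\psi\colon C\to A$ with $\tilde\psi\phi=\psi$. A Furstenberg--Hamana boundary of $D(G)$ is a $D(G)$-injective $D(G)$-boundary. Theorem. For every compact quantum group $G$, a Furstenberg--Hamana boundary of $D(G)$ exists and is unique up to isomorphism. Furthermore, if $A$ is a Furstenberg--Hamana boundary of $D(G)$,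 then the only $D(G)$-equivariant ucp map $A\to A$ is the identity map, and $A$ is braided-commutative: $ab=b_{(2)}(S^{-1}(b_{(1)})\rhd a)$ for all regular $a,b\in A$. -/

import Mathlib

universe u v w

namespace QG

open scoped TensorProduct ComplexOrder
open Coalgebra HopfAlgebra

/-- A Haar state on a Hopf `*`-algebra: a positive normalized functional that is invariant,
`(h ⊗ ι)Δ(x) = h(x)1 = (ι ⊗ h)Δ(x)`. It is unique if it exists. -/
structure IsHaarState {H : Type u} [Ring H] [StarRing H] [HopfAlgebra ℂ H]
    (h : H →ₗ[ℂ] ℂ) : Prop where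
  map_one : h 1 = 1
  nonneg : ∀ x : H, 0 ≤ h (star x * x)
  left_invariant : ∀ x : H,
    TensorProduct.lid ℂ H (h.rTensor H (comul (R := ℂ) x)) = h x • (1 : H)
  right_invariant : ∀ x : H,
    TensorProduct.rid ℂ H (h.lTensor H (comul (R := ℂ) x)) = h x • (1 : H)

/-- A compact quantum group `G`, described by its Hopf `*`-algebra `H = ℂ[G]` of regular
functions: a Hopf `*`-algebra over `ℂ` that has an invariant state. (Faithfulness of this state
on `ℂ[G]`, the reduced C*-completion and the boundedness of its slices are derived below.) -/
class CompactQuantumGroup (H : Type u) [Ring H] [StarRing H] [HopfAlgebra ℂ H]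
    [StarModule ℂ H] : Prop where
  comul_star : ∀ x : H, comul (R := ℂ) (star x) = star (comul (R := ℂ) x)
  exists_haarState : ∃ h : H →ₗ[ℂ] ℂ, IsHaarState h

noncomputable section

section Haar
variable (H : Type u) [Ring H] [StarRing H] [HopfAlgebra ℂ H] [StarModule ℂ H]
  [CompactQuantumGroup H]

/-- The Haar state `h` of `G`. -/
def haar : H →ₗ[ℂ] ℂ := (CompactQuantumGroup.exists_haarState (H := H)).choose

lemma haar_spec : IsHaarState (haar H) :=
  (CompactQuantumGroup.exists_haarState (H := H)).choose_spec

variable {H}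

lemma haar_star (x : H) : haar H (star x) = star (haar H x) := by
  have key : ∀ y : H, star (haar H (star y * y)) = haar H (star y * y) := fun y =>
    ((haar_spec H).nonneg y).isSelfAdjoint
  have h1 := key (x + 1)
  have h2 := key (x + Complex.I • (1 : H))
  have h0 := key x
  have h3 := (haar_spec H).map_one
  simp only [star_add, star_one, add_mul, mul_add, mul_one, one_mul, map_add, star_smul,
    smul_mul_assoc, mul_smul_comm, map_smul, h3, smul_eq_mul, star_mul', h0] at h1 h2
  have hI : star Complex.I = -Complex.I := by simp
  simp only [hI, star_neg] at h1 h2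
  apply Complex.ext
  · have e1 := congrArg Complex.re h2
    have e2 := congrArg Complex.im h2
    have e3 := congrArg Complex.re h1
    have e4 := congrArg Complex.im h1
    simp at e1 e2 e3 e4 ⊢
    linarith
  · have e1 := congrArg Complex.re h2
    have e2 := congrArg Complex.im h2
    have e3 := congrArg Complex.re h1
    have e4 := congrArg Complex.im h1
    simp at e1 e2 e3 e4 ⊢
    linarith

/-- The semi-inner product `⟪x, y⟫ = h(x* y)` on `ℂ[G]`. -/
abbrev preCore : PreInnerProductSpace.Core ℂ H where
  inner x y := haar H (star x * y)
  conj_inner_symm x y := by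
    rw [starRingEnd_apply, ← haar_star]; simp
  re_inner_nonneg x := (Complex.nonneg_iff.mp ((haar_spec H).nonneg x)).1
  add_left x y z := by simp [add_mul]
  smul_left x y r := by simp [star_smul]

lemma haar_mul_eq_zero {x : H} (hx : haar H (star x * x) = 0) (y : H) : haar H (y * x) = 0 := by
  let c : PreInnerProductSpace.Core ℂ H := preCore
  let _ : Inner ℂ H := c.toInner
  have h1 := InnerProductSpace.Core.inner_mul_inner_self_le (𝕜 := ℂ) (F := H) (star y) x
  have h2 : (inner ℂ x x : ℂ) = 0 := hx
  have h3 : (inner ℂ (star y) x : ℂ) = haar H (y * x) := by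
    change haar H (star (star y) * x) = _
    rw [star_star]
  have h4 : ‖(inner ℂ x (star y) : ℂ)‖ = ‖(inner ℂ (star y) x : ℂ)‖ :=
    InnerProductSpace.Core.norm_inner_symm _ _
  rw [h2, h4, h3] at h1
  simp only [map_zero, mul_zero] at h1
  have h5 : ‖haar H (y * x)‖ = 0 := by nlinarith [norm_nonneg (haar H (y * x))]
  exact norm_eq_zero.mp h5

/-- The linear map `a ⊗ b ↦ (S(a) ⊗ 1) Δ(b)`. -/
def antipodeComul {H : Type u} [Ring H] [HopfAlgebra ℂ H] : H ⊗[ℂ] H →ₗ[ℂ] H ⊗[ℂ] H :=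
  TensorProduct.lift (LinearMap.mk₂ ℂ
      (fun a b : H => ((antipode ℂ a) ⊗ₜ[ℂ] (1 : H)) * comul (R := ℂ) b)
      (by intros; simp [TensorProduct.add_tmul, add_mul])
      (by intros; simp [← TensorProduct.smul_tmul'])
      (by intros; simp [mul_add])
      (by intros; simp))

/-- `∑ (S(p₍₁₎) ⊗ 1) Δ(p₍₂₎) = 1 ⊗ p`. -/
lemma antipode_comul {H : Type u} [Ring H] [HopfAlgebra ℂ H] (p : H) :
    antipodeComul (comul (R := ℂ) p) = (1 : H) ⊗ₜ[ℂ] p := by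
  have key : ∀ t : H ⊗[ℂ] H, antipodeComul t =
      (LinearMap.mul' ℂ H ∘ₗ (antipode ℂ).rTensor H).rTensor H
        ((TensorProduct.assoc ℂ H H H).symm ((comul (R := ℂ)).lTensor H t)) := by
    intro t
    induction t using TensorProduct.induction_on with
    | zero => simp
    | add x y hx hy => simp only [map_add, hx, hy]
    | tmul a b =>
      simp only [antipodeComul, TensorProduct.lift.tmul, LinearMap.mk₂_apply, LinearMap.lTensor_tmul]
      induction comul (R := ℂ) b using TensorProduct.induction_on with
      | zero => simp
      | add x y hx hy => simp only [TensorProduct.tmul_add, map_add, mul_add, hx, hy]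
      | tmul c d => simp
  rw [key, coassoc_symm_apply, ← LinearMap.comp_apply, ← LinearMap.rTensor_comp,
    LinearMap.comp_assoc, mul_antipode_rTensor_comul, LinearMap.rTensor_comp,
    LinearMap.comp_apply, rTensor_counit_comul]
  simp

lemma haar_faithful {x : H} (hx : haar H (star x * x) = 0) : x = 0 := by
  classical
  have h0 := haar_mul_eq_zero hx
  -- the null space `N` of `h` satisfies `Δ(N) ⊆ H ⊗ N`
  have h1 : ∀ {z : H}, (∀ y, haar H (y * z) = 0) → ∀ p : H,
      (haar H ∘ₗ LinearMap.mulLeft ℂ p).lTensor H (comul (R := ℂ) z) = 0 := by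
    intro z hz p
    have h2 : ∀ t : H ⊗[ℂ] H, (haar H).lTensor H (antipodeComul t * comul (R := ℂ) z) = 0 := by
      intro t
      induction t using TensorProduct.induction_on with
      | zero => simp
      | add x y hx hy => simp only [map_add, add_mul, hx, hy, add_zero]
      | tmul a b =>
        simp only [antipodeComul, TensorProduct.lift.tmul, LinearMap.mk₂_apply]
        rw [mul_assoc, ← Bialgebra.comul_mul]
        have h3 : (haar H).lTensor H (comul (R := ℂ) (b * z)) = 0 := by
          apply (TensorProduct.rid ℂ H).injective
          rw [(haar_spec H).right_invariant, hz, map_zero, zero_smul]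
        have h4 : ∀ s : H ⊗[ℂ] H, (haar H).lTensor H ((antipode ℂ a ⊗ₜ[ℂ] (1 : H)) * s) =
            (LinearMap.mulLeft ℂ (antipode ℂ a)).rTensor ℂ ((haar H).lTensor H s) := by
          intro s
          induction s using TensorProduct.induction_on with
          | zero => simp
          | add x y hx hy => simp only [map_add, mul_add, hx, hy]
          | tmul c d => simp
        rw [h4, h3, map_zero]
    have h5 := h2 (comul (R := ℂ) p)
    rw [antipode_comul] at h5
    rw [← h5]
    generalize comul (R := ℂ) z = s
    induction s using TensorProduct.induction_on with
    | zero => simp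
    | add x y hx hy => simp only [map_add, mul_add, hx, hy]
    | tmul c d => simp
  let b := Module.Basis.ofVectorSpace ℂ H
  have hexp : ∀ z : H, ∃ (s : Finset (Module.Basis.ofVectorSpaceIndex ℂ H))
      (y : Module.Basis.ofVectorSpaceIndex ℂ H → H), comul (R := ℂ) z = ∑ i ∈ s, b i ⊗ₜ[ℂ] y i := by
    intro z
    obtain ⟨f, hf⟩ := (TensorProduct.equivFinsuppOfBasisLeft (N := H) b).symm.surjective
      (comul (R := ℂ) z)
    refine ⟨f.support, f, ?_⟩
    rw [← hf, TensorProduct.equivFinsuppOfBasisLeft_symm_apply]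
    rfl
  have hN : ∀ {z : H}, (∀ y, haar H (y * z) = 0) →
      ∃ (s : Finset (Module.Basis.ofVectorSpaceIndex ℂ H))
      (y : Module.Basis.ofVectorSpaceIndex ℂ H → H), comul (R := ℂ) z = ∑ i ∈ s, b i ⊗ₜ[ℂ] y i ∧
      ∀ i ∈ s, ∀ p, haar H (p * y i) = 0 := by
    intro z hz
    obtain ⟨s, y, h⟩ := hexp z
    refine ⟨s, y, h, fun i hi p => ?_⟩
    have h6 := congrArg (TensorProduct.rid ℂ H) (h1 hz p)
    rw [h] at h6
    simp only [map_sum, LinearMap.lTensor_tmul, LinearMap.comp_apply, LinearMap.mulLeft_apply,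
      TensorProduct.rid_tmul, map_zero] at h6
    exact linearIndependent_iff'.mp b.linearIndependent s _ h6 i hi
  have hε : ∀ {z : H}, (∀ y, haar H (y * z) = 0) → counit (R := ℂ) z = 0 := by
    intro z hz
    obtain ⟨s, y, h, h'⟩ := hN hz
    have h7 := congrArg (haar H) (mul_antipode_rTensor_comul_apply (R := ℂ) z)
    rw [h, Algebra.algebraMap_eq_smul_one, map_smul, (haar_spec H).map_one] at h7
    simp only [map_sum, LinearMap.rTensor_tmul, LinearMap.mul'_apply] at h7
    rw [Finset.sum_eq_zero (fun i hi => h' i hi _)] at h7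
    simpa using h7.symm
  obtain ⟨s, y, h, h'⟩ := hN h0
  have h8 := lTensor_counit_comul (R := ℂ) x
  rw [h] at h8
  simp only [map_sum, LinearMap.lTensor_tmul] at h8
  rw [Finset.sum_eq_zero (fun i hi => by rw [hε (h' i hi), TensorProduct.tmul_zero])] at h8
  have h9 := congrArg (TensorProduct.rid ℂ H) h8
  simpa using h9.symm


/-- The inner product `⟪x, y⟫ = h(x* y)` on `ℂ[G]`. -/
abbrev innerCore : InnerProductSpace.Core ℂ H where
  __ := preCore (H := H)
  definite _ hx := haar_faithful hx

/-- Every tensor has an expansion whose left legs are orthonormal for `h(x* y)`. -/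
lemma exists_orthonormal_expansion {M : Type*} [AddCommGroup M] [Module ℂ M] (z : H ⊗[ℂ] M) :
    ∃ (n : ℕ) (e : Fin n → H) (m : Fin n → M),
      (∀ i j, haar H (star (e i) * e j) = if i = j then 1 else 0) ∧
      z = ∑ i, e i ⊗ₜ[ℂ] m i := by
  classical
  let c : InnerProductSpace.Core ℂ H := innerCore
  let _ : NormedAddCommGroup H := c.toNormedAddCommGroup
  let _ : InnerProductSpace ℂ H := InnerProductSpace.ofCore c.toCore
  obtain ⟨S, hS⟩ := TensorProduct.exists_finset (R := ℂ) z
  let V : Submodule ℂ H := Submodule.span ℂ (S.image Prod.fst : Finset H)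
  have : FiniteDimensional ℂ V := FiniteDimensional.span_finset ℂ _
  let b := stdOrthonormalBasis ℂ V
  have hmem : ∀ p ∈ S, p.1 ∈ V := fun p hp =>
    Submodule.subset_span (by simpa using ⟨p.2, hp⟩)
  have hexp : ∀ x ∈ V, ∃ r : Fin (Module.finrank ℂ V) → ℂ, x = ∑ i, r i • (b i : H) := by
    intro x hx
    refine ⟨fun i => b.repr ⟨x, hx⟩ i, ?_⟩
    have := congrArg V.subtype (b.sum_repr ⟨x, hx⟩)
    simpa using this.symm
  choose! r hr using hexp
  refine ⟨_, fun i => (b i : H), fun i => ∑ p ∈ S, r p.1 i • p.2, ?_, ?_⟩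
  · intro i j
    have := orthonormal_iff_ite.mp b.orthonormal i j
    exact this
  · rw [hS]
    calc ∑ p ∈ S, p.1 ⊗ₜ[ℂ] p.2
        = ∑ p ∈ S, ∑ i, (b i : H) ⊗ₜ[ℂ] (r p.1 i • p.2) := by
          refine Finset.sum_congr rfl fun p hp => ?_
          conv_lhs => rw [hr p.1 (hmem p hp), TensorProduct.sum_tmul]
          simp [TensorProduct.smul_tmul]
      _ = _ := by
          rw [Finset.sum_comm]
          simp [TensorProduct.tmul_sum]

/-- For every `x` there are finitely many `uᵢ` spanning `x` with `∑ uᵢ* uᵢ` a scalar. -/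
lemma exists_bounded_expansion (x : H) :
    ∃ (n : ℕ) (c : Fin n → ℂ) (w : Fin n → H), x = ∑ i, c i • w i ∧
      ∑ i, star (w i) * w i = haar H (star x * x) • (1 : H) := by
  obtain ⟨n, e, w, he, hw⟩ := exists_orthonormal_expansion (comul (R := ℂ) x)
  refine ⟨n, fun i => counit (R := ℂ) (e i), w, ?_, ?_⟩
  · have h1 := rTensor_counit_comul (R := ℂ) x
    rw [hw] at h1
    have h2 := congrArg (TensorProduct.lid ℂ H) h1
    simpa using h2.symm
  · rw [← (haar_spec H).left_invariant, Bialgebra.comul_mul, CompactQuantumGroup.comul_star, hw]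
    simp [Finset.sum_mul, Finset.mul_sum, star_sum, TensorProduct.star_tmul, he]

end Haar

section HilbertModule
/-- The slice map `f ⊗ ι : ℂ[G] ⊗ A → A`. -/
def slice {H : Type u} [Ring H] [Algebra ℂ H] {A : Type w} [CStarAlgebra A] (f : H →ₗ[ℂ] ℂ) : H ⊗[ℂ] A →ₗ[ℂ] A :=
  (TensorProduct.lid ℂ A).toLinearMap ∘ₗ f.rTensor A

@[simp] lemma slice_tmul {H : Type u} [Ring H] [Algebra ℂ H] {A : Type w} [CStarAlgebra A]
    (f : H →ₗ[ℂ] ℂ) (x : H) (a : A) :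
    slice f (x ⊗ₜ[ℂ] a) = f x • a := by simp [slice]

variable {H : Type u} [Ring H] [StarRing H] [HopfAlgebra ℂ H] [StarModule ℂ H]
  [CompactQuantumGroup H] {A : Type w} [CStarAlgebra A]

/-- The `A`-valued inner product `⟪y, z⟫ = (h ⊗ ι)(y* z)` on `ℂ[G] ⊗ A`. -/
def modInner (y z : H ⊗[ℂ] A) : A := slice (haar H) (star y * z)

lemma modInner_tmul (x y : H) (a b : A) :
    modInner (x ⊗ₜ[ℂ] a) (y ⊗ₜ[ℂ] b) = haar H (star x * y) • (star a * b) := by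
  simp [modInner]

lemma modInner_add_right (x y z : H ⊗[ℂ] A) :
    modInner x (y + z) = modInner x y + modInner x z := by simp [modInner, mul_add]

lemma modInner_add_left (x y z : H ⊗[ℂ] A) :
    modInner (x + y) z = modInner x z + modInner y z := by simp [modInner, add_mul]

lemma modInner_sub_right (x y z : H ⊗[ℂ] A) :
    modInner x (y - z) = modInner x y - modInner x z := by simp [modInner, mul_sub]

lemma modInner_sub_left (x y z : H ⊗[ℂ] A) :
    modInner (x - y) z = modInner x z - modInner y z := by simp [modInner, sub_mul]

lemma modInner_smul_right (c : ℂ) (x y : H ⊗[ℂ] A) :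
    modInner x (c • y) = c • modInner x y := by simp [modInner]

lemma modInner_smul_left (c : ℂ) (x y : H ⊗[ℂ] A) :
    modInner (c • x) y = star c • modInner x y := by simp [modInner, star_smul]

lemma star_slice_haar (z : H ⊗[ℂ] A) :
    star (slice (haar H) z) = slice (haar H) (star z) := by
  induction z using TensorProduct.induction_on with
  | zero => simp
  | add x y hx hy => simp only [map_add, star_add, hx, hy]
  | tmul x a => simp [haar_star, star_smul]

lemma star_modInner (y z : H ⊗[ℂ] A) : star (modInner y z) = modInner z y := by
  simp [modInner, star_slice_haar]

lemma modInner_mul_left (x y z : H ⊗[ℂ] A) : modInner (x * y) z = modInner y (star x * z) := by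
  simp [modInner, mul_assoc]

lemma modInner_mul_right_tmul (y z : H ⊗[ℂ] A) (a : A) :
    modInner y (z * ((1 : H) ⊗ₜ[ℂ] a)) = modInner y z * a := by
  have : ∀ t : H ⊗[ℂ] A, slice (haar H) (t * ((1 : H) ⊗ₜ[ℂ] a)) = slice (haar H) t * a := by
    intro t
    induction t using TensorProduct.induction_on with
    | zero => simp
    | add x y hx hy => simp only [map_add, add_mul, hx, hy]
    | tmul x b => simp
  simp only [modInner, ← mul_assoc, this]

lemma modInner_expansion {n : ℕ} {e : Fin n → H}
    (he : ∀ i j, haar H (star (e i) * e j) = if i = j then 1 else 0) (a b : Fin n → A) :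
    modInner (∑ i, e i ⊗ₜ[ℂ] a i) (∑ i, e i ⊗ₜ[ℂ] b i) = ∑ i, star (a i) * b i := by
  simp [modInner, star_sum, Finset.sum_mul, Finset.mul_sum, he]

section order
attribute [local instance] CStarAlgebra.spectralOrder CStarAlgebra.spectralOrderedRing

lemma modInner_self_nonneg (z : H ⊗[ℂ] A) : 0 ≤ modInner z z := by
  obtain ⟨n, e, a, he, rfl⟩ := exists_orthonormal_expansion z
  rw [modInner_expansion he]
  exact Finset.sum_nonneg fun i _ => star_mul_self_nonneg _

lemma modInner_self_eq_zero {z : H ⊗[ℂ] A} (hz : modInner z z = 0) : z = 0 := by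
  obtain ⟨n, e, a, he, rfl⟩ := exists_orthonormal_expansion z
  rw [modInner_expansion he,
    Finset.sum_eq_zero_iff_of_nonneg (fun i _ => star_mul_self_nonneg _)] at hz
  refine Finset.sum_eq_zero fun i hi => ?_
  rw [(CStarRing.star_mul_self_eq_zero_iff _).mp (hz i hi), TensorProduct.tmul_zero]

/-- The Cauchy–Schwarz inequality. -/
lemma norm_modInner_sq_le (y z : H ⊗[ℂ] A) :
    ‖modInner y z‖ ^ 2 ≤ ‖modInner y y‖ * ‖modInner z z‖ := by
  rcases eq_or_ne (modInner y y) 0 with h | h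
  · rw [modInner_self_eq_zero h]; simp [modInner]
  set N := ‖modInner y y‖ with hN
  have hNpos : 0 < N := norm_pos_iff.mpr h
  set g := modInner y z with hg
  have hzy : modInner z y = star g := by rw [hg, star_modInner]
  have hlin : ∀ (p q : H ⊗[ℂ] A) (a : A), modInner (p * ((1 : H) ⊗ₜ[ℂ] a)) q =
      star a * modInner p q := by
    intro p q a
    rw [← star_modInner, modInner_mul_right_tmul, star_mul, star_modInner]
  have h1 : (0 : A) ≤ (N : ℂ) • (star g * g) - 2 • ((N : ℂ) • (star g * g)) +
      (N : ℂ) • ((N : ℂ) • modInner z z) := by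
    have h2 := modInner_self_nonneg (y * ((1 : H) ⊗ₜ[ℂ] g) - (N : ℂ) • z)
    have h3 : star g * modInner y y * g ≤ (N : ℂ) • (star g * g) := by
      have := CStarAlgebra.star_left_conjugate_le_norm_smul (a := g) (b := modInner y y)
        (hb := star_modInner y y)
      rw [← hN] at this
      simpa using this
    have h4 : modInner (y * ((1 : H) ⊗ₜ[ℂ] g) - (N : ℂ) • z)
        (y * ((1 : H) ⊗ₜ[ℂ] g) - (N : ℂ) • z) = star g * modInner y y * g -
        2 • ((N : ℂ) • (star g * g)) + (N : ℂ) • ((N : ℂ) • modInner z z) := by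
      have hs : star (N : ℂ) = N := by simp
      simp only [modInner_sub_left, modInner_sub_right, modInner_smul_left, modInner_smul_right,
        hlin, modInner_mul_right_tmul, hzy, ← hg, hs, smul_mul_assoc, sub_mul, smul_sub, two_smul, mul_assoc]
      abel
    rw [h4] at h2
    refine h2.trans ?_
    gcongr
  have h5 : star g * g ≤ (N : ℂ) • modInner z z := by
    have h6 : (N : ℂ) • (star g * g) ≤ (N : ℂ) • ((N : ℂ) • modInner z z) := by
      rw [two_smul] at h1
      rw [← sub_nonneg]
      convert h1 using 1
      abel
    have h7 : (0 : ℝ) ≤ N⁻¹ := by positivity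
    have h8 := smul_le_smul_of_nonneg_left h6 h7
    have h9 : ∀ b : A, N⁻¹ • ((N : ℂ) • b) = b := by
      intro b
      rw [Complex.coe_smul, smul_smul, inv_mul_cancel₀ hNpos.ne', one_smul]
    rwa [h9, h9] at h8
  have h10 := CStarAlgebra.norm_le_norm_of_nonneg_of_le (star_mul_self_nonneg g) h5
  rw [CStarRing.norm_star_mul_self, norm_smul] at h10
  simp only [Complex.norm_real, Real.norm_eq_abs, abs_of_pos hNpos] at h10
  rw [sq]; exact h10

/-- The norm `‖(h ⊗ ι)(z* z)‖^{1/2}` on `ℂ[G] ⊗ A`. -/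
def modNorm (z : H ⊗[ℂ] A) : ℝ := √‖modInner z z‖

lemma modNorm_sq (z : H ⊗[ℂ] A) : modNorm z ^ 2 = ‖modInner z z‖ :=
  Real.sq_sqrt (norm_nonneg _)

lemma modNorm_nonneg (z : H ⊗[ℂ] A) : 0 ≤ modNorm z := Real.sqrt_nonneg _

lemma norm_modInner_le (y z : H ⊗[ℂ] A) : ‖modInner y z‖ ≤ modNorm y * modNorm z := by
  refine abs_le_of_sq_le_sq' ?_ (mul_nonneg (modNorm_nonneg _) (modNorm_nonneg _)) |>.2
  rw [mul_pow, modNorm_sq, modNorm_sq]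
  exact norm_modInner_sq_le y z

lemma modNorm_add_le (y z : H ⊗[ℂ] A) : modNorm (y + z) ≤ modNorm y + modNorm z := by
  refine abs_le_of_sq_le_sq' ?_ (add_nonneg (modNorm_nonneg _) (modNorm_nonneg _)) |>.2
  rw [modNorm_sq, modInner_add_left, modInner_add_right, modInner_add_right]
  have h1 := norm_add_le (modInner y y + modInner y z) (modInner z y + modInner z z)
  have h2 := norm_add_le (modInner y y) (modInner y z)
  have h3 := norm_add_le (modInner z y) (modInner z z)
  have h4 := norm_modInner_le y z
  have h5 := norm_modInner_le z y
  have h6 := modNorm_sq y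
  have h7 := modNorm_sq z
  nlinarith

lemma modNorm_smul (c : ℂ) (z : H ⊗[ℂ] A) : modNorm (c • z) = ‖c‖ * modNorm z := by
  rw [modNorm, modInner_smul_left, modInner_smul_right, smul_smul, norm_smul, norm_mul, norm_star,
    Real.sqrt_mul (mul_self_nonneg _), Real.sqrt_mul_self (norm_nonneg _), modNorm]

lemma modNorm_eq_zero {z : H ⊗[ℂ] A} : modNorm z = 0 ↔ z = 0 := by
  constructor
  · intro h
    apply modInner_self_eq_zero
    rw [← norm_eq_zero, ← modNorm_sq, h]; simp
  · rintro rfl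
    simp [modNorm, modInner]

lemma modNorm_le_of_le {y z : H ⊗[ℂ] A} {r : ℝ} (hr : 0 ≤ r)
    (h : modInner y y ≤ (r ^ 2 : ℝ) • modInner z z) : modNorm y ≤ r * modNorm z := by
  refine abs_le_of_sq_le_sq' ?_ (mul_nonneg hr (modNorm_nonneg _)) |>.2
  rw [mul_pow, modNorm_sq, modNorm_sq]
  have := CStarAlgebra.norm_le_norm_of_nonneg_of_le (modInner_self_nonneg y) h
  rwa [norm_smul, Real.norm_eq_abs, abs_of_nonneg (sq_nonneg r)] at this

lemma modNorm_one_tmul_mul_le (a : A) (z : H ⊗[ℂ] A) :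
    modNorm (((1 : H) ⊗ₜ[ℂ] a) * z) ≤ ‖a‖ * modNorm z := by
  apply modNorm_le_of_le (norm_nonneg a)
  obtain ⟨n, e, b, he, rfl⟩ := exists_orthonormal_expansion z
  have h1 : ((1 : H) ⊗ₜ[ℂ] a) * ∑ i, e i ⊗ₜ[ℂ] b i = ∑ i, e i ⊗ₜ[ℂ] (a * b i) := by
    simp [Finset.mul_sum]
  rw [h1, modInner_expansion he, modInner_expansion he, Finset.smul_sum]
  refine Finset.sum_le_sum fun i _ => ?_
  have h2 := CStarAlgebra.star_left_conjugate_le_norm_smul (a := b i) (b := star a * a)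
    (hb := .star_mul_self a)
  rw [CStarRing.norm_star_mul_self, ← sq] at h2
  simpa [mul_assoc] using h2

lemma exists_bound_tmul_one_mul (x : H) :
    ∃ C : ℝ, ∀ z : H ⊗[ℂ] A, modNorm ((x ⊗ₜ[ℂ] (1 : A)) * z) ≤ C * modNorm z := by
  obtain ⟨n, c, y, hx, hy⟩ := exists_bounded_expansion x
  set r : ℝ := √(haar H (star x * x)).re with hr
  have hr2 : ((r ^ 2 : ℝ) : ℂ) = haar H (star x * x) := by
    have h0 := (haar_spec H).nonneg x
    rw [Complex.nonneg_iff] at h0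
    rw [hr, Real.sq_sqrt h0.1]
    exact Complex.ext (by simp) (by simpa using h0.2)
  have hb : ∀ (i : Fin n) (z : H ⊗[ℂ] A), modNorm ((y i ⊗ₜ[ℂ] (1 : A)) * z) ≤ r * modNorm z := by
    intro i z
    apply modNorm_le_of_le (Real.sqrt_nonneg _)
    have h1 : ∑ j, modInner ((y j ⊗ₜ[ℂ] (1 : A)) * z) ((y j ⊗ₜ[ℂ] (1 : A)) * z) =
        (r ^ 2 : ℝ) • modInner z z := by
      have h2 : ∀ j, modInner ((y j ⊗ₜ[ℂ] (1 : A)) * z) ((y j ⊗ₜ[ℂ] (1 : A)) * z) =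
          slice (haar H) (star z * (((star (y j) * y j) ⊗ₜ[ℂ] (1 : A)) * z)) := by
        intro j
        rw [modInner_mul_left, modInner]
        congr 2
        rw [← mul_assoc]
        simp
      simp_rw [h2]
      rw [← map_sum, ← Finset.mul_sum, ← Finset.sum_mul, ← TensorProduct.sum_tmul, hy, ← hr2]
      rw [← TensorProduct.smul_tmul', ← Algebra.TensorProduct.one_def, smul_mul_assoc, one_mul,
        mul_smul_comm, map_smul, Complex.coe_smul]
      rfl
    rw [← h1]
    exact Finset.single_le_sum (f := fun j =>
      modInner ((y j ⊗ₜ[ℂ] (1 : A)) * z) ((y j ⊗ₜ[ℂ] (1 : A)) * z))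
      (fun j _ => modInner_self_nonneg _) (Finset.mem_univ i)
  refine ⟨∑ i, ‖c i‖ * r, fun z => ?_⟩
  have h3 : (x ⊗ₜ[ℂ] (1 : A)) * z = ∑ i, c i • ((y i ⊗ₜ[ℂ] (1 : A)) * z) := by
    conv_lhs => rw [hx, TensorProduct.sum_tmul, Finset.sum_mul]
    simp [← TensorProduct.smul_tmul']
  rw [h3, Finset.sum_mul]
  refine (Finset.le_sum_of_subadditive modNorm (by simp [modNorm, modInner]) modNorm_add_le
    _ _).trans (Finset.sum_le_sum fun i _ => ?_)
  rw [modNorm_smul, mul_assoc]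
  exact mul_le_mul_of_nonneg_left (hb i z) (norm_nonneg _)

end order

/-- Left multiplication by an element of `ℂ[G] ⊗ A` is bounded. -/
lemma exists_bound_mul_left (x : H ⊗[ℂ] A) :
    ∃ C : ℝ, ∀ z : H ⊗[ℂ] A, modNorm (x * z) ≤ C * modNorm z := by
  induction x using TensorProduct.induction_on with
  | zero => exact ⟨0, fun z => by simp [modNorm, modInner]⟩
  | add x y hx hy =>
    obtain ⟨C, hC⟩ := hx
    obtain ⟨D, hD⟩ := hy
    refine ⟨C + D, fun z => ?_⟩
    rw [add_mul, add_mul]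
    exact (modNorm_add_le _ _).trans (add_le_add (hC z) (hD z))
  | tmul x a =>
    obtain ⟨C, hC⟩ := exists_bound_tmul_one_mul (A := A) x
    refine ⟨|C| * ‖a‖, fun z => ?_⟩
    have h1 : x ⊗ₜ[ℂ] a * z = (x ⊗ₜ[ℂ] (1 : A)) * (((1 : H) ⊗ₜ[ℂ] a) * z) := by
      rw [← mul_assoc]; simp
    rw [h1, mul_assoc]
    calc _ ≤ C * modNorm (((1 : H) ⊗ₜ[ℂ] a) * z) := hC _
      _ ≤ |C| * modNorm (((1 : H) ⊗ₜ[ℂ] a) * z) :=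
        mul_le_mul_of_nonneg_right (le_abs_self C) (modNorm_nonneg _)
      _ ≤ _ := mul_le_mul_of_nonneg_left (modNorm_one_tmul_mul_le a z) (abs_nonneg C)

end HilbertModule
section Completion
open UniformSpace
variable (X : Type u) [NormedRing X] [StarRing X] [NormedAlgebra ℂ X] [StarModule ℂ X]
  [CStarRing X]

lemma uniformContinuous_star_aux : UniformContinuous (star : X → X) :=
  (starₗᵢ ℂ : X ≃ₗᵢ⋆[ℂ] X).isometry.uniformContinuous

/-- The involution on the completion, extended by continuity. -/
abbrev completionStarRing : StarRing (Completion X) :=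
  have hu : UniformContinuous (star : X → X) := uniformContinuous_star_aux X
  have hc : Continuous (Completion.map (star : X → X)) := Completion.continuous_map
  { star := Completion.map star
    star_involutive := by
      intro x
      induction x using Completion.induction_on with
      | hp => exact isClosed_eq (by fun_prop) (by fun_prop)
      | ih x => rw [Completion.map_coe hu, Completion.map_coe hu, star_star]
    star_mul := by
      intro x y
      change Completion.map star (x * y) = Completion.map star y * Completion.map star x
      induction x, y using Completion.induction_on₂ with
      | hp => exact isClosed_eq (by fun_prop) (by fun_prop)
      | ih x y =>
        rw [← Completion.coe_mul, Completion.map_coe hu, Completion.map_coe hu,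
          Completion.map_coe hu, star_mul, Completion.coe_mul]
    star_add := by
      intro x y
      change Completion.map star (x + y) = Completion.map star x + Completion.map star y
      induction x, y using Completion.induction_on₂ with
      | hp => exact isClosed_eq (by fun_prop) (by fun_prop)
      | ih x y =>
        rw [← Completion.coe_add, Completion.map_coe hu, Completion.map_coe hu,
          Completion.map_coe hu, star_add, Completion.coe_add] }

lemma completion_norm_mul_self_le (x : Completion X) :
    ‖x‖ * ‖x‖ ≤ ‖Completion.map star x * x‖ := by
  have hc : Continuous (Completion.map (star : X → X)) := Completion.continuous_map
  induction x using Completion.induction_on with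
  | hp => exact isClosed_le (by fun_prop) (by fun_prop)
  | ih x =>
    rw [Completion.map_coe (uniformContinuous_star_aux X), ← Completion.coe_mul,
      Completion.norm_coe, Completion.norm_coe]
    exact CStarRing.norm_mul_self_le x

abbrev completionNormedAlgebra : NormedAlgebra ℂ (Completion X) where
  norm_smul_le := norm_smul_le

lemma completion_star_smul (c : ℂ) (x : Completion X) :
    Completion.map star (c • x) = star c • Completion.map star x := by
  have hc : Continuous (Completion.map (star : X → X)) := Completion.continuous_map
  have hu := uniformContinuous_star_aux X
  induction x using Completion.induction_on with
  | hp =>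
    exact isClosed_eq (hc.comp (continuous_const_smul c))
      ((continuous_const_smul (star c)).comp hc)
  | ih x =>
    rw [← Completion.coe_smul, Completion.map_coe hu, Completion.map_coe hu, star_smul,
      Completion.coe_smul]

/-- The completion of a pre-C*-algebra is a C*-algebra. -/
abbrev completionCStarAlgebra : CStarAlgebra (Completion X) where
  __ := completionStarRing X
  __ := completionNormedAlgebra X
  complete := (inferInstance : CompleteSpace (Completion X)).complete
  norm_mul_self_le := completion_norm_mul_self_le X
  star_smul := completion_star_smul X

end Completion

section MinTensor
variable (H : Type u) [Ring H] [StarRing H] [HopfAlgebra ℂ H] [StarModule ℂ H]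
  [CompactQuantumGroup H] (A : Type w) [CStarAlgebra A]

/-- The algebraic tensor product `ℂ[G] ⊗ A` as a pre-Hilbert `A`-module, a dense submodule of
`L²(G) ⊗ A`; the norm is `‖(h ⊗ ι)(z* z)‖^{1/2}`. -/
def PreHilbertModule := H ⊗[ℂ] A

instance : AddCommGroup (PreHilbertModule H A) := inferInstanceAs (AddCommGroup (H ⊗[ℂ] A))
instance : Module ℂ (PreHilbertModule H A) := inferInstanceAs (Module ℂ (H ⊗[ℂ] A))
instance : Norm (PreHilbertModule H A) := ⟨fun z => modNorm (H := H) (A := A) z⟩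

lemma preHilbertModule_core : NormedSpace.Core ℂ (PreHilbertModule H A) where
  norm_nonneg z := modNorm_nonneg (H := H) (A := A) z
  norm_smul c z := modNorm_smul (H := H) (A := A) c z
  norm_triangle y z := modNorm_add_le (H := H) (A := A) y z
  norm_eq_zero_iff _ := modNorm_eq_zero (H := H) (A := A)

instance : NormedAddCommGroup (PreHilbertModule H A) :=
  NormedAddCommGroup.ofCore (preHilbertModule_core H A)
instance : NormedSpace ℂ (PreHilbertModule H A) :=
  NormedSpace.ofCore (preHilbertModule_core H A)

/-- The algebraic tensor product `ℂ[G] ⊗ A`, as a `*`-algebra that acts on the pre-Hilbert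
module by left multiplication and carries the operator norm of this action, that is, the norm
of the minimal tensor product `C(G) ⊗ A` for the reduced C*-algebra `C(G)`. -/
def AlgTensor := H ⊗[ℂ] A

instance : Ring (AlgTensor H A) := inferInstanceAs (Ring (H ⊗[ℂ] A))
instance : StarRing (AlgTensor H A) := inferInstanceAs (StarRing (H ⊗[ℂ] A))
instance : Algebra ℂ (AlgTensor H A) := inferInstanceAs (Algebra ℂ (H ⊗[ℂ] A))
instance : StarModule ℂ (AlgTensor H A) := inferInstanceAs (StarModule ℂ (H ⊗[ℂ] A))

variable {H A} in
/-- Left multiplication by `x ∈ ℂ[G] ⊗ A` as a bounded operator. -/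
def leftMulCLM (x : AlgTensor H A) : PreHilbertModule H A →L[ℂ] PreHilbertModule H A :=
  LinearMap.mkContinuousOfExistsBound
    (LinearMap.mulLeft ℂ (A := H ⊗[ℂ] A) x : PreHilbertModule H A →ₗ[ℂ] PreHilbertModule H A)
    (exists_bound_mul_left (H := H) (A := A) x)

variable {H A} in
lemma leftMulCLM_apply (x : AlgTensor H A) (z : PreHilbertModule H A) :
    leftMulCLM x z = (show PreHilbertModule H A from (show H ⊗[ℂ] A from x) * (show H ⊗[ℂ] A from z)) :=
  rfl

/-- The representation of `ℂ[G] ⊗ A` by left multiplication. -/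
def leftMulHom : AlgTensor H A →ₐ[ℂ] (PreHilbertModule H A →L[ℂ] PreHilbertModule H A) where
  toFun := leftMulCLM
  map_one' := by
    ext z; exact one_mul (M := H ⊗[ℂ] A) z
  map_mul' x y := by
    ext z; exact mul_assoc (G := H ⊗[ℂ] A) x y z
  map_zero' := by
    ext z; exact zero_mul (M₀ := H ⊗[ℂ] A) z
  map_add' x y := by
    ext z; exact add_mul (R := H ⊗[ℂ] A) x y z
  commutes' c := by
    ext z
    exact (Algebra.smul_def (A := H ⊗[ℂ] A) c z).symm

lemma leftMulHom_injective : Function.Injective (leftMulHom H A) := by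
  intro x y hxy
  have h : (show H ⊗[ℂ] A from x) * 1 = (show H ⊗[ℂ] A from y) * 1 :=
    congrArg (fun T => T (show PreHilbertModule H A from (1 : H ⊗[ℂ] A))) hxy
  rwa [mul_one, mul_one] at h

instance : NormedRing (AlgTensor H A) :=
  NormedRing.induced _ _ (leftMulHom H A) (leftMulHom_injective H A)

lemma algTensor_norm_def (x : AlgTensor H A) : ‖x‖ = ‖leftMulHom H A x‖ := rfl

instance : NormedAlgebra ℂ (AlgTensor H A) where
  norm_smul_le c x := by
    rw [algTensor_norm_def, algTensor_norm_def, map_smul]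
    exact norm_smul_le c (leftMulHom H A x)

variable {H A} in
lemma modNorm_mul_le (x : AlgTensor H A) (z : H ⊗[ℂ] A) :
    modNorm ((show H ⊗[ℂ] A from x) * z) ≤ ‖x‖ * modNorm z :=
  (leftMulHom H A x).le_opNorm (show PreHilbertModule H A from z)

instance : CStarRing (AlgTensor H A) where
  norm_mul_self_le x := by
    have h1 : ‖x‖ ≤ √‖star x * x‖ := by
      refine ContinuousLinearMap.opNorm_le_bound _ (Real.sqrt_nonneg _) fun z => ?_
      change modNorm ((show H ⊗[ℂ] A from x) * (show H ⊗[ℂ] A from z)) ≤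
        _ * modNorm (show H ⊗[ℂ] A from z)
      refine abs_le_of_sq_le_sq' ?_ (mul_nonneg (Real.sqrt_nonneg _) (modNorm_nonneg _)) |>.2
      rw [mul_pow, Real.sq_sqrt (norm_nonneg _), modNorm_sq, modInner_mul_left, ← mul_assoc]
      refine (norm_modInner_le _ _).trans ?_
      have h2 := modNorm_mul_le (star x * x) (show H ⊗[ℂ] A from z)
      calc _ ≤ modNorm (show H ⊗[ℂ] A from z) *
          (‖star x * x‖ * modNorm (show H ⊗[ℂ] A from z)) :=
            mul_le_mul_of_nonneg_left h2 (modNorm_nonneg _)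
        _ = _ := by ring
    calc ‖x‖ * ‖x‖ ≤ √‖star x * x‖ * √‖star x * x‖ :=
          mul_self_le_mul_self (norm_nonneg x) h1
      _ = _ := Real.mul_self_sqrt (norm_nonneg _)

/-- The minimal (spatial) C*-tensor product `C(G) ⊗ A`, where `C(G)` is the reduced C*-algebra:
the completion of `ℂ[G] ⊗ A` in the norm of its action on the Hilbert `A`-module `L²(G) ⊗ A`,
on which `C(G) ⊗ A` is faithfully represented. For `A = ℂ` this is `C(G)` itself, the closure of
`ℂ[G]` in the GNS representation of `h`. -/
def MinTensor := UniformSpace.Completion (AlgTensor H A)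

instance : CStarAlgebra (MinTensor H A) := completionCStarAlgebra (AlgTensor H A)

variable {H A}

/-- The inclusion `ℂ[G] ⊗ A → C(G) ⊗ A`. -/
def ofAlg : H ⊗[ℂ] A →⋆ₐ[ℂ] MinTensor H A where
  toFun z := ((show AlgTensor H A from z : AlgTensor H A) :
    UniformSpace.Completion (AlgTensor H A))
  map_one' := rfl
  map_mul' x y := UniformSpace.Completion.coe_mul (α := AlgTensor H A) x y
  map_zero' := rfl
  map_add' x y := UniformSpace.Completion.coe_add (α := AlgTensor H A) x y
  commutes' _ := rfl
  map_star' x := (UniformSpace.Completion.map_coe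
    (starₗᵢ ℂ : AlgTensor H A ≃ₗᵢ⋆[ℂ] AlgTensor H A).isometry.uniformContinuous x).symm

/-- The map `z ↦ (ω ⊗ ι)(z)` on `ℂ[G] ⊗ A` for `ω = h(· x)`. -/
def preSlice (x : H) : AlgTensor H A →L[ℂ] A :=
  LinearMap.mkContinuous
    (slice (A := A) (haar H ∘ₗ LinearMap.mulRight ℂ x) : AlgTensor H A →ₗ[ℂ] A)
    (modNorm (1 : H ⊗[ℂ] A) * modNorm (x ⊗ₜ[ℂ] (1 : A)))
    (by
      intro z
      have h1 : slice (haar H ∘ₗ LinearMap.mulRight ℂ x) (show H ⊗[ℂ] A from z) =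
          modInner 1 ((show H ⊗[ℂ] A from z) * (x ⊗ₜ[ℂ] (1 : A))) := by
        have h2 : ∀ t : H ⊗[ℂ] A, slice (haar H ∘ₗ LinearMap.mulRight ℂ x) t =
            modInner 1 (t * (x ⊗ₜ[ℂ] (1 : A))) := by
          intro t
          induction t using TensorProduct.induction_on with
          | zero => simp [modInner]
          | add p q hp hq => rw [map_add, hp, hq, add_mul, modInner_add_right]
          | tmul c a => simp [modInner]
        exact h2 z
      change ‖slice (haar H ∘ₗ LinearMap.mulRight ℂ x) (show H ⊗[ℂ] A from z)‖ ≤ _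
      rw [h1, mul_assoc]
      refine (norm_modInner_le _ _).trans (mul_le_mul_of_nonneg_left ?_ (modNorm_nonneg _))
      rw [mul_comm]
      exact modNorm_mul_le z _)

/-- The slice map `ω ⊗ ι : C(G) ⊗ A → A` for the functional `ω = h(· x)` on `C(G)`. -/
def minSlice (x : H) : MinTensor H A →L[ℂ] A :=
  (preSlice x).extend (UniformSpace.Completion.toComplL (𝕜 := ℂ) (E := AlgTensor H A))

lemma minSlice_ofAlg (x c : H) (a : A) :
    minSlice x (ofAlg (c ⊗ₜ[ℂ] a)) = haar H (c * x) • a := by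
  have h := (preSlice (A := A) x).extend_eq
    (e := UniformSpace.Completion.toComplL (𝕜 := ℂ) (E := AlgTensor H A))
    (UniformSpace.Completion.denseRange_coe)
    (UniformSpace.Completion.isUniformInducing_coe _)
    (show AlgTensor H A from c ⊗ₜ[ℂ] a)
  refine h.trans ?_
  change slice (haar H ∘ₗ LinearMap.mulRight ℂ x) (c ⊗ₜ[ℂ] a) = _
  simp

end MinTensor
section Actions
variable (H : Type u) [Ring H] [StarRing H] [HopfAlgebra ℂ H] [StarModule ℂ H]
  [CompactQuantumGroup H]

variable {H} in
/-- A (continuous left) action `α : A → C(G) ⊗ A` of `G` on a unital C*-algebra `A`. -/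
structure IsAction {A : Type w} [CStarAlgebra A] (α : A →⋆ₐ[ℂ] MinTensor H A) : Prop where
  injective : Function.Injective α
  /-- `(ι ⊗ α) α = (Δ ⊗ ι) α`. Here `Φ = ι ⊗ α` and `Ψ = Δ ⊗ ι` are the continuous extensions
  to `C(G) ⊗ A` of the maps on `ℂ[G] ⊗ A`; being continuous, they are determined by these. -/
  coassociative : ∃ Φ Ψ : MinTensor H A →L[ℂ] MinTensor H (MinTensor H A),
    (∀ (x : H) (a : A), Φ (ofAlg (x ⊗ₜ[ℂ] a)) = ofAlg (x ⊗ₜ[ℂ] α a)) ∧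
    (∀ (x : H) (a : A), Ψ (ofAlg (x ⊗ₜ[ℂ] a)) =
      ofAlg ((ofAlg.toLinearMap ∘ₗ (TensorProduct.mk ℂ H A).flip a).lTensor H
        (comul (R := ℂ) x))) ∧
    ∀ a : A, Φ (α a) = Ψ (α a)
  /-- The Podleś condition: `(C(G) ⊗ 1) α(A)` spans a dense subspace of `C(G) ⊗ A`. (As `ℂ[G]`
  is dense in `C(G)`, it does not matter that only `x ∈ ℂ[G]` is used.) -/
  podles : Dense (Submodule.span ℂ
    {t : MinTensor H A | ∃ (x : H) (a : A), t = ofAlg (x ⊗ₜ[ℂ] (1 : A)) * α a} :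
      Set (MinTensor H A))

variable {H} in
/-- A right action of the dual discrete quantum group `Ĝ` on a unital C*-algebra `A`, given by
the corresponding left `ℂ[G]`-module algebra structure `x ▷ a = (ι ⊗ x)β(a)` with
`x ▷ a* = (S(x)* ▷ a)*`. -/
structure IsDualAction {A : Type w} [CStarAlgebra A] (act : H →ₗ[ℂ] A →ₗ[ℂ] A) : Prop where
  one_act : ∀ a : A, act 1 a = a
  mul_act : ∀ (x y : H) (a : A), act (x * y) a = act x (act y a)
  act_one : ∀ x : H, act x 1 = counit (R := ℂ) x • (1 : A)
  act_mul : ∀ (x : H) (a b : A), act x (a * b) =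
    LinearMap.mul' ℂ A (TensorProduct.map (act.flip a) (act.flip b) (comul (R := ℂ) x))
  act_star : ∀ (x : H) (a : A), act x (star a) = star (act (star (antipode ℂ x)) a)

/-- A (nonzero) unital Yetter–Drinfeld `G`-C*-algebra, that is, a unital C*-algebra with an
action of the Drinfeld double `D(G)`. -/
structure YDAlgebra where
  carrier : Type w
  [cstarAlgebra : CStarAlgebra carrier]
  [nontrivial : Nontrivial carrier]
  /-- the action of `G` -/
  α : carrier →⋆ₐ[ℂ] MinTensor H carrier
  isAction : IsAction α
  /-- the action of `Ĝ`, `act x a = x ▷ a` -/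
  act : H →ₗ[ℂ] carrier →ₗ[ℂ] carrier
  isDualAction : IsDualAction act
  /-- The Yetter–Drinfeld condition
  `α(x ▷ a) = x₍₁₎ a₍₁₎ S(x₍₃₎) ⊗ (x₍₂₎ ▷ a₍₂₎)` for all `x ∈ ℂ[G]` and all regular `a`. -/
  yetterDrinfeld : ∀ (x : H) (a : carrier) (n : ℕ) (x₁ x₂ x₃ : Fin n → H)
    (m : ℕ) (a₁ : Fin m → H) (a₂ : Fin m → carrier),
    (comul (R := ℂ)).lTensor H (comul (R := ℂ) x) =
      ∑ i, x₁ i ⊗ₜ[ℂ] (x₂ i ⊗ₜ[ℂ] x₃ i) →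
    α a = ofAlg (∑ j, a₁ j ⊗ₜ[ℂ] a₂ j) →
    α (act x a) = ofAlg (∑ i, ∑ j,
      (x₁ i * a₁ j * antipode ℂ (x₃ i)) ⊗ₜ[ℂ] act (x₂ i) (a₂ j))

attribute [instance] YDAlgebra.cstarAlgebra YDAlgebra.nontrivial

instance : CoeSort (YDAlgebra.{u, w} H) (Type w) := ⟨YDAlgebra.carrier⟩

end Actions

section CompletelyPositive
open scoped CStarAlgebra
attribute [local instance] CStarAlgebra.spectralOrder CStarAlgebra.spectralOrderedRing
variable {A : Type v} {B : Type w} [CStarAlgebra A] [CStarAlgebra B]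

/-- Unital completely positive maps. -/
def IsUCP (φ : A →ₗ[ℂ] B) : Prop :=
  φ 1 = 1 ∧ ∃ ψ : A →CP B, ψ.toLinearMap = φ

/-- Completely isometric maps. -/
def IsCompletelyIsometric (φ : A →ₗ[ℂ] B) : Prop :=
  ∀ (k : ℕ) (M : CStarMatrix (Fin k) (Fin k) A), ‖M.map φ‖ = ‖M‖

end CompletelyPositive

namespace YDAlgebra
variable {H : Type u} [Ring H] [StarRing H] [HopfAlgebra ℂ H] [StarModule ℂ H]
  [CompactQuantumGroup H]

/-- The right `c_c(Ĝ)`-module structure `a ◂ ω = (ω ⊗ ι)α(a)`, where `ω = h(· x)`, `x ∈ ℂ[G]`. -/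
def dualAct (A : YDAlgebra.{u, w} H) (a : A) (x : H) : A := minSlice x (A.α a)

/-- `D(G)`-equivariance: `φ` is both a `c_c(Ĝ)`-module map and a `ℂ[G]`-module map. -/
structure IsEquivariant {A : YDAlgebra.{u, v} H} {B : YDAlgebra.{u, w} H}
    (φ : A →ₗ[ℂ] B) : Prop where
  map_dualAct : ∀ (a : A) (x : H), φ (A.dualAct a x) = B.dualAct (φ a) x
  map_act : ∀ (x : H) (a : A), φ (A.act x a) = B.act x (φ a)

/-- `A` is `D(G)`-injective. -/
def IsInjective (A : YDAlgebra.{u, w} H) : Prop :=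
  ∀ (B C : YDAlgebra.{u, w} H) (φ : B →ₗ[ℂ] C) (ψ : B →ₗ[ℂ] A),
    IsUCP φ → IsEquivariant φ → IsCompletelyIsometric φ → IsUCP ψ → IsEquivariant ψ →
    ∃ ψ' : C →ₗ[ℂ] A, IsUCP ψ' ∧ IsEquivariant ψ' ∧ ψ' ∘ₗ φ = ψ

/-- `A` is a `D(G)`-boundary. -/
def IsBoundary (A : YDAlgebra.{u, w} H) : Prop :=
  ∀ (B : YDAlgebra.{u, w} H) (ψ : A →ₗ[ℂ] B),
    IsUCP ψ → IsEquivariant ψ → IsCompletelyIsometric ψ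

/-- `A` is a Furstenberg–Hamana boundary of `D(G)`. -/
structure IsFHBoundary (A : YDAlgebra.{u, w} H) : Prop where
  isBoundary : A.IsBoundary
  isInjective : A.IsInjective

/-- Isomorphism of Yetter–Drinfeld `G`-C*-algebras. -/
def Isomorphic (A B : YDAlgebra.{u, w} H) : Prop :=
  ∃ e : A ≃⋆ₐ[ℂ] B, IsEquivariant (A := A) (B := B) (e : A →ₗ[ℂ] B)

/-- `a` is regular: `α(a)` lies in the algebraic tensor product `ℂ[G] ⊗ A`. -/
def IsRegular (A : YDAlgebra.{u, w} H) (a : A) : Prop :=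
  ∃ z : H ⊗[ℂ] A, A.α a = ofAlg z

/-- Braided commutativity: `ab = b₍₂₎ (S⁻¹(b₍₁₎) ▷ a)` for all regular `a` and `b`, where
`S⁻¹(x) = S(x*)*`. -/
def IsBraidedCommutative (A : YDAlgebra.{u, w} H) : Prop :=
  ∀ (a b : A), A.IsRegular a → ∀ (m : ℕ) (b₁ : Fin m → H) (b₂ : Fin m → A),
    A.α b = ofAlg (∑ j, b₁ j ⊗ₜ[ℂ] b₂ j) →
    a * b = ∑ j, b₂ j * A.act (star (antipode ℂ (star (b₁ j)))) a

end YDAlgebra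

end

end QG

/-! The proof realises the boundary inside one concrete algebra, `regYD H`: the norm closure of the
regular part of ℓ^∞(Ĝ). Here ℓ^∞(Ĝ) is the algebra `LInf H` of bounded operators on L²(G) of the
form x ↦ x₍₁₎f(x₍₂₎), and the functional f on ℂ[G] is called the symbol. The action of ℂ[G] is f ↦
f(· y), and the coaction of G sends f to x ↦ S(x₍₁₎)f(x₍₂₎)x₍₃₎ (`coact`). In Hopf-algebraic form it
is implemented by the fundamental isometry, which gives its boundedness.

The decisive fact is that D(G)-equivariant ucp maps B → `regYD H` are the same as G-invariant states
of B. A map φ gives the state obtained by evaluating the symbol of φ(b) at 1, and equivariance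
recovers φ from it because the symbol of φ(b) at v is the value of that state at v ▷ b
(`symbol_apply_of_isEquivariant`). Conversely, an invariant state θ gives the Poisson map b ↦ θ(· ▷
b) (`IsInvariantState.exists_poissonMap`); its boundedness and complete positivity rest on strong
invariance of the Haar state, and its G-equivariance on the Yetter–Drinfeld condition.

Two consequences follow. Every Yetter–Drinfeld algebra maps equivariantly to `regYD H`, since states
exist and can be averaged with the Haar state. Moreover `regYD H` is injective: extend the
associated state by Hahn–Banach and average it (`regYD_exists_extension`).

The equivariant ucp self-maps of `regYD H` form a monoid that is compact in the topology of
pointwise convergence of the associated states, and multiplication is continuous in its left factor.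
Every r has some c with c r = c, by Cesàro means. An element p of a minimal closed left ideal then
satisfies p s p = p for all s (`exists_mul_mul_eq_self`). Its range with the Choi–Effros product is
a Yetter–Drinfeld algebra A₀ whose only equivariant ucp self-map is the identity.

This rigidity gives everything else. A₀ is injective as a retract of `regYD H`. It is a boundary
because any map A₀ → B can be followed by B → `regYD H` → A₀, and the composition is the identity. A
Furstenberg–Hamana boundary A maps completely isometrically to A₀; injectivity of A provides a left
inverse and rigidity of A₀ makes it two-sided. Braided commutativity is a symbol computation in
`regYD H` (`RegInf.braidedCommutative`) that survives passage to a retract. -/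

namespace QG
noncomputable section
open scoped TensorProduct ComplexOrder CStarAlgebra
open Coalgebra HopfAlgebra

/-! ### Completely positive maps and the Kadison–Schwarz inequality -/

section CompletePositivity
attribute [local instance] CStarAlgebra.spectralOrder CStarAlgebra.spectralOrderedRing

/-- A self-adjoint element is positive if it is positive under a family of positive maps that
separates points and is stable under conjugation. -/
lemma nonneg_of_separating {D E : Type*} [CStarAlgebra D] [CStarAlgebra E] {J : Type*}
    (F : J → D →ₗ[ℂ] E)
    (hconj : ∀ j c, ∃ j', ∀ d, F j (star c * d * c) = F j' d)
    (hpos : ∀ j d, 0 ≤ F j (star d * d))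
    (hsep : ∀ d, (∀ j, F j (star d * d) = 0) → d = 0)
    {X : D} (hX : IsSelfAdjoint X) (h : ∀ j, 0 ≤ F j X) : 0 ≤ X := by
  have hN : 0 ≤ X⁻ := CFC.negPart_nonneg X
  obtain ⟨s, hs⟩ := CStarAlgebra.nonneg_iff_eq_star_mul_self.mp hN
  have hNs : star X⁻ = X⁻ := (IsSelfAdjoint.of_nonneg hN)
  -- Compressing X by its negative part gives −(X⁻)³. Every `F j` sends this to an element that is ≤
  -- 0, while stability under conjugation makes it ≥ 0.
  have h1 : star X⁻ * X * X⁻ = - (star (s * X⁻) * (s * X⁻)) := by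
    have h2 : X * X⁻ = - (X⁻ * X⁻) := by
      have h3 := congrArg (· * X⁻) (CFC.posPart_sub_negPart X hX)
      simpa [sub_mul, CFC.posPart_mul_negPart] using h3.symm
    rw [mul_assoc, h2, star_mul, hNs, mul_assoc, ← mul_assoc (star s), ← hs]
    simp
  have h3 : s * X⁻ = 0 := by
    apply hsep
    intro j
    obtain ⟨j', hj'⟩ := hconj j X⁻
    have h4 := h j'
    rw [← hj', h1, map_neg] at h4
    exact le_antisymm (neg_nonneg.mp h4) (hpos j _)
  have h5 : star X⁻ * X⁻ = 0 := by
    rw [hNs]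
    nth_rw 1 [hs]
    rw [mul_assoc, h3, mul_zero]
  have h6 : X⁻ = 0 := (CStarRing.star_mul_self_eq_zero_iff _).mp h5
  rw [← CFC.posPart_sub_negPart X hX, h6, sub_zero]
  exact CFC.posPart_nonneg X

variable {A : Type*} {B : Type*} {C : Type*} [CStarAlgebra A] [CStarAlgebra B] [CStarAlgebra C]

lemma sum_star_mul_self_nonneg {ι : Type*} [Fintype ι] (a : ι → A) :
    0 ≤ ∑ i, star (a i) * a i := Finset.sum_nonneg fun _ _ => star_mul_self_nonneg _

lemma sum_star_mul_self_eq_zero {ι : Type*} [Fintype ι] {a : ι → A}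
    (h : ∑ i, star (a i) * a i = 0) (i : ι) : a i = 0 := by
  rw [Finset.sum_eq_zero_iff_of_nonneg (fun i _ => star_mul_self_nonneg _)] at h
  exact (CStarRing.star_mul_self_eq_zero_iff _).mp (h i (Finset.mem_univ i))

lemma exists_star_mul_self_of_nonneg {a : A} (ha : 0 ≤ a) : ∃ s, a = star s * s :=
  CStarAlgebra.nonneg_iff_eq_star_mul_self.mp ha

/-- The form `M ↦ ∑ bᵢ* Mᵢⱼ cⱼ`. -/
def matrixForm {n : Type*} [Fintype n] (b c : n → A) : CStarMatrix n n A →ₗ[ℂ] A where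
  toFun M := ∑ i, ∑ j, star (b i) * M i j * c j
  map_add' M N := by simp [mul_add, add_mul, Finset.sum_add_distrib]
  map_smul' c M := by simp [Finset.smul_sum]

lemma matrixForm_apply {n : Type*} [Fintype n] (b c : n → A) (M : CStarMatrix n n A) :
    matrixForm b c M = ∑ i, ∑ j, star (b i) * M i j * c j := rfl

lemma matrixForm_eq_dotProduct {n : Type*} [Fintype n] (b c : n → A) (M : CStarMatrix n n A) :
    matrixForm b c M = star b ⬝ᵥ (Matrix.mulVec (CStarMatrix.ofMatrix.symm M) c) := by
  simp [matrixForm_apply, dotProduct, Matrix.mulVec, Finset.mul_sum, mul_assoc]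

lemma matrixForm_conj {n : Type*} [Fintype n] (b c : n → A) (M N K : CStarMatrix n n A) :
    matrixForm b c (star N * M * K) =
      matrixForm (fun i => ∑ j, N i j * b j) (fun i => ∑ j, K i j * c j) M := by
  rw [matrixForm_eq_dotProduct, matrixForm_eq_dotProduct]
  change star b ⬝ᵥ Matrix.mulVec ((CStarMatrix.ofMatrix.symm N).conjTranspose *
    CStarMatrix.ofMatrix.symm M * CStarMatrix.ofMatrix.symm K) c =
    star (Matrix.mulVec (CStarMatrix.ofMatrix.symm N) b) ⬝ᵥ
      Matrix.mulVec (CStarMatrix.ofMatrix.symm M) (Matrix.mulVec (CStarMatrix.ofMatrix.symm K) c)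
  rw [Matrix.star_mulVec, ← Matrix.dotProduct_mulVec, Matrix.mulVec_mulVec, Matrix.mulVec_mulVec,
    Matrix.mul_assoc]

lemma matrixForm_star_mul {n : Type*} [Fintype n] (b c : n → A) (N K : CStarMatrix n n A) :
    matrixForm b c (star N * K) = ∑ m, star (∑ i, N m i * b i) * (∑ i, K m i * c i) := by
  rw [matrixForm_eq_dotProduct]
  change star b ⬝ᵥ Matrix.mulVec ((CStarMatrix.ofMatrix.symm N).conjTranspose *
    CStarMatrix.ofMatrix.symm K) c =
    star (Matrix.mulVec (CStarMatrix.ofMatrix.symm N) b) ⬝ᵥ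
      (Matrix.mulVec (CStarMatrix.ofMatrix.symm K) c)
  rw [Matrix.star_mulVec, ← Matrix.dotProduct_mulVec, Matrix.mulVec_mulVec]

/-- The forms b*Xb are permuted by conjugation, and their values at unit vectors detect the columns
of a matrix, so `nonneg_of_separating` applies. -/
lemma matrix_nonneg_of_form {k : Type*} [Fintype k] [DecidableEq k] {X : CStarMatrix k k A}
    (hX : IsSelfAdjoint X) (h : ∀ b : k → A, 0 ≤ matrixForm b b X) : 0 ≤ X := by
  refine nonneg_of_separating (fun b : k → A => matrixForm b b) (fun b N => ⟨_, fun M =>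
    matrixForm_conj b b M N N⟩) (fun b N => ?_) (fun N hN => ?_) hX h
  · rw [matrixForm_star_mul]; exact sum_star_mul_self_nonneg _
  · ext m i
    have := hN (Pi.single i 1)
    rw [matrixForm_star_mul] at this
    simpa [Pi.single_apply] using sum_star_mul_self_eq_zero this m

lemma matrixForm_nonneg {k : Type*} [Fintype k] [DecidableEq k] {X : CStarMatrix k k A}
    (hX : 0 ≤ X) (b : k → A) : 0 ≤ matrixForm b b X := by
  obtain ⟨N, rfl⟩ := exists_star_mul_self_of_nonneg hX
  rw [matrixForm_star_mul]; exact sum_star_mul_self_nonneg _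

lemma map_star_of_nonneg {φ : A →ₗ[ℂ] B} (hφ : ∀ a, 0 ≤ φ (star a * a)) (a : A) :
    φ (star a) = star (φ a) := by
  have hφ' : ∀ a, 0 ≤ a → 0 ≤ φ a := by
    intro a ha
    obtain ⟨s, rfl⟩ := CStarAlgebra.nonneg_iff_eq_star_mul_self.mp ha
    exact hφ s
  exact map_star (PositiveLinearMap.mk₀ φ hφ') a

/-- Unital completely positive maps in terms of finite families. -/
lemma isUCP_iff {φ : A →ₗ[ℂ] B} : IsUCP φ ↔ φ 1 = 1 ∧
    ∀ (n : ℕ) (a : Fin n → A) (b : Fin n → B),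
      0 ≤ ∑ i, ∑ j, star (b i) * φ (star (a i) * a j) * b j := by
  constructor
  · rintro ⟨h1, ψ, rfl⟩
    refine ⟨h1, fun n a b => ?_⟩
    cases n with
    | zero => simp
    | succ n =>
    -- The matrix with first row a and zeros elsewhere: R*R has entries aᵢ*aⱼ.
    let R : CStarMatrix (Fin (n+1)) (Fin (n+1)) A :=
      CStarMatrix.ofMatrix (fun i j => if i = 0 then a j else 0)
    have h2 := ψ.map_cstarMatrix_nonneg' (n+1) (star R * R) (star_mul_self_nonneg R)
    have h3 := matrixForm_nonneg h2 b
    refine h3.trans_eq ?_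
    simp only [matrixForm_apply, CStarMatrix.map_apply]
    refine Finset.sum_congr rfl fun i _ => Finset.sum_congr rfl fun j _ => ?_
    congr 3
    rw [CStarMatrix.mul_apply, Finset.sum_eq_single 0]
    · rfl
    · intro m _ hm
      have : R m j = 0 := if_neg hm
      rw [this, mul_zero]
    · simp
  · rintro ⟨h1, h2⟩
    have hp : ∀ a, 0 ≤ φ (star a * a) := by
      intro a
      simpa using h2 1 (fun _ => a) (fun _ => 1)
    refine ⟨h1, ⟨φ, fun k M hM => ?_⟩, rfl⟩
    apply matrix_nonneg_of_form
    · have : star M = M := IsSelfAdjoint.of_nonneg hM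
      ext i j
      simp only [CStarMatrix.star_apply, CStarMatrix.map_apply]
      rw [← map_star_of_nonneg hp, ← CStarMatrix.star_apply, this]
    · intro b
      obtain ⟨N, rfl⟩ := exists_star_mul_self_of_nonneg hM
      -- N*N is the sum over the rows of N of matrices of the form (aᵢ*aⱼ), to which the hypothesis
      -- applies one row at a time.
      have : matrixForm b b ((star N * N).map φ) =
          ∑ m, ∑ i, ∑ j, star (b i) * φ (star (N m i) * N m j) * b j := by
        simp only [matrixForm_apply, CStarMatrix.map_apply, CStarMatrix.mul_apply,
          CStarMatrix.star_apply, map_sum, Finset.mul_sum, Finset.sum_mul]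
        rw [Finset.sum_congr rfl fun i _ => Finset.sum_comm]
        rw [Finset.sum_comm]
      rw [this]
      exact Finset.sum_nonneg fun m _ => h2 k (fun i => N m i) b

namespace IsUCP
variable {φ : A →ₗ[ℂ] B}

lemma form_nonneg (hφ : IsUCP φ) {ι : Type*} [Fintype ι] (a : ι → A) (b : ι → B) :
    0 ≤ ∑ i, ∑ j, star (b i) * φ (star (a i) * a j) * b j := by
  let e := Fintype.equivFin ι
  have := (isUCP_iff.mp hφ).2 _ (a ∘ e.symm) (b ∘ e.symm)
  refine this.trans_eq ?_
  rw [← e.sum_comp]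
  refine Finset.sum_congr rfl fun i _ => ?_
  rw [← e.sum_comp]
  simp

lemma map_star_mul_self_nonneg (hφ : IsUCP φ) (a : A) : 0 ≤ φ (star a * a) := by
  simpa using hφ.form_nonneg (fun _ : Fin 1 => a) (fun _ => 1)

lemma map_nonneg (hφ : IsUCP φ) {a : A} (ha : 0 ≤ a) : 0 ≤ φ a := by
  obtain ⟨s, rfl⟩ := CStarAlgebra.nonneg_iff_eq_star_mul_self.mp ha
  exact hφ.map_star_mul_self_nonneg s

lemma mono (hφ : IsUCP φ) {a b : A} (h : a ≤ b) : φ a ≤ φ b := by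
  rw [← sub_nonneg, ← map_sub]; exact hφ.map_nonneg (sub_nonneg.mpr h)

lemma map_star (hφ : IsUCP φ) (a : A) : φ (star a) = star (φ a) :=
  map_star_of_nonneg hφ.map_star_mul_self_nonneg a

/-- The Kadison–Schwarz inequality for finite families. -/
lemma schwarz_sum (hφ : IsUCP φ) {ι : Type*} [Fintype ι] (a : ι → A) (b : ι → B) :
    star (∑ i, φ (a i) * b i) * (∑ i, φ (a i) * b i) ≤
      ∑ i, ∑ j, star (b i) * φ (star (a i) * a j) * b j := by
  set X := ∑ i, φ (a i) * b i with hX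
  -- Completing the square: the extra index carries a = 1 and the coefficient −X.
  have h := hφ.form_nonneg (fun o : Option ι => o.elim 1 a) (fun o => o.elim (-X) b)
  have hsX : ∑ i, star (b i) * φ (star (a i)) = star X := by
    rw [hX, star_sum]
    refine Finset.sum_congr rfl fun i _ => ?_
    rw [star_mul, hφ.map_star]
  have h1 : ∑ i, star X * φ (a i) * b i = star X * X := by
    rw [hX, Finset.mul_sum]; simp only [mul_assoc]
  have h2 : ∑ i, star (b i) * φ (star (a i)) * X = star X * X := by
    rw [← Finset.sum_mul, hsX]
  simp only [Fintype.sum_option, Option.elim, star_one, one_mul, mul_one, hφ.1, star_neg,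
    neg_mul, mul_neg, Finset.sum_add_distrib, Finset.sum_neg_distrib, h1, h2] at h
  rw [← sub_nonneg]
  refine h.trans_eq ?_
  abel

lemma schwarz (hφ : IsUCP φ) (a : A) : star (φ a) * φ a ≤ φ (star a * a) := by
  simpa using hφ.schwarz_sum (fun _ : Fin 1 => a) (fun _ => 1)

lemma norm_le (hφ : IsUCP φ) (a : A) : ‖φ a‖ ≤ ‖a‖ := by
  have h1 : star (φ a) * φ a ≤ algebraMap ℝ B (‖a‖ ^ 2) := by
    refine (hφ.schwarz a).trans ((hφ.mono CStarAlgebra.star_mul_le_algebraMap_norm_sq).trans_eq ?_)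
    rw [Algebra.algebraMap_eq_smul_one, Algebra.algebraMap_eq_smul_one, ← Complex.coe_smul,
      map_smul, hφ.1, Complex.coe_smul]
  have h2 := CStarAlgebra.norm_le_norm_of_nonneg_of_le (star_mul_self_nonneg _) h1
  rw [CStarRing.norm_star_mul_self, Algebra.algebraMap_eq_smul_one, norm_smul] at h2
  rcases subsingleton_or_nontrivial B with hB | hB
  · rw [Subsingleton.elim (φ a) 0]; simp
  · rw [norm_one, mul_one, Real.norm_eq_abs, abs_of_nonneg (by positivity), ← sq] at h2
    exact abs_le_of_sq_le_sq' h2 (norm_nonneg _) |>.2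

/-- A ucp map as a continuous linear map. -/
def toCLM (hφ : IsUCP φ) : A →L[ℂ] B :=
  φ.mkContinuous 1 fun a => by simpa using hφ.norm_le a

@[simp] lemma toCLM_apply (hφ : IsUCP φ) (a : A) : hφ.toCLM a = φ a := rfl

lemma continuous (hφ : IsUCP φ) : Continuous φ := hφ.toCLM.continuous

lemma comp {ψ : B →ₗ[ℂ] C} (hψ : IsUCP ψ) (hφ : IsUCP φ) : IsUCP (ψ ∘ₗ φ) := by
  obtain ⟨h1, φ', rfl⟩ := hφ
  obtain ⟨h2, ψ', rfl⟩ := hψ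
  refine ⟨by simp [h1, h2], ⟨_, fun k M hM => ?_⟩, rfl⟩
  exact ψ'.map_cstarMatrix_nonneg' k _ (φ'.map_cstarMatrix_nonneg' k M hM)

lemma id : IsUCP (LinearMap.id : A →ₗ[ℂ] A) :=
  ⟨rfl, ⟨LinearMap.id, fun _ _ hM => hM⟩, rfl⟩

lemma of_starAlgHom (f : A →⋆ₐ[ℂ] B) : IsUCP (f : A →ₗ[ℂ] B) := by
  refine isUCP_iff.mpr ⟨map_one f, fun n a b => ?_⟩
  have := star_mul_self_nonneg (∑ j, f (a j) * b j)
  refine this.trans_eq ?_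
  have hs : ∀ x, f (star x) = star (f x) := fun x => StarHomClass.map_star f x
  simp [Finset.sum_mul_sum, mul_assoc, hs]

/-- The amplification of a ucp map to matrices is ucp. -/
lemma mapMatrix (hφ : IsUCP φ) (k : ℕ) :
    IsUCP (CStarMatrix.mapₗ φ : CStarMatrix (Fin k) (Fin k) A →ₗ[ℂ] CStarMatrix (Fin k) (Fin k) B) := by
  have hst : ∀ M : CStarMatrix (Fin k) (Fin k) A, (star M).map φ = star (M.map φ) := by
    intro M; ext i j; simp [CStarMatrix.star_apply, hφ.map_star]
  refine isUCP_iff.mpr ⟨?_, fun n N D => ?_⟩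
  · ext i j
    change φ ((1 : CStarMatrix (Fin k) (Fin k) A) i j) = (1 : CStarMatrix (Fin k) (Fin k) B) i j
    rw [CStarMatrix.one_apply, CStarMatrix.one_apply]
    split_ifs <;> simp [hφ.1]
  · apply matrix_nonneg_of_form
    · rw [isSelfAdjoint_iff, star_sum]
      simp only [star_sum, star_mul, star_star]
      rw [Finset.sum_comm]
      refine Finset.sum_congr rfl fun i _ => Finset.sum_congr rfl fun j _ => ?_
      change star (D i) * (star ((star (N j) * N i).map φ) * D j) = _
      rw [← hst, star_mul, star_star, mul_assoc]; rfl
    · intro c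
      -- For each row m, the family is indexed by pairs of a matrix N i and a column.
      have h1 := Finset.sum_nonneg (s := Finset.univ) fun m _ =>
        hφ.form_nonneg (fun p : Fin n × Fin k => N p.1 m p.2) (fun p => ∑ l, D p.1 p.2 l * c l)
      refine h1.trans_eq ?_
      have h2 : ∀ i j, matrixForm c c (star (D i) * (CStarMatrix.mapₗ φ (star (N i) * N j)) * D j) =
          ∑ m, ∑ a, ∑ b, star (∑ l, D i a l * c l) * φ (star (N i m a) * N j m b) *
            (∑ l, D j b l * c l) := by
        intro i j
        rw [matrixForm_conj, matrixForm_apply]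
        have h3 : ∀ a b, (CStarMatrix.mapₗ φ (star (N i) * N j) : CStarMatrix (Fin k) (Fin k) B) a b
            = ∑ m, φ (star (N i m a) * N j m b) := by
          intro a b
          change φ ((star (N i) * N j) a b) = _
          rw [CStarMatrix.mul_apply, map_sum]
          rfl
        simp only [h3, Finset.mul_sum (s := Finset.univ) (f := fun m => φ _), Finset.sum_mul (s := Finset.univ) (f := fun m => _ * φ _)]
        rw [Finset.sum_congr rfl fun i _ => Finset.sum_comm]
        rw [Finset.sum_comm]
      simp only [map_sum, h2, Fintype.sum_prod_type]
      rw [Finset.sum_comm]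
      refine Finset.sum_congr rfl fun i _ => ?_
      rw [Finset.sum_congr rfl fun m _ => Finset.sum_comm]
      rw [Finset.sum_comm]

lemma norm_map_le (hφ : IsUCP φ) (k : ℕ) (M : CStarMatrix (Fin k) (Fin k) A) :
    ‖M.map φ‖ ≤ ‖M‖ := (hφ.mapMatrix k).norm_le M

end IsUCP

/-- Ucp maps are completely contractive, so a ucp left inverse leaves no room for a decrease of
norm. The boundary property is obtained from this. -/
lemma isCompletelyIsometric_of_comp_eq_id {φ : A →ₗ[ℂ] B} {ψ : B →ₗ[ℂ] A} (hφ : IsUCP φ)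
    (hψ : IsUCP ψ) (h : ψ ∘ₗ φ = LinearMap.id) : IsCompletelyIsometric φ := by
  intro k M
  refine le_antisymm (hφ.norm_map_le k M) ?_
  have h1 : (M.map φ).map ψ = M := by
    ext i j; exact LinearMap.congr_fun h (M i j)
  calc ‖M‖ = ‖(M.map φ).map ψ‖ := by rw [h1]
    _ ≤ _ := hψ.norm_map_le k _

end CompletePositivity
end
end QG

namespace QG
noncomputable section
open scoped TensorProduct ComplexOrder CStarAlgebra
open Coalgebra HopfAlgebra

/-! ### Idempotent ucp maps, multiplicativity, and states -/

section States
attribute [local instance] CStarAlgebra.spectralOrder CStarAlgebra.spectralOrderedRing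
variable {A : Type*} {B : Type*} [CStarAlgebra A] [CStarAlgebra B]

lemma isClosed_setOf_nonneg : IsClosed {a : A | 0 ≤ a} := CStarAlgebra.isClosed_nonneg

lemma nonneg_of_forall_pos {Y Z : A} (h : ∀ t : ℝ, 0 < t → 0 ≤ Y + t • Z) : 0 ≤ Y := by
  have h1 : Filter.Tendsto (fun t : ℝ => Y + t • Z) (nhdsWithin 0 (Set.Ioi 0)) (nhds Y) := by
    have : Continuous (fun t : ℝ => Y + t • Z) := by fun_prop
    have h2 := this.tendsto 0
    simp only [zero_smul, add_zero] at h2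
    exact h2.mono_left nhdsWithin_le_nhds
  refine isClosed_setOf_nonneg.mem_of_tendsto h1 ?_
  filter_upwards [self_mem_nhdsWithin] with t ht using h t ht

/-- For `a` in the range of a ucp idempotent `p`, `p(a* b)` depends on `p b` only. -/
lemma IsUCP.idempotent_map_star_mul_eq_zero {p : A →ₗ[ℂ] A} (hp : IsUCP p)
    (hpp : ∀ a, p (p a) = p a) {a b : A} (ha : p a = a) (hb : p b = 0) : p (star a * b) = 0 := by
  have key : ∀ c : A, p c = 0 → p (star a * c) + p (star c * a) = 0 := by
    intro c hc
    -- Apply p to the Schwarz inequality for a + tc. The constant terms cancel, and a quadratic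
    -- polynomial in t without constant term that stays nonnegative has no linear term.
    have h1 : ∀ t : ℝ, 0 ≤ t • (p (star a * c) + p (star c * a)) + (t * t) • p (star c * c) := by
      intro t
      have h2 := hp.schwarz (a + t • c)
      have hpt : p (t • c) = 0 := by
        rw [← Complex.coe_smul, map_smul, hc, smul_zero]
      have hsm : ∀ (t : ℝ) (x : A), p (t • x) = t • p x := fun t x => by
        rw [← Complex.coe_smul, map_smul, Complex.coe_smul]
      rw [map_add, hpt, add_zero, ha] at h2
      have h3 := hp.mono h2
      rw [hpp] at h3
      have h4 : p (star (a + t • c) * (a + t • c)) = p (star a * a) +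
          (t • (p (star a * c) + p (star c * a)) + (t * t) • p (star c * c)) := by
        simp only [star_add, star_smul, star_trivial, add_mul, mul_add, smul_mul_assoc,
          mul_smul_comm, map_add, hsm, smul_add, smul_smul]
        abel
      rw [h4] at h3
      simpa using h3
    refine le_antisymm ?_ ?_
    · rw [← neg_nonneg]
      refine nonneg_of_forall_pos (Z := p (star c * c)) fun t ht => ?_
      have h2 := smul_nonneg (inv_nonneg.mpr ht.le) (h1 (-t))
      rw [smul_add, smul_smul, smul_smul] at h2
      convert h2 using 2
      · rw [mul_neg, inv_mul_cancel₀ ht.ne', neg_one_smul]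
      · field_simp
    · refine nonneg_of_forall_pos (Z := p (star c * c)) fun t ht => ?_
      have h2 := smul_nonneg (inv_nonneg.mpr ht.le) (h1 t)
      rw [smul_add, smul_smul, smul_smul] at h2
      convert h2 using 2
      · rw [inv_mul_cancel₀ ht.ne', one_smul]
      · field_simp
  have h1 := key b hb
  -- Replacing b by ib changes the relative sign of the two terms, so both vanish.
  have h2 := key (Complex.I • b) (by rw [map_smul, hb, smul_zero])
  have hI : star Complex.I = -Complex.I := by simp
  rw [mul_smul_comm, star_smul, smul_mul_assoc, map_smul, map_smul, hI, neg_smul, ← sub_eq_add_neg,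
    ← smul_sub, smul_eq_zero] at h2
  have h3 : p (star a * b) = p (star b * a) := sub_eq_zero.mp (h2.resolve_left Complex.I_ne_zero)
  rw [← h3, ← two_smul ℂ, smul_eq_zero] at h1
  exact h1.resolve_left two_ne_zero

lemma IsUCP.idempotent_map_mul_map {p : A →ₗ[ℂ] A} (hp : IsUCP p)
    (hpp : ∀ a, p (p a) = p a) {a : A} (ha : p a = a) (b : A) : p (a * p b) = p (a * b) := by
  have hsa : p (star a) = star a := by rw [hp.map_star, ha]
  have := hp.idempotent_map_star_mul_eq_zero hpp hsa (b := p b - b) (by rw [map_sub, hpp, sub_self])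
  rwa [star_star, mul_sub, map_sub, sub_eq_zero] at this

lemma IsUCP.idempotent_map_map_mul {p : A →ₗ[ℂ] A} (hp : IsUCP p)
    (hpp : ∀ a, p (p a) = p a) {a : A} (ha : p a = a) (b : A) : p (p b * a) = p (b * a) := by
  have hsa : p (star a) = star a := by rw [hp.map_star, ha]
  have := congrArg star (hp.idempotent_map_mul_map hpp hsa (star b))
  rwa [← hp.map_star, ← hp.map_star, star_mul, star_mul, star_star, hp.map_star, star_star,
    star_star] at this

/-- A ucp map with a ucp inverse is multiplicative. -/
lemma IsUCP.map_mul_of_inverse {φ : A →ₗ[ℂ] B} {ψ : B →ₗ[ℂ] A} (hφ : IsUCP φ) (hψ : IsUCP ψ)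
    (h1 : ∀ a, ψ (φ a) = a) (h2 : ∀ b, φ (ψ b) = b) (a b : A) : φ (a * b) = φ a * φ b := by
  have key : ∀ a : A, φ (star a * a) = star (φ a) * φ a := by
    intro a
    -- The reverse inequality is φ applied to the Schwarz inequality of the inverse ψ. Polarisation
    -- then passes from squares to products.
    refine le_antisymm ?_ (hφ.schwarz a)
    have h3 := hφ.mono (hψ.schwarz (φ a))
    rwa [h1, h2] at h3
  have key2 : ∀ a b : A, φ (star a * b) + φ (star b * a) =
      star (φ a) * φ b + star (φ b) * φ a := by
    intro a b
    have h3 := key (a + b)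
    simp only [star_add, add_mul, mul_add, map_add, key] at h3
    have h4 : ∀ x y z w s t : B, x + y + (z + w) = x + s + (t + w) → z + y = t + s := by
      intro x y z w s t h
      have : x + y + (z + w) - x - w = x + s + (t + w) - x - w := by rw [h]
      calc z + y = x + y + (z + w) - x - w := by abel
        _ = x + s + (t + w) - x - w := this
        _ = t + s := by abel
    exact h4 _ _ _ _ _ _ h3
  have h3 := key2 (star a) b
  have h4 := key2 (star a) (Complex.I • b)
  have hI : star Complex.I = -Complex.I := by simp
  simp only [star_star, star_smul, smul_mul_assoc, mul_smul_comm, map_smul, hI, neg_smul,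
    neg_mul, map_neg] at h3 h4
  rw [← sub_eq_add_neg, ← sub_eq_add_neg, ← smul_sub, ← smul_sub] at h4
  have h5 := smul_right_injective B Complex.I_ne_zero h4
  rw [hφ.map_star a, star_star] at h3 h5
  have h6 : (2 : ℂ) • φ (a * b) = (2 : ℂ) • (φ a * φ b) := by
    rw [two_smul, two_smul]
    have := congrArg₂ (· + ·) h3 h5
    convert this using 1 <;> abel
  exact smul_right_injective B two_ne_zero h6

/-- States of a unital C*-algebra. -/
structure IsState (θ : A →ₗ[ℂ] ℂ) : Prop where
  map_one : θ 1 = 1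
  nonneg : ∀ a, 0 ≤ θ (star a * a)

namespace IsState
variable {θ : A →ₗ[ℂ] ℂ}

lemma map_nonneg (hθ : IsState θ) {a : A} (ha : 0 ≤ a) : 0 ≤ θ a := by
  obtain ⟨s, rfl⟩ := exists_star_mul_self_of_nonneg ha
  exact hθ.nonneg s

lemma map_star (hθ : IsState θ) (a : A) : θ (star a) = star (θ a) :=
  StarHomClass.map_star (PositiveLinearMap.mk₀ θ fun _ ha => hθ.map_nonneg ha) a

lemma normSq_le (hθ : IsState θ) (a : A) : ((‖θ a‖ ^ 2 : ℝ) : ℂ) ≤ θ (star a * a) := by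
  have h := hθ.nonneg (a - θ a • 1)
  have h1 : θ (star (a - θ a • 1) * (a - θ a • 1)) = θ (star a * a) - star (θ a) * θ a := by
    simp only [star_sub, star_smul, star_one, sub_mul, mul_sub, smul_mul_assoc, mul_smul_comm,
      one_mul, mul_one, map_sub, map_smul, hθ.map_one, hθ.map_star, smul_eq_mul]
    ring
  rw [h1, sub_nonneg] at h
  have h2 : star (θ a) * θ a = ((‖θ a‖ ^ 2 : ℝ) : ℂ) := by
    have := RCLike.conj_mul (θ a)
    push_cast
    simpa using this
  rwa [h2] at h

lemma map_star_mul_self_le (hθ : IsState θ) (a : A) : θ (star a * a) ≤ ((‖a‖ ^ 2 : ℝ) : ℂ) := by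
  have h := hθ.map_nonneg (sub_nonneg.mpr (CStarAlgebra.star_mul_le_algebraMap_norm_sq (a := a)))
  rw [map_sub, sub_nonneg, Algebra.algebraMap_eq_smul_one, ← Complex.coe_smul, map_smul,
    hθ.map_one] at h
  simpa using h

lemma norm_le (hθ : IsState θ) (a : A) : ‖θ a‖ ≤ ‖a‖ := by
  have h := (hθ.normSq_le a).trans (hθ.map_star_mul_self_le a)
  rw [Complex.real_le_real] at h
  exact abs_le_of_sq_le_sq' h (norm_nonneg _) |>.2

lemma comp (hθ : IsState θ) {φ : B →ₗ[ℂ] A} (hφ : IsUCP φ) : IsState (θ ∘ₗ φ) where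
  map_one := by simp [hφ.1, hθ.map_one]
  nonneg b := hθ.map_nonneg (hφ.map_star_mul_self_nonneg b)

/-- A unital contractive functional is a state. -/
lemma of_contractive (h1 : θ 1 = 1) (h : ∀ a, ‖θ a‖ ≤ ‖a‖) : IsState θ := by
  have hA : Nontrivial A := ⟨1, 0, fun h0 => by simp [h0] at h1⟩
  have hre : ∀ x : A, star x = x → (θ x).im = 0 := by
    intro x hx
    by_contra hne
    set β := (θ x).im
    -- Evaluate θ on x + it, whose norm squared is at most ‖x‖² + t² as x is self-adjoint. A nonzero
    -- imaginary part β of θ(x) makes the left side grow by 2βt.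
    have key : ∀ t : ℝ, (β + t) ^ 2 ≤ ‖x‖ ^ 2 + t ^ 2 := by
      intro t
      have e1 : (β + t) ^ 2 ≤ ‖θ (x + ((t : ℂ) * Complex.I) • 1)‖ ^ 2 := by
        rw [map_add, map_smul, h1]
        have : β + t = (θ x + ((t : ℂ) * Complex.I) • (1 : ℂ)).im := by simp [β]
        rw [this]
        rw [← sq_abs]
        exact pow_le_pow_left₀ (abs_nonneg _) (Complex.abs_im_le_norm _) 2
      have e2 : ‖x + ((t : ℂ) * Complex.I) • (1 : A)‖ ^ 2 ≤ ‖x‖ ^ 2 + t ^ 2 := by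
        rw [sq, ← CStarRing.norm_star_mul_self]
        have : star (x + ((t : ℂ) * Complex.I) • (1 : A)) * (x + ((t : ℂ) * Complex.I) • 1) =
            star x * x + ((t : ℂ) ^ 2) • 1 := by
          simp only [star_add, star_smul, star_one, hx, star_mul', add_mul, mul_add,
            smul_mul_assoc, mul_smul_comm, mul_one, one_mul, smul_add, smul_smul, Complex.star_def,
            Complex.conj_ofReal, Complex.conj_I]
          have e : (t : ℂ) * Complex.I * (t * -Complex.I) = (t : ℂ) ^ 2 := by
            ring_nf; simp
          rw [e]
          have e3 : (t : ℂ) * -Complex.I = - (t * Complex.I) := by ring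
          rw [e3, neg_smul]
          abel
        rw [this]
        refine (norm_add_le _ _).trans ?_
        rw [CStarRing.norm_star_mul_self, norm_smul, norm_one, mul_one, ← sq]
        simp
      exact e1.trans ((pow_le_pow_left₀ (norm_nonneg _) (h _) 2).trans e2)
    have h3 := key (‖x‖ ^ 2 / β)
    -- With t = ‖x‖²/β the inequality becomes β² + ‖x‖² ≤ 0.
    have h4 : (β + ‖x‖ ^ 2 / β) ^ 2 = β ^ 2 + 2 * ‖x‖ ^ 2 + (‖x‖ ^ 2 / β) ^ 2 := by
      field_simp; ring
    have h5 : 0 < β ^ 2 := by positivity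
    nlinarith [sq_nonneg ‖x‖]
  refine ⟨h1, fun a => ?_⟩
  set x := star a * a with hx
  have hxs : star x = x := by simp [hx]
  -- For x ≥ 0 the element ‖x‖1 − x has norm at most ‖x‖, so θ(x) lies in the disc of radius ‖x‖
  -- about ‖x‖ and has nonnegative real part.
  have h2 : ‖algebraMap ℝ A ‖x‖ - x‖ ≤ ‖x‖ := by
    have h3 : 0 ≤ algebraMap ℝ A ‖x‖ - x :=
      sub_nonneg.mpr (IsSelfAdjoint.le_algebraMap_norm_self (a := x) hxs)
    have h4 : algebraMap ℝ A ‖x‖ - x ≤ algebraMap ℝ A ‖x‖ :=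
      sub_le_self _ (star_mul_self_nonneg a)
    refine (CStarAlgebra.norm_le_norm_of_nonneg_of_le h3 h4).trans ?_
    rw [Algebra.algebraMap_eq_smul_one, norm_smul, norm_one]; simp
  have h3 : ‖(‖x‖ : ℂ) - θ x‖ ≤ ‖x‖ := by
    have := (h _).trans h2
    rwa [map_sub, Algebra.algebraMap_eq_smul_one, ← Complex.coe_smul, map_smul, h1, smul_eq_mul,
      mul_one] at this
  rw [Complex.nonneg_iff]
  refine ⟨?_, (hre x hxs).symm⟩
  have h4 := (Complex.abs_re_le_norm _).trans h3
  rw [Complex.sub_re, Complex.ofReal_re] at h4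
  have := abs_le.mp h4
  linarith

/-- A unital contractive functional on a subspace extends to a state. -/
lemma exists_extension (V : Submodule ℂ A) (f : V →ₗ[ℂ] ℂ) (hV : (1 : A) ∈ V)
    (h1 : f ⟨1, hV⟩ = 1) (h : ∀ a, ‖f a‖ ≤ ‖(a : A)‖) :
    ∃ θ : A →ₗ[ℂ] ℂ, IsState θ ∧ ∀ a : V, θ a = f a := by
  obtain ⟨g, hg, hn⟩ := exists_extension_norm_eq V (f.mkContinuous 1 fun a => by simpa using h a)
  refine ⟨g, of_contractive ?_ fun a => ?_, fun a => hg a⟩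
  · exact (hg ⟨1, hV⟩).trans h1
  · have h2 : ‖g‖ ≤ 1 := hn.trans_le (LinearMap.mkContinuous_norm_le _ zero_le_one _)
    simpa using g.le_of_opNorm_le h2 a

end IsState

lemma exists_isState [Nontrivial A] : ∃ θ : A →ₗ[ℂ] ℂ, IsState θ := by
  have hne : (1 : A) ≠ 0 := one_ne_zero
  let e := LinearEquiv.toSpanNonzeroSingleton ℂ A 1 hne
  have he : ∀ c, ((e c : _) : A) = c • 1 := fun c => rfl
  obtain ⟨θ, h, -⟩ := IsState.exists_extension (Submodule.span ℂ {(1 : A)}) e.symm.toLinearMap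
    (Submodule.mem_span_singleton_self 1) (by
      simp only [LinearEquiv.coe_coe]
      rw [LinearEquiv.symm_apply_eq]
      apply Subtype.ext
      simp [he]) (by
      intro a
      obtain ⟨c, rfl⟩ := e.surjective a
      simp [he, norm_smul])
  exact ⟨θ, h⟩

end States
end
end QG

namespace QG
noncomputable section
open scoped TensorProduct ComplexOrder CStarAlgebra
open Coalgebra HopfAlgebra

/-! ### Convolution, antipode identities and strong invariance of the Haar state -/

section Convolution
variable {H : Type*} [Ring H] [HopfAlgebra ℂ H] {R : Type*} [Ring R] [Algebra ℂ R]
  {Q : Type*} [Ring Q] [Algebra ℂ Q]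

/-- The convolution product of linear maps from a coalgebra to an algebra. -/
def conv (f g : H →ₗ[ℂ] R) : H →ₗ[ℂ] R :=
  (WithConv.toConv f * WithConv.toConv g).ofConv

lemma conv_apply (f g : H →ₗ[ℂ] R) (x : H) :
    conv f g x = LinearMap.mul' ℂ R (TensorProduct.map f g (comul (R := ℂ) x)) := rfl

lemma conv_apply_of_eq {ι : Type*} [Fintype ι] {x : H} {a b : ι → H}
    (h : comul (R := ℂ) x = ∑ i, a i ⊗ₜ[ℂ] b i) (f g : H →ₗ[ℂ] R) :
    conv f g x = ∑ i, f (a i) * g (b i) := by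
  simp [conv_apply, h]

lemma conv_assoc (f g k : H →ₗ[ℂ] R) : conv (conv f g) k = conv f (conv g k) := by
  have := mul_assoc (WithConv.toConv f) (WithConv.toConv g) (WithConv.toConv k)
  exact congrArg WithConv.ofConv this

/-- A functional, viewed as a map to an arbitrary algebra. -/
def scalar (R : Type*) [Ring R] [Algebra ℂ R] (f : H →ₗ[ℂ] ℂ) : H →ₗ[ℂ] R :=
  Algebra.linearMap ℂ R ∘ₗ f

@[simp] lemma scalar_apply (f : H →ₗ[ℂ] ℂ) (x : H) : scalar R f x = f x • (1 : R) := by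
  simp [scalar, Algebra.algebraMap_eq_smul_one]

lemma conv_counit (f : H →ₗ[ℂ] R) : conv f (scalar R counit) = f := by
  have := mul_one (WithConv.toConv f)
  exact congrArg WithConv.ofConv this

lemma counit_conv (f : H →ₗ[ℂ] R) : conv (scalar R counit) f = f := by
  have := one_mul (WithConv.toConv f)
  exact congrArg WithConv.ofConv this

lemma antipode_conv_id : conv (antipode ℂ) LinearMap.id = scalar H counit :=
  congrArg WithConv.ofConv (LinearMap.antipode_mul_id (R := ℂ) (C := H))

lemma id_conv_antipode : conv LinearMap.id (antipode ℂ) = scalar H counit :=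
  congrArg WithConv.ofConv (LinearMap.id_mul_antipode (R := ℂ) (C := H))

lemma algHom_comp_conv (j : R →ₐ[ℂ] Q) (f g : H →ₗ[ℂ] R) :
    j.toLinearMap ∘ₗ conv f g = conv (j.toLinearMap ∘ₗ f) (j.toLinearMap ∘ₗ g) :=
  LinearMap.algHom_comp_convMul_distrib j (WithConv.toConv f) (WithConv.toConv g)

lemma algHom_comp_scalar (j : R →ₐ[ℂ] Q) (f : H →ₗ[ℂ] ℂ) :
    j.toLinearMap ∘ₗ scalar R f = scalar Q f := by
  ext x; simp

lemma conv_scalar (F : H →ₗ[ℂ] R) (f : H →ₗ[ℂ] ℂ) :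
    conv F (scalar R f) = F ∘ₗ conv LinearMap.id (scalar H f) := by
  ext x
  obtain ⟨s, hs⟩ := TensorProduct.exists_finset (R := ℂ) (comul (R := ℂ) x)
  rw [LinearMap.comp_apply, conv_apply, conv_apply, hs]
  simp [map_sum]

/-- The operator `x ↦ x₍₁₎ f(x₍₂₎)`. -/
def convRight (f : H →ₗ[ℂ] ℂ) : H →ₗ[ℂ] H := conv LinearMap.id (scalar H f)

lemma convRight_apply_of_eq {ι : Type*} [Fintype ι] {x : H} {a b : ι → H}
    (h : comul (R := ℂ) x = ∑ i, a i ⊗ₜ[ℂ] b i) (f : H →ₗ[ℂ] ℂ) :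
    convRight f x = ∑ i, f (b i) • a i := by
  simp [convRight, conv_apply_of_eq h]

/-- This recovers the functional from the operator, so an operator has at most one symbol. -/
lemma counit_convRight (f : H →ₗ[ℂ] ℂ) (x : H) : counit (R := ℂ) (convRight f x) = f x := by
  have h := conv_scalar (R := ℂ) (counit (R := ℂ) (A := H)) f
  have h2 : scalar ℂ f = f := by ext; simp
  have h3 : scalar ℂ (counit (R := ℂ) (A := H)) = counit := by ext; simp
  have h4 := counit_conv (R := ℂ) f
  rw [h3] at h4
  rw [h2, h4] at h
  exact (LinearMap.congr_fun h x).symm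

/-- The functional `f ∘ₗ convRight g` is the convolution x ↦ f(x₍₁₎)g(x₍₂₎): composition of
operators is convolution of symbols. -/
lemma convRight_comp (f g : H →ₗ[ℂ] ℂ) :
    convRight f ∘ₗ convRight g = convRight (f ∘ₗ convRight g) := by
  have h : scalar H (f ∘ₗ convRight g) = conv (scalar H f) (scalar H g) := by
    rw [conv_scalar]; rfl
  have h1 : convRight (f ∘ₗ convRight g) = conv LinearMap.id (scalar H (f ∘ₗ convRight g)) := rfl
  rw [h1, h, ← conv_assoc, conv_scalar]
  rfl

lemma convRight_counit : convRight (counit (R := ℂ) (A := H)) = LinearMap.id :=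
  conv_counit _

lemma convRight_injective : Function.Injective (convRight (H := H)) := by
  intro f g h
  ext x
  rw [← counit_convRight, h, counit_convRight]

end Convolution

section Sweedler
variable {H : Type u} [Ring H] [HopfAlgebra ℂ H] {ι : Type*} [Fintype ι] {x : H} {a b : ι → H}

lemma exists_comul_eq_sum (x : H) : ∃ (n : ℕ) (a b : Fin n → H),
    comul (R := ℂ) x = ∑ i, a i ⊗ₜ[ℂ] b i := by
  obtain ⟨s, hs⟩ := TensorProduct.exists_finset (R := ℂ) (comul (R := ℂ) x)
  refine ⟨s.card, fun i => (s.equivFin.symm i).1.1, fun i => (s.equivFin.symm i).1.2, ?_⟩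
  rw [hs, ← Finset.sum_coe_sort, ← s.equivFin.symm.sum_comp]

lemma sum_counit_smul_right (h : comul (R := ℂ) x = ∑ i, a i ⊗ₜ[ℂ] b i) :
    ∑ i, counit (R := ℂ) (a i) • b i = x := by
  have := congrArg (TensorProduct.lid ℂ H) (rTensor_counit_comul (R := ℂ) x)
  rw [h] at this
  simpa using this

lemma sum_counit_smul_left (h : comul (R := ℂ) x = ∑ i, a i ⊗ₜ[ℂ] b i) :
    ∑ i, counit (R := ℂ) (b i) • a i = x := by
  have := congrArg (TensorProduct.rid ℂ H) (lTensor_counit_comul (R := ℂ) x)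
  rw [h] at this
  simpa using this

lemma sum_antipode_mul (h : comul (R := ℂ) x = ∑ i, a i ⊗ₜ[ℂ] b i) :
    ∑ i, antipode ℂ (a i) * b i = counit (R := ℂ) x • (1 : H) := by
  have := LinearMap.congr_fun (antipode_conv_id (H := H)) x
  rwa [conv_apply_of_eq h, scalar_apply] at this

lemma sum_mul_antipode (h : comul (R := ℂ) x = ∑ i, a i ⊗ₜ[ℂ] b i) :
    ∑ i, a i * antipode ℂ (b i) = counit (R := ℂ) x • (1 : H) := by
  have := LinearMap.congr_fun (id_conv_antipode (H := H)) x
  rwa [conv_apply_of_eq h, scalar_apply] at this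

lemma comul_eq_conv : comul (R := ℂ) (A := H) =
    conv (Algebra.TensorProduct.includeLeft (R := ℂ) (S := ℂ) (A := H) (B := H)).toLinearMap
      (Algebra.TensorProduct.includeRight (R := ℂ) (A := H) (B := H)).toLinearMap := by
  ext x
  obtain ⟨n, a, b, h⟩ := exists_comul_eq_sum x
  rw [conv_apply_of_eq h, h]
  simp

lemma sum_comul_mul_antipode (h : comul (R := ℂ) x = ∑ i, a i ⊗ₜ[ℂ] b i) :
    ∑ i, comul (R := ℂ) (a i) * ((1 : H) ⊗ₜ[ℂ] antipode ℂ (b i)) = x ⊗ₜ[ℂ] (1 : H) := by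
  let i₁ := Algebra.TensorProduct.includeLeft (R := ℂ) (S := ℂ) (A := H) (B := H)
  let i₂ := Algebra.TensorProduct.includeRight (R := ℂ) (A := H) (B := H)
  have h1 : conv (comul (R := ℂ)) (i₂.toLinearMap ∘ₗ antipode ℂ) = i₁.toLinearMap := by
    have h2 := algHom_comp_conv i₂ LinearMap.id (antipode ℂ)
    rw [id_conv_antipode, algHom_comp_scalar] at h2
    rw [comul_eq_conv, conv_assoc]
    exact (congrArg (conv i₁.toLinearMap) h2.symm).trans (conv_counit _)
  have := LinearMap.congr_fun h1 x
  rw [conv_apply_of_eq h] at this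
  simpa [i₁, i₂] using this

/-- Both sides are convolution inverses of Δ among linear maps H → H ⊗ H: the left one is a right
inverse, and `G` is a left inverse. -/
lemma comul_antipode (h : comul (R := ℂ) x = ∑ i, a i ⊗ₜ[ℂ] b i) :
    comul (R := ℂ) (antipode ℂ x) = ∑ i, antipode ℂ (b i) ⊗ₜ[ℂ] antipode ℂ (a i) := by
  let i₁ := Algebra.TensorProduct.includeLeft (R := ℂ) (S := ℂ) (A := H) (B := H)
  let i₂ := Algebra.TensorProduct.includeRight (R := ℂ) (A := H) (B := H)
  let G : H →ₗ[ℂ] H ⊗[ℂ] H := conv (i₂.toLinearMap ∘ₗ antipode ℂ) (i₁.toLinearMap ∘ₗ antipode ℂ)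
  have h1 : conv (comul (R := ℂ)) (comul (R := ℂ) ∘ₗ antipode ℂ) = scalar (H ⊗[ℂ] H) counit :=
    congrArg WithConv.ofConv (LinearMap.comul_right_inv (R := ℂ) (C := H))
  have h2 : conv G (comul (R := ℂ)) = scalar (H ⊗[ℂ] H) counit := by
    have e1 := algHom_comp_conv i₁ (antipode ℂ) LinearMap.id
    have e2 := algHom_comp_conv i₂ (antipode ℂ) LinearMap.id
    rw [antipode_conv_id, algHom_comp_scalar] at e1 e2
    rw [comul_eq_conv, conv_assoc, ← conv_assoc (i₁.toLinearMap ∘ₗ antipode ℂ)]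
    have e3 : conv (conv (i₁.toLinearMap ∘ₗ antipode ℂ) i₁.toLinearMap) i₂.toLinearMap =
        i₂.toLinearMap := (congrArg (fun t => conv t i₂.toLinearMap) e1.symm).trans (counit_conv _)
    exact (congrArg (conv (i₂.toLinearMap ∘ₗ antipode ℂ)) e3).trans e2.symm
  have h3 : comul (R := ℂ) ∘ₗ antipode ℂ = G := by
    rw [← counit_conv (comul (R := ℂ) ∘ₗ antipode ℂ), ← h2, conv_assoc, h1, conv_counit]
  have := LinearMap.congr_fun h3 x
  simp only [G] at this
  rw [conv_apply_of_eq h] at this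
  simpa [i₁, i₂] using this

end Sweedler

section StarSweedler
variable {H : Type u} [Ring H] [StarRing H] [HopfAlgebra ℂ H] [StarModule ℂ H]
  [CompactQuantumGroup H] {ι : Type*} [Fintype ι] {x : H} {a b : ι → H}

lemma comul_star_of_eq (h : comul (R := ℂ) x = ∑ i, a i ⊗ₜ[ℂ] b i) :
    comul (R := ℂ) (star x) = ∑ i, star (a i) ⊗ₜ[ℂ] star (b i) := by
  rw [CompactQuantumGroup.comul_star, h, star_sum]
  simp

/-- The functional x ↦ conj ε(x*) is again a counit, and a coalgebra has only one: pair both with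
the two legs of Δ(x). -/
lemma counit_star (x : H) : counit (R := ℂ) (star x) = star (counit (R := ℂ) x) := by
  obtain ⟨n, a, b, h⟩ := exists_comul_eq_sum x
  have h1 := congrArg star (sum_counit_smul_right (comul_star_of_eq h))
  simp only [star_sum, star_smul, star_star] at h1
  have h2 := congrArg (counit (R := ℂ)) h1
  have h3 := congrArg (fun t => counit (R := ℂ) (star t)) (sum_counit_smul_left h)
  simp only [star_sum, star_smul, map_sum, map_smul, smul_eq_mul] at h2 h3
  rw [← h2, ← h3, star_sum]
  simp [mul_comm]

variable (H) in
/-- The inverse `x ↦ S(x*)*` of the antipode. -/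
def antipodeInv : H →ₗ[ℂ] H where
  toFun x := star (antipode ℂ (star x))
  map_add' x y := by simp
  map_smul' c x := by simp [star_smul]

lemma antipodeInv_apply (x : H) : antipodeInv H x = star (antipode ℂ (star x)) := rfl

lemma sum_mul_antipodeInv (h : comul (R := ℂ) x = ∑ i, a i ⊗ₜ[ℂ] b i) :
    ∑ i, b i * antipodeInv H (a i) = counit (R := ℂ) x • (1 : H) := by
  have := congrArg star (sum_antipode_mul (comul_star_of_eq h))
  simpa [star_sum, counit_star, star_smul, antipodeInv_apply] using this

-- The composition of `antipode ℂ` with `antipodeInv H` and the identity map are both left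
-- convolution inverses of the antipode, whose convolution inverse is unique.
@[simp] lemma antipode_antipodeInv (x : H) : antipode ℂ (antipodeInv H x) = x := by
  have h1 : conv (antipode ℂ ∘ₗ antipodeInv H) (antipode ℂ) = scalar H counit := by
    ext x
    obtain ⟨n, a, b, h⟩ := exists_comul_eq_sum x
    rw [conv_apply_of_eq h]
    simp only [LinearMap.comp_apply, ← antipode_mul_antidistrib]
    rw [← map_sum, sum_mul_antipodeInv h]
    simp
  have h2 : antipode ℂ ∘ₗ antipodeInv H = LinearMap.id := by
    rw [← conv_counit (antipode ℂ ∘ₗ antipodeInv H), ← antipode_conv_id, ← conv_assoc, h1,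
      counit_conv]
  exact LinearMap.congr_fun h2 x

@[simp] lemma antipodeInv_antipode (x : H) : antipodeInv H (antipode ℂ x) = x := by
  have := congrArg star (antipode_antipodeInv (star x))
  simpa [antipodeInv_apply] using this

lemma antipode_injective : Function.Injective (antipode ℂ : H →ₗ[ℂ] H) :=
  Function.LeftInverse.injective antipodeInv_antipode

@[simp] lemma antipodeInv_one : antipodeInv H 1 = 1 := by simp [antipodeInv_apply]

lemma antipode_star_antipode (x : H) : antipode ℂ (star (antipode ℂ x)) = star x := by
  have := antipode_antipodeInv (star x)
  rwa [antipodeInv_apply, star_star] at this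

lemma sum_antipodeInv_mul_comul (h : comul (R := ℂ) x = ∑ i, a i ⊗ₜ[ℂ] b i) :
    ∑ i, ((1 : H) ⊗ₜ[ℂ] antipodeInv H (b i)) * comul (R := ℂ) (a i) = x ⊗ₜ[ℂ] (1 : H) := by
  have := congrArg star (sum_comul_mul_antipode (comul_star_of_eq h))
  simpa [star_sum, CompactQuantumGroup.comul_star, antipodeInv_apply] using this

/-- Strong invariance: `(h ⊗ ι)((p ⊗ 1)Δ(a)(z ⊗ 1)) = ∑ h(p₍₁₎ a z₍₁₎) S⁻¹(p₍₂₎) S(z₍₂₎)`. -/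
lemma haar_strong_invariance {κ : Type*} [Fintype κ] {p z : H} {p₁ p₂ : ι → H} {z₁ z₂ : κ → H}
    (hp : comul (R := ℂ) p = ∑ i, p₁ i ⊗ₜ[ℂ] p₂ i) (hz : comul (R := ℂ) z = ∑ j, z₁ j ⊗ₜ[ℂ] z₂ j)
    (a : H) :
    TensorProduct.lid ℂ H ((haar H).rTensor H
      ((p ⊗ₜ[ℂ] (1 : H)) * comul (R := ℂ) a * (z ⊗ₜ[ℂ] (1 : H)))) =
    ∑ i, ∑ j, haar H (p₁ i * a * z₁ j) • (antipodeInv H (p₂ i) * antipode ℂ (z₂ j)) := by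
  have key : ∀ (c d : H) (t : H ⊗[ℂ] H), TensorProduct.lid ℂ H ((haar H).rTensor H
      (((1 : H) ⊗ₜ[ℂ] c) * t * ((1 : H) ⊗ₜ[ℂ] d))) =
      c * TensorProduct.lid ℂ H ((haar H).rTensor H t) * d := by
    intro c d t
    induction t using TensorProduct.induction_on with
    | zero => simp
    | add x y hx hy => simp only [map_add, add_mul, mul_add, hx, hy]
    | tmul x y => simp
  -- Write p ⊗ 1 = ∑ (1 ⊗ S⁻¹(p₍₂₎))Δ(p₍₁₎) and z ⊗ 1 = ∑ Δ(z₍₁₎)(1 ⊗ S(z₍₂₎)). The middle factor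
  -- becomes Δ(p₍₁₎az₍₁₎), where left invariance applies.
  rw [← sum_antipodeInv_mul_comul hp, ← sum_comul_mul_antipode hz]
  simp only [Finset.sum_mul, Finset.mul_sum, map_sum]
  rw [Finset.sum_comm]
  refine Finset.sum_congr rfl fun i _ => Finset.sum_congr rfl fun j _ => ?_
  have := key (antipodeInv H (p₂ i)) (antipode ℂ (z₂ j)) (comul (R := ℂ) (p₁ i * a * z₁ j))
  rw [(haar_spec H).left_invariant] at this
  rw [Bialgebra.comul_mul, Bialgebra.comul_mul] at this
  simp only [mul_assoc] at this ⊢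
  rw [this]
  simp

lemma haar_strong_invariance_left {p : H} {p₁ p₂ : ι → H}
    (hp : comul (R := ℂ) p = ∑ i, p₁ i ⊗ₜ[ℂ] p₂ i) {κ : Type*} [Fintype κ] {a b : κ → H}
    (hx : comul (R := ℂ) x = ∑ i, a i ⊗ₜ[ℂ] b i) :
    ∑ i, haar H (p * a i) • b i = ∑ i, haar H (p₁ i * x) • antipodeInv H (p₂ i) := by
  have h1 : comul (R := ℂ) (1 : H) = ∑ _j : Fin 1, (1 : H) ⊗ₜ[ℂ] (1 : H) := by
    simp [Bialgebra.comul_one, Algebra.TensorProduct.one_def]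
  have := haar_strong_invariance hp h1 x
  rw [hx] at this
  simpa [Finset.mul_sum, Finset.sum_mul] using this

lemma haar_strong_invariance_right {z : H} {z₁ z₂ : ι → H}
    (hz : comul (R := ℂ) z = ∑ i, z₁ i ⊗ₜ[ℂ] z₂ i) {κ : Type*} [Fintype κ] {a b : κ → H}
    (hx : comul (R := ℂ) x = ∑ i, a i ⊗ₜ[ℂ] b i) :
    ∑ i, haar H (a i * z) • b i = ∑ i, haar H (x * z₁ i) • antipode ℂ (z₂ i) := by
  have h1 : comul (R := ℂ) (1 : H) = ∑ _j : Fin 1, (1 : H) ⊗ₜ[ℂ] (1 : H) := by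
    simp [Bialgebra.comul_one, Algebra.TensorProduct.one_def]
  have := haar_strong_invariance h1 hz x
  rw [hx] at this
  simpa [Finset.mul_sum, Finset.sum_mul] using this

lemma sum_haar_smul_right (h : comul (R := ℂ) x = ∑ i, a i ⊗ₜ[ℂ] b i) :
    ∑ i, haar H (a i) • b i = haar H x • (1 : H) := by
  have := (haar_spec H).left_invariant x
  rw [h] at this
  simpa using this

lemma sum_haar_smul_left (h : comul (R := ℂ) x = ∑ i, a i ⊗ₜ[ℂ] b i) :
    ∑ i, haar H (b i) • a i = haar H x • (1 : H) := by
  have := (haar_spec H).right_invariant x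
  rw [h] at this
  simpa using this

/-- Evaluate (h∘S ⊗ h)Δ(x) in two ways, by right invariance of h at S(x) and at x. -/
lemma haar_antipode (x : H) : haar H (antipode ℂ x) = haar H x := by
  obtain ⟨n, a, b, h⟩ := exists_comul_eq_sum x
  have h1 := congrArg (antipodeInv H) (sum_haar_smul_left (comul_antipode h))
  simp only [map_sum, map_smul, antipodeInv_antipode, antipodeInv_one] at h1
  have h2 := congrArg (haar H) h1
  have h3 := congrArg (fun t => haar H (antipode ℂ t)) (sum_haar_smul_left h)
  simp only [map_sum, map_smul, smul_eq_mul, (haar_spec H).map_one, antipode_one, mul_one] at h2 h3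
  rw [← h2, ← h3]
  simp [mul_comm]

/-- `y = 0` if `h(y x) = 0` for all `x`. -/
lemma eq_zero_of_haar_mul_eq_zero {y : H} (h : ∀ x, haar H (y * x) = 0) : y = 0 := by
  have : star y = 0 := haar_faithful (by rw [star_star]; exact h _)
  simpa using this

/-- On finitely many elements, the counit is implemented by a functional `h(· x)`. -/
lemma exists_haar_mul_eq_counit (e : ι → H) :
    ∃ x : H, ∀ i, haar H (e i * x) = counit (R := ℂ) (e i) := by
  classical
  -- All eᵢ are packed into one tensor so that a single orthonormal family expands them. The
  -- adjoints appear because h(· x) pairs g* with x.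
  obtain ⟨n, g, m, hg, hz⟩ := exists_orthonormal_expansion
    (∑ i, star (e i) ⊗ₜ[ℂ] (Pi.single i 1 : ι → ℂ))
  have he : ∀ i, e i = ∑ k, star (m k i) • star (g k) := by
    intro i
    have h1 := congrArg (fun t => TensorProduct.rid ℂ H
      ((LinearMap.proj i : (ι → ℂ) →ₗ[ℂ] ℂ).lTensor H t)) hz
    simp only [map_sum, LinearMap.lTensor_tmul, TensorProduct.rid_tmul, LinearMap.proj_apply,
      Pi.single_apply, ite_smul, one_smul, zero_smul, Finset.sum_ite_eq, Finset.mem_univ,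
      if_true] at h1
    simpa [star_sum, star_smul] using congrArg star h1
  refine ⟨∑ j, counit (R := ℂ) (star (g j)) • g j, fun i => ?_⟩
  rw [he i]
  simp [Finset.mul_sum, Finset.sum_mul, hg, mul_comm]

end StarSweedler

/-! ### The fundamental isometry on ℂ[G] ⊗ ℂ[G] -/

section Multiplicative
variable {H : Type u} [Ring H] [StarRing H] [HopfAlgebra ℂ H] [StarModule ℂ H]
  [CompactQuantumGroup H]

variable (H) in
/-- The functional `h ⊗ h`. -/
def haar₂ : H ⊗[ℂ] H →ₗ[ℂ] ℂ := LinearMap.mul' ℂ ℂ ∘ₗ TensorProduct.map (haar H) (haar H)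

@[simp] lemma haar₂_tmul (x y : H) : haar₂ H (x ⊗ₜ[ℂ] y) = haar H x * haar H y := by simp [haar₂]

variable (H) in
/-- The isometry `v ⊗ e ↦ Δ(v)(1 ⊗ e)`. -/
def fundamentalIsometry : H ⊗[ℂ] H →ₗ[ℂ] H ⊗[ℂ] H :=
  TensorProduct.lift (LinearMap.mk₂ ℂ (fun v e => comul (R := ℂ) v * ((1 : H) ⊗ₜ[ℂ] e))
    (by intros; simp [add_mul]) (by intros; simp)
    (by intros; simp [TensorProduct.tmul_add, mul_add]) (by intros; simp))

@[simp] lemma fundamentalIsometry_tmul (v e : H) :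
    fundamentalIsometry H (v ⊗ₜ[ℂ] e) = comul (R := ℂ) v * ((1 : H) ⊗ₜ[ℂ] e) := by
  simp [fundamentalIsometry]

lemma haar₂_comul_mul (c : H) (e d : H) :
    haar₂ H (((1 : H) ⊗ₜ[ℂ] d) * comul (R := ℂ) c * ((1 : H) ⊗ₜ[ℂ] e)) =
      haar H c * haar H (d * e) := by
  obtain ⟨n, a, b, h⟩ := exists_comul_eq_sum c
  have h1 := congrArg (fun t => haar H (d * t * e)) (sum_haar_smul_right h)
  simp only [Finset.mul_sum, Finset.sum_mul, mul_smul_comm, smul_mul_assoc, map_sum, map_smul,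
    smul_eq_mul, mul_one] at h1
  rw [h]
  simpa [Finset.mul_sum, Finset.sum_mul] using h1

lemma haar₂_fundamentalIsometry (ξ η : H ⊗[ℂ] H) :
    haar₂ H (star (fundamentalIsometry H ξ) * fundamentalIsometry H η) = haar₂ H (star ξ * η) := by
  induction ξ using TensorProduct.induction_on with
  | zero => simp
  | add x y hx hy => simp only [map_add, star_add, add_mul, hx, hy]
  | tmul v e =>
    induction η using TensorProduct.induction_on with
    | zero => simp
    | add x y hx hy => simp only [map_add, mul_add, hx, hy]
    | tmul v' e' =>
      rw [fundamentalIsometry_tmul, fundamentalIsometry_tmul, star_mul,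
        ← CompactQuantumGroup.comul_star, mul_assoc, ← mul_assoc (comul (star v)),
        ← Bialgebra.comul_mul, ← mul_assoc, TensorProduct.star_tmul, star_one, haar₂_comul_mul]
      simp

lemma fundamentalIsometry_mul (a : H) (ξ : H ⊗[ℂ] H) :
    fundamentalIsometry H ((a ⊗ₜ[ℂ] (1 : H)) * ξ) =
      comul (R := ℂ) a * fundamentalIsometry H ξ := by
  induction ξ using TensorProduct.induction_on with
  | zero => simp
  | add x y hx hy => simp only [map_add, mul_add, hx, hy]
  | tmul v e => simp [Bialgebra.comul_mul, mul_assoc]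

/-- For every `y` there are finitely many `wᵢ` spanning `y` with `∑ h(wᵢ* a wᵢ) = h(y* y) h(a)`. -/
lemma exists_right_expansion (y : H) :
    ∃ (n : ℕ) (c : Fin n → ℂ) (w : Fin n → H), y = ∑ i, c i • w i ∧
      ∀ a, ∑ i, haar H (star (w i) * a * w i) = haar H (star y * y) * haar H a := by
  obtain ⟨m, a, b, h⟩ := exists_comul_eq_sum y
  obtain ⟨n, s, w, hs, hw⟩ := exists_orthonormal_expansion
    (∑ i, antipode ℂ (b i) ⊗ₜ[ℂ] a i)
  refine ⟨n, fun i => counit (R := ℂ) (s i), w, ?_, fun c => ?_⟩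
  · have h1 := congrArg (fun t => TensorProduct.lid ℂ H ((counit (R := ℂ)).rTensor H t)) hw
    simp only [map_sum, LinearMap.rTensor_tmul, TensorProduct.lid_tmul, counit_antipode] at h1
    rw [← h1, sum_counit_smul_left h]
  -- Z is the preimage of y ⊗ 1 under the fundamental isometry W. Since W(c ⊗ 1) = Δ(c)W, the sum is
  -- ⟨Z, (c ⊗ 1)Z⟩ = ⟨y ⊗ 1, Δ(c)(y ⊗ 1)⟩, which invariance evaluates.
  · set Z : H ⊗[ℂ] H := ∑ i, a i ⊗ₜ[ℂ] antipode ℂ (b i) with hZ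
    have hZw : Z = ∑ i, w i ⊗ₜ[ℂ] s i := by
      have := congrArg (TensorProduct.comm ℂ H H) hw
      simpa using this
    have hWZ : fundamentalIsometry H Z = y ⊗ₜ[ℂ] (1 : H) := by
      rw [hZ, map_sum, ← sum_comul_mul_antipode h]
      simp
    have h1 : haar₂ H (star Z * ((c ⊗ₜ[ℂ] (1 : H)) * Z)) =
        ∑ i, haar H (star (w i) * c * w i) := by
      rw [hZw]
      simp [star_sum, Finset.sum_mul, Finset.mul_sum, hs, mul_assoc]
    rw [← h1, ← haar₂_fundamentalIsometry, fundamentalIsometry_mul, hWZ]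
    obtain ⟨k, c₁, c₂, hc⟩ := exists_comul_eq_sum c
    have h2 := congrArg (fun t => haar H (star y * t * y)) (sum_haar_smul_left hc)
    simp only [Finset.mul_sum, Finset.sum_mul, mul_smul_comm, smul_mul_assoc, map_sum, map_smul,
      smul_eq_mul, mul_one] at h2
    rw [hc, mul_comm, ← h2]
    simp [Finset.mul_sum, Finset.sum_mul, mul_assoc, mul_comm]

end Multiplicative
end
end QG

namespace QG
noncomputable section
open scoped TensorProduct ComplexOrder CStarAlgebra
open Coalgebra HopfAlgebra

/-! ### Extending maps to C(G) ⊗ A -/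

section MinTensorTools
attribute [local instance] CStarAlgebra.spectralOrder CStarAlgebra.spectralOrderedRing
variable {H : Type u} [Ring H] [StarRing H] [HopfAlgebra ℂ H] [StarModule ℂ H]
  [CompactQuantumGroup H] {A : Type v} [CStarAlgebra A] {B : Type w} [CStarAlgebra B]

lemma denseRange_ofAlg : DenseRange (ofAlg : H ⊗[ℂ] A → MinTensor H A) :=
  UniformSpace.Completion.denseRange_coe (α := AlgTensor H A)

lemma norm_ofAlg (z : H ⊗[ℂ] A) : ‖(ofAlg z : MinTensor H A)‖ = ‖(show AlgTensor H A from z)‖ :=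
  UniformSpace.Completion.norm_coe (E := AlgTensor H A) z

lemma ofAlg_injective : Function.Injective (ofAlg : H ⊗[ℂ] A → MinTensor H A) :=
  UniformSpace.Completion.coe_injective (AlgTensor H A)

lemma norm_ofAlg_le {z : H ⊗[ℂ] A} {C : ℝ} (hC : 0 ≤ C)
    (h : ∀ y, modNorm (z * y) ≤ C * modNorm y) : ‖(ofAlg z : MinTensor H A)‖ ≤ C := by
  rw [norm_ofAlg]
  exact ContinuousLinearMap.opNorm_le_bound _ hC h

lemma exists_extension_ofAlg {E : Type*} [NormedAddCommGroup E] [NormedSpace ℂ E] [CompleteSpace E]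
    (g : H ⊗[ℂ] A →ₗ[ℂ] E) (C : ℝ) (h : ∀ z, ‖g z‖ ≤ C * ‖(ofAlg z : MinTensor H A)‖) :
    ∃ G : MinTensor H A →L[ℂ] E, ∀ z, G (ofAlg z) = g z := by
  let g' : AlgTensor H A →L[ℂ] E := LinearMap.mkContinuous (g : AlgTensor H A →ₗ[ℂ] E) C
    (fun z => (h z).trans_eq (congrArg (C * ·) (norm_ofAlg (H := H) (A := A) z)))
  refine ⟨g'.extend (UniformSpace.Completion.toComplL (𝕜 := ℂ) (E := AlgTensor H A)), fun z => ?_⟩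
  exact g'.extend_eq (e := UniformSpace.Completion.toComplL (𝕜 := ℂ) (E := AlgTensor H A))
    (UniformSpace.Completion.denseRange_coe)
    (UniformSpace.Completion.isUniformInducing_coe _) (show AlgTensor H A from z)

lemma minSlice_ofAlg_eq (x : H) (z : H ⊗[ℂ] A) :
    minSlice x (ofAlg z) = slice (haar H ∘ₗ LinearMap.mulRight ℂ x) z := by
  induction z using TensorProduct.induction_on with
  | zero => simp
  | add x y hx hy => simp only [map_add, hx, hy]
  | tmul c a => rw [minSlice_ofAlg]; simp

lemma minTensor_clm_ext {E : Type*} [NormedAddCommGroup E] [NormedSpace ℂ E]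
    {F G : MinTensor H A →L[ℂ] E} (h : ∀ c a, F (ofAlg (c ⊗ₜ[ℂ] a)) = G (ofAlg (c ⊗ₜ[ℂ] a))) :
    F = G := by
  apply DFunLike.coe_injective
  refine denseRange_ofAlg.equalizer F.continuous G.continuous (funext fun z => ?_)
  induction z using TensorProduct.induction_on with
  | zero => simp
  | add x y hx hy =>
    simp only [Function.comp_apply, map_add] at hx hy ⊢
    rw [hx, hy]
  | tmul c a => exact h c a

/-- The slice map as a linear function of the functional. -/
def minSliceₗ (w : MinTensor H A) : H →ₗ[ℂ] A where
  toFun x := minSlice x w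
  map_add' x y := by
    have : (minSlice (x + y) : MinTensor H A →L[ℂ] A) = minSlice x + minSlice y :=
      minTensor_clm_ext fun c a => by simp [minSlice_ofAlg, mul_add, add_smul]
    rw [this]; rfl
  map_smul' r x := by
    have : (minSlice (r • x) : MinTensor H A →L[ℂ] A) = r • minSlice x :=
      minTensor_clm_ext fun c a => by simp [minSlice_ofAlg, smul_smul]
    rw [this]; rfl

@[simp] lemma minSliceₗ_apply (w : MinTensor H A) (x : H) : minSliceₗ w x = minSlice x w := rfl

lemma nonneg_of_nonneg_ofAlg (F : MinTensor H A →L[ℂ] B)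
    (hF : ∀ w : H ⊗[ℂ] A, 0 ≤ F (ofAlg (star w * w))) (r : MinTensor H A) :
    0 ≤ F (star r * r) := by
  refine denseRange_ofAlg.induction_on r ?_ fun w => ?_
  · exact isClosed_setOf_nonneg.preimage (F.continuous.comp (by fun_prop))
  · have := hF w
    rwa [map_mul, StarHomClass.map_star] at this

lemma exists_norm_sq_sub_eq (w : A) :
    ∃ r : A, ((‖w‖ ^ 2 : ℝ) : ℂ) • (1 : A) - star w * w = star r * r := by
  obtain ⟨r, hr⟩ := exists_star_mul_self_of_nonneg
    (sub_nonneg.mpr (CStarAlgebra.star_mul_le_algebraMap_norm_sq (a := w)))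
  refine ⟨r, ?_⟩
  rw [← hr, Algebra.algebraMap_eq_smul_one, Complex.coe_smul]

/-- The difference ‖w‖²1 − w*w is a square r*r, but r lies only in the completion;
`nonneg_of_nonneg_ofAlg` carries positivity there by density. -/
lemma apply_star_mul_self_le (F : MinTensor H A →L[ℂ] B)
    (hF : ∀ w : H ⊗[ℂ] A, 0 ≤ F (ofAlg (star w * w))) (w : MinTensor H A) :
    F (star w * w) ≤ (‖w‖ ^ 2 : ℝ) • F 1 := by
  obtain ⟨r, hr⟩ := exists_norm_sq_sub_eq w
  have := nonneg_of_nonneg_ofAlg F hF r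
  rwa [← hr, map_sub, sub_nonneg, map_smul, Complex.coe_smul] at this

lemma modInner_mul_tmul_left (p q : H ⊗[ℂ] A) (a : A) :
    modInner (p * ((1 : H) ⊗ₜ[ℂ] a)) q = star a * modInner p q := by
  rw [← star_modInner, modInner_mul_right_tmul, star_mul, star_modInner]

/-- A unital linear map between algebraic tensor products that satisfies the Kadison–Schwarz
inequality in the module sense and has continuous matrix coefficients extends to the completions. -/
lemma exists_extension_of_schwarz (ρ : H ⊗[ℂ] A →ₗ[ℂ] H ⊗[ℂ] B) (h1 : ρ 1 = 1)
    (hcont : ∀ e e' : H, ∃ G : MinTensor H A →L[ℂ] B, ∀ w, G (ofAlg w) =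
      modInner (e ⊗ₜ[ℂ] (1 : B)) (ρ w * (e' ⊗ₜ[ℂ] (1 : B))))
    (hs : ∀ w y, modInner (ρ w * y) (ρ w * y) ≤ modInner y (ρ (star w * w) * y)) :
    ∃ G : MinTensor H A →L[ℂ] MinTensor H B, ∀ z, G (ofAlg z) = ofAlg (ρ z) := by
  have hG : ∀ y y' : H ⊗[ℂ] B, ∃ G : MinTensor H A →L[ℂ] B, ∀ w, G (ofAlg w) =
      modInner y (ρ w * y') := by
    intro y y'
    induction y using TensorProduct.induction_on with
    | zero => exact ⟨0, fun w => by simp [modInner]⟩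
    | add x y hx hy =>
      obtain ⟨F, hF⟩ := hx
      obtain ⟨G, hG⟩ := hy
      exact ⟨F + G, fun w => by simp [hF, hG, modInner_add_left]⟩
    | tmul e b =>
      induction y' using TensorProduct.induction_on with
      | zero => exact ⟨0, fun w => by simp [modInner]⟩
      | add x y hx hy =>
        obtain ⟨F, hF⟩ := hx
        obtain ⟨G, hG⟩ := hy
        exact ⟨F + G, fun w => by simp [hF, hG, mul_add, modInner_add_right]⟩
      | tmul e' b' =>
        obtain ⟨G, hG⟩ := hcont e e'
        refine ⟨(ContinuousLinearMap.mul ℂ B (star b)).comp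
          (((ContinuousLinearMap.mul ℂ B).flip b').comp G), fun w => ?_⟩
        have e1 : ∀ (e : H) (b : B), e ⊗ₜ[ℂ] b = (e ⊗ₜ[ℂ] (1 : B)) * ((1 : H) ⊗ₜ[ℂ] b) := by
          intro e b; simp
        rw [e1 e b, e1 e' b', modInner_mul_tmul_left, ← mul_assoc (ρ w), modInner_mul_right_tmul]
        simp [hG]
  -- The functional w ↦ ⟨y, ρ(w)y⟩ extends continuously and is positive, so its value at z*z is at
  -- most ‖z‖²⟨y, y⟩. With the Schwarz hypothesis this bounds ρ(z) as an operator.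
  have hn : ∀ z, ‖(ofAlg (ρ z) : MinTensor H B)‖ ≤ 1 * ‖(ofAlg z : MinTensor H A)‖ := by
    intro z
    rw [one_mul]
    refine norm_ofAlg_le (norm_nonneg _) fun y => ?_
    apply modNorm_le_of_le (norm_nonneg _)
    obtain ⟨G, hG⟩ := hG y y
    have h2 := apply_star_mul_self_le G (fun w => by
      rw [hG]; exact (modInner_self_nonneg _).trans (hs w y)) (ofAlg z)
    rw [← map_one (ofAlg : H ⊗[ℂ] A →⋆ₐ[ℂ] MinTensor H A), hG, ← StarHomClass.map_star, ← map_mul,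
      hG, h1, one_mul] at h2
    exact (hs z y).trans h2
  exact exists_extension_ofAlg (ofAlg.toLinearMap ∘ₗ ρ) 1 hn

/-- The two-sided slice `(h(p · z) ⊗ ι)`. -/
def minSlice₂ (p z : H) : MinTensor H A →L[ℂ] A :=
  (minSlice z).comp (ContinuousLinearMap.mul ℂ (MinTensor H A) (ofAlg (p ⊗ₜ[ℂ] (1 : A))))

lemma minSlice₂_ofAlg (p z c : H) (a : A) :
    minSlice₂ p z (ofAlg (c ⊗ₜ[ℂ] a)) = haar H (p * c * z) • a := by
  change minSlice z (ofAlg (p ⊗ₜ[ℂ] (1 : A)) * ofAlg (c ⊗ₜ[ℂ] a)) = _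
  rw [← map_mul, Algebra.TensorProduct.tmul_mul_tmul, minSlice_ofAlg, one_mul]

lemma lTensor_mul_tmul_one (φ : A →ₗ[ℂ] B) (w : H ⊗[ℂ] A) (e : H) :
    φ.lTensor H (w * (e ⊗ₜ[ℂ] (1 : A))) = φ.lTensor H w * (e ⊗ₜ[ℂ] (1 : B)) := by
  induction w using TensorProduct.induction_on with
  | zero => simp
  | add x y hx hy => simp only [map_add, add_mul, hx, hy]
  | tmul c a => simp

lemma modInner_tmul_one_lTensor (φ : A →ₗ[ℂ] B) (t : H ⊗[ℂ] A) (e : H) :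
    modInner (e ⊗ₜ[ℂ] (1 : B)) (φ.lTensor H t) = φ (modInner (e ⊗ₜ[ℂ] (1 : A)) t) := by
  induction t using TensorProduct.induction_on with
  | zero => simp [modInner]
  | add x y hx hy => simp only [map_add, modInner_add_right, hx, hy]
  | tmul c a => simp [modInner_tmul]

/-- Expanding in an orthonormal family reduces the inequality to `IsUCP.schwarz_sum`, applied for
each member of that family. -/
lemma lTensor_schwarz {φ : A →ₗ[ℂ] B} (hφ : IsUCP φ) (w : H ⊗[ℂ] A) (y : H ⊗[ℂ] B) :
    modInner (φ.lTensor H w * y) (φ.lTensor H w * y) ≤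
      modInner y (φ.lTensor H (star w * w) * y) := by
  obtain ⟨n, e, b, -, rfl⟩ := exists_orthonormal_expansion y
  -- The n tensors w(eₖ ⊗ 1) are collected in H ⊗ Aⁿ, so that one orthonormal family g serves all k.
  obtain ⟨m, g, d, hg, hd⟩ := exists_orthonormal_expansion
    (∑ k, (LinearMap.single ℂ (fun _ : Fin n => A) k).lTensor H (w * (e k ⊗ₜ[ℂ] (1 : A))))
  have hw : ∀ k, w * (e k ⊗ₜ[ℂ] (1 : A)) = ∑ i, g i ⊗ₜ[ℂ] d i k := by
    intro k
    have h1 := congrArg ((LinearMap.proj k : (Fin n → A) →ₗ[ℂ] A).lTensor H) hd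
    simp only [map_sum, LinearMap.lTensor_tmul, LinearMap.proj_apply] at h1
    rw [← h1]
    have h2 : ∀ j, (LinearMap.proj k : (Fin n → A) →ₗ[ℂ] A).lTensor H
        ((LinearMap.single ℂ (fun _ : Fin n => A) j).lTensor H (w * (e j ⊗ₜ[ℂ] (1 : A)))) =
        if j = k then w * (e j ⊗ₜ[ℂ] (1 : A)) else 0 := by
      intro j
      rw [← LinearMap.comp_apply, ← LinearMap.lTensor_comp]
      split_ifs with hjk
      · subst hjk
        rw [LinearMap.proj_comp_single_same, LinearMap.lTensor_id, LinearMap.id_apply]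
      · rw [LinearMap.proj_comp_single_ne _ _ _ _ (Ne.symm hjk), LinearMap.lTensor_zero,
          LinearMap.zero_apply]
    simp [h2]
  have e1 : ∀ (e : H) (b : B), e ⊗ₜ[ℂ] b = (e ⊗ₜ[ℂ] (1 : B)) * ((1 : H) ⊗ₜ[ℂ] b) := by
    intro e b; simp
  have h1 : φ.lTensor H w * ∑ k, e k ⊗ₜ[ℂ] b k = ∑ i, g i ⊗ₜ[ℂ] ∑ k, φ (d i k) * b k := by
    simp only [TensorProduct.tmul_sum]
    rw [Finset.mul_sum, Finset.sum_comm]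
    refine Finset.sum_congr rfl fun k _ => ?_
    rw [e1 (e k), ← mul_assoc, ← lTensor_mul_tmul_one, hw, map_sum, Finset.sum_mul]
    simp
  have h2 : ∀ j k, modInner (e j ⊗ₜ[ℂ] b j) (φ.lTensor H (star w * w) * (e k ⊗ₜ[ℂ] b k)) =
      ∑ i, star (b j) * φ (star (d i j) * d i k) * b k := by
    intro j k
    rw [e1 (e j), e1 (e k), ← mul_assoc, modInner_mul_tmul_left, modInner_mul_right_tmul,
      ← lTensor_mul_tmul_one, modInner_tmul_one_lTensor, mul_assoc (star w), ← modInner_mul_left,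
      hw, hw, modInner_expansion hg]
    simp [Finset.mul_sum, Finset.sum_mul, mul_assoc]
  have h3 : modInner (∑ k, e k ⊗ₜ[ℂ] b k)
      (φ.lTensor H (star w * w) * ∑ k, e k ⊗ₜ[ℂ] b k) =
      ∑ i, ∑ j, ∑ k, star (b j) * φ (star (d i j) * d i k) * b k := by
    have e2 : ∀ (s : Fin n → H ⊗[ℂ] B) t, modInner (∑ j, s j) t = ∑ j, modInner (s j) t := by
      intro s t; simp [modInner, star_sum, Finset.sum_mul]
    have e3 : ∀ (s : Fin n → H ⊗[ℂ] B) t, modInner t (∑ j, s j) = ∑ j, modInner t (s j) := by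
      intro s t; simp [modInner, Finset.mul_sum]
    rw [e2, Finset.mul_sum]
    simp only [e3, h2]
    rw [Finset.sum_congr rfl fun j _ => Finset.sum_comm, Finset.sum_comm]
  rw [h1, h3, modInner_expansion hg]
  exact Finset.sum_le_sum fun i _ => hφ.schwarz_sum (d i) b

lemma exists_mapRight {φ : A →ₗ[ℂ] B} (hφ : IsUCP φ) :
    ∃ G : MinTensor H A →L[ℂ] MinTensor H B, ∀ z, G (ofAlg z) = ofAlg (φ.lTensor H z) := by
  refine exists_extension_of_schwarz _ (by simp [Algebra.TensorProduct.one_def, hφ.1])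
    (fun e e' => ⟨hφ.toCLM.comp (minSlice₂ (star e) e'), fun w => ?_⟩) (lTensor_schwarz hφ)
  rw [← lTensor_mul_tmul_one, modInner_tmul_one_lTensor]
  simp only [ContinuousLinearMap.comp_apply, IsUCP.toCLM_apply]
  congr 1
  induction w using TensorProduct.induction_on with
  | zero => simp [modInner]
  | add x y hx hy => simp only [map_add, add_mul, modInner_add_right, hx, hy]
  | tmul c a => simp [minSlice₂_ofAlg, modInner, mul_assoc]

/-- The map `ι ⊗ φ : C(G) ⊗ A → C(G) ⊗ B` for a ucp map `φ`. -/
def mapRight {φ : A →ₗ[ℂ] B} (hφ : IsUCP φ) : MinTensor H A →L[ℂ] MinTensor H B :=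
  (exists_mapRight hφ).choose

lemma mapRight_ofAlg {φ : A →ₗ[ℂ] B} (hφ : IsUCP φ) (z : H ⊗[ℂ] A) :
    mapRight hφ (ofAlg z) = ofAlg (φ.lTensor H z) := (exists_mapRight hφ).choose_spec z

lemma minSlice_mapRight {φ : A →ₗ[ℂ] B} (hφ : IsUCP φ) (x : H) (w : MinTensor H A) :
    minSlice x (mapRight hφ w) = φ (minSlice x w) := by
  have : (minSlice x).comp (mapRight hφ) = hφ.toCLM.comp (minSlice (A := A) x) :=
    minTensor_clm_ext fun c a => by simp [mapRight_ofAlg, minSlice_ofAlg]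
  exact DFunLike.congr_fun this w

/-- The homomorphism `(ι ⊗ j)(Δ ⊗ ι)` for a homomorphism `j` on `ℂ[G] ⊗ A`. -/
def comulAlg (j : H ⊗[ℂ] A →⋆ₐ[ℂ] B) : H ⊗[ℂ] A →ₐ[ℂ] H ⊗[ℂ] B :=
  ((Algebra.TensorProduct.map (AlgHom.id ℂ H) j.toAlgHom).comp
    (Algebra.TensorProduct.assoc ℂ ℂ ℂ H H A).toAlgHom).comp
    (Algebra.TensorProduct.map (Bialgebra.comulAlgHom ℂ H) (AlgHom.id ℂ A))

lemma comulAlg_tmul (j : H ⊗[ℂ] A →⋆ₐ[ℂ] B) {ι : Type*} [Fintype ι] {c : H} {c₁ c₂ : ι → H}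
    (hc : comul (R := ℂ) c = ∑ i, c₁ i ⊗ₜ[ℂ] c₂ i) (a : A) :
    comulAlg j (c ⊗ₜ[ℂ] a) = ∑ i, c₁ i ⊗ₜ[ℂ] j (c₂ i ⊗ₜ[ℂ] a) := by
  simp [comulAlg, hc, TensorProduct.sum_tmul]

lemma comulAlg_star (j : H ⊗[ℂ] A →⋆ₐ[ℂ] B) (w : H ⊗[ℂ] A) :
    comulAlg j (star w) = star (comulAlg j w) := by
  induction w using TensorProduct.induction_on with
  | zero => simp
  | add x y hx hy => simp only [map_add, star_add, hx, hy]
  | tmul c a =>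
    obtain ⟨n, c₁, c₂, hc⟩ := exists_comul_eq_sum c
    rw [comulAlg_tmul j hc, TensorProduct.star_tmul, comulAlg_tmul j (comul_star_of_eq hc), star_sum]
    simp [← StarHomClass.map_star]

/-- Here `comulAlg j` is a `*`-homomorphism, so the Schwarz inequality is an equality. Its matrix
coefficients are continuous since strong invariance moves the coproduct from the argument to the
vectors; `T` supplies continuity of a ↦ j(c ⊗ a) for fixed c. -/
lemma exists_extension_comulAlg (j : H ⊗[ℂ] A →⋆ₐ[ℂ] B) (T : H → A →L[ℂ] B)
    (hT : ∀ c a, T c a = j (c ⊗ₜ[ℂ] a)) : ∃ G : MinTensor H A →L[ℂ] MinTensor H B,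
    ∀ z, G (ofAlg z) = ofAlg (comulAlg j z) := by
  refine exists_extension_of_schwarz (comulAlg j).toLinearMap (map_one (comulAlg j)) (fun e e' => ?_)
    (fun w y => le_of_eq ?_)
  · obtain ⟨n, p₁, p₂, hp⟩ := exists_comul_eq_sum (star e)
    obtain ⟨m, z₁, z₂, hz⟩ := exists_comul_eq_sum e'
    refine ⟨∑ i, ∑ k, (T (antipodeInv H (p₂ i) * antipode ℂ (z₂ k))).comp
      (minSlice₂ (p₁ i) (z₁ k)), fun w => ?_⟩
    induction w using TensorProduct.induction_on with
    | zero => simp [modInner]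
    | add x y hx hy => simp only [map_add, add_mul, modInner_add_right, hx, hy]
    | tmul c a =>
      obtain ⟨k, c₁, c₂, hc⟩ := exists_comul_eq_sum c
      have h1 := haar_strong_invariance hp hz c
      rw [hc] at h1
      simp only [Finset.mul_sum, Finset.sum_mul, Algebra.TensorProduct.tmul_mul_tmul, one_mul,
        mul_one, map_sum, LinearMap.rTensor_tmul, TensorProduct.lid_tmul] at h1
      have h2 := congrArg (fun t => j (t ⊗ₜ[ℂ] a)) h1
      simp only [TensorProduct.sum_tmul, map_sum, ← TensorProduct.smul_tmul', map_smul] at h2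
      rw [AlgHom.toLinearMap_apply, comulAlg_tmul j hc]
      simp only [FunLike.coe_sum, Finset.sum_apply, ContinuousLinearMap.comp_apply,
        minSlice₂_ofAlg, hT, TensorProduct.tmul_smul, map_smul]
      rw [← h2]
      simp [modInner, Finset.sum_mul, Finset.mul_sum, mul_assoc]
  · rw [modInner_mul_left]
    simp [comulAlg_star, mul_assoc]

lemma continuous_starAlgHom (f : A →⋆ₐ[ℂ] B) : Continuous f :=
  (IsUCP.of_starAlgHom f).continuous

variable (H) in
lemma continuous_ofAlg_tmul (c : H) : Continuous fun a : A => (ofAlg (c ⊗ₜ[ℂ] a) : MinTensor H A) := by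
  let i : A →⋆ₐ[ℂ] MinTensor H A := ofAlg.comp
    { (Algebra.TensorProduct.includeRight (R := ℂ) (A := H) (B := A)) with
      map_star' := fun a => by simp }
  have h : ∀ a : A, (ofAlg (c ⊗ₜ[ℂ] a) : MinTensor H A) = ofAlg (c ⊗ₜ[ℂ] (1 : A)) * i a := by
    intro a
    have : i a = ofAlg ((1 : H) ⊗ₜ[ℂ] a) := rfl
    rw [this, ← map_mul, Algebra.TensorProduct.tmul_mul_tmul, mul_one, one_mul]
  rw [funext h]
  exact continuous_const.mul (continuous_starAlgHom i)

/-- The map `a ↦ c ⊗ a`. -/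
def tmulRight (c : H) : A →L[ℂ] MinTensor H A where
  toFun a := ofAlg (c ⊗ₜ[ℂ] a)
  map_add' a b := by simp [TensorProduct.tmul_add]
  map_smul' r a := by simp
  cont := continuous_ofAlg_tmul H c

@[simp] lemma tmulRight_apply (c : H) (a : A) :
    (tmulRight c : A →L[ℂ] MinTensor H A) a = ofAlg (c ⊗ₜ[ℂ] a) := rfl

/-- The map `Δ ⊗ ι : C(G) ⊗ A → C(G) ⊗ C(G) ⊗ A`. -/
def comulExt : MinTensor H A →L[ℂ] MinTensor H (MinTensor H A) :=
  (exists_extension_comulAlg ofAlg tmulRight fun _ _ => rfl).choose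

lemma comulExt_ofAlg (z : H ⊗[ℂ] A) :
    comulExt (ofAlg z : MinTensor H A) = ofAlg (comulAlg ofAlg z) :=
  (exists_extension_comulAlg ofAlg tmulRight fun _ _ => rfl).choose_spec z

end MinTensorTools
end
end QG

namespace QG
noncomputable section
open scoped TensorProduct ComplexOrder CStarAlgebra
open Coalgebra HopfAlgebra

/-! ### Coassociativity in coordinates, and consequences of the axioms of an action -/

section SweedlerCoassoc
variable {H : Type u} [Ring H] [HopfAlgebra ℂ H]

/-- The expansions of the iterated coproduct are chosen independently, so coassociativity is only
visible after applying a linear map to both of them. -/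
lemma sum_coassoc {M : Type*} [AddCommGroup M] [Module ℂ M] (T : H ⊗[ℂ] (H ⊗[ℂ] H) →ₗ[ℂ] M)
    {n : ℕ} {k l : Fin n → ℕ} {x : H} {x₁ x₂ : Fin n → H} {a b : ∀ i, Fin (k i) → H}
    {c d : ∀ i, Fin (l i) → H} (hx : comul (R := ℂ) x = ∑ i, x₁ i ⊗ₜ[ℂ] x₂ i)
    (hab : ∀ i, comul (R := ℂ) (x₁ i) = ∑ j, a i j ⊗ₜ[ℂ] b i j)
    (hcd : ∀ i, comul (R := ℂ) (x₂ i) = ∑ j, c i j ⊗ₜ[ℂ] d i j) :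
    ∑ i, ∑ j, T (a i j ⊗ₜ[ℂ] (b i j ⊗ₜ[ℂ] x₂ i)) =
      ∑ i, ∑ j, T (x₁ i ⊗ₜ[ℂ] (c i j ⊗ₜ[ℂ] d i j)) := by
  have h := congrArg T (coassoc_apply (R := ℂ) x)
  simpa [hx, hab, hcd, TensorProduct.sum_tmul, TensorProduct.tmul_sum] using h

/-- The linear map on a triple tensor product given by a trilinear map. -/
def trilift {M : Type*} [AddCommGroup M] [Module ℂ M] (T : H →ₗ[ℂ] H →ₗ[ℂ] H →ₗ[ℂ] M) :
    H ⊗[ℂ] (H ⊗[ℂ] H) →ₗ[ℂ] M :=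
  TensorProduct.lift ((TensorProduct.uncurry (RingHom.id ℂ) H H M) ∘ₗ T)

@[simp] lemma trilift_tmul {M : Type*} [AddCommGroup M] [Module ℂ M]
    (T : H →ₗ[ℂ] H →ₗ[ℂ] H →ₗ[ℂ] M) (p q r : H) :
    trilift T (p ⊗ₜ[ℂ] (q ⊗ₜ[ℂ] r)) = T p q r := rfl

end SweedlerCoassoc

section ActionFacts
attribute [local irreducible] instCStarAlgebraMinTensor
attribute [local instance] CStarAlgebra.spectralOrder CStarAlgebra.spectralOrderedRing
variable {H : Type u} [Ring H] [StarRing H] [HopfAlgebra ℂ H] [StarModule ℂ H]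
  [CompactQuantumGroup H] {A : Type v} [CStarAlgebra A] {B : Type w} [CStarAlgebra B]

@[simp] lemma minSlice_add (x y : H) (w : MinTensor H A) :
    minSlice (x + y) w = minSlice x w + minSlice y w := (minSliceₗ w).map_add x y

lemma minSlice_one_mul (x : H) (w : MinTensor H A) :
    minSlice 1 (w * ofAlg (x ⊗ₜ[ℂ] (1 : A))) = minSlice x w := by
  have : (minSlice 1).comp ((ContinuousLinearMap.mul ℂ (MinTensor H A)).flip
      (ofAlg (x ⊗ₜ[ℂ] (1 : A)))) = minSlice x := minTensor_clm_ext fun c a => by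
    rw [minSlice_ofAlg, ContinuousLinearMap.comp_apply, ContinuousLinearMap.flip_apply,
      ContinuousLinearMap.mul_apply', ← map_mul, Algebra.TensorProduct.tmul_mul_tmul,
      minSlice_ofAlg]
    simp
  exact DFunLike.congr_fun this w

lemma minSlice_comulExt (x : H) {ι : Type*} [Fintype ι] {x₁ x₂ : ι → H}
    (hx : comul (R := ℂ) x = ∑ i, x₁ i ⊗ₜ[ℂ] x₂ i) (w : MinTensor H A) :
    minSlice x (comulExt w) = ofAlg (∑ i, antipode ℂ (x₂ i) ⊗ₜ[ℂ] minSlice (x₁ i) w) := by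
  have : (minSlice x).comp comulExt =
      ∑ i, (tmulRight (antipode ℂ (x₂ i))).comp (minSlice (A := A) (x₁ i)) := by
    refine minTensor_clm_ext fun c a => ?_
    obtain ⟨k, c₁, c₂, hc⟩ := exists_comul_eq_sum c
    have h1 := congrArg (fun t => (ofAlg (t ⊗ₜ[ℂ] a) : MinTensor H A))
      (haar_strong_invariance_right hx hc)
    simp only [TensorProduct.sum_tmul, map_sum, ← TensorProduct.smul_tmul', map_smul] at h1
    rw [ContinuousLinearMap.comp_apply, comulExt_ofAlg, comulAlg_tmul _ hc, map_sum, map_sum]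
    simp only [minSlice_ofAlg, h1, FunLike.coe_sum, Finset.sum_apply,
      ContinuousLinearMap.comp_apply, map_smul, tmulRight_apply]
  rw [map_sum]
  simpa using DFunLike.congr_fun this w

variable {α : A →⋆ₐ[ℂ] MinTensor H A}

/-- The continuous maps in the definition of an action are determined on elementary tensors, so they
are ι ⊗ α and Δ ⊗ ι as constructed above. -/
lemma IsAction.mapRight_eq (hα : IsAction α) (a : A) :
    mapRight (IsUCP.of_starAlgHom α) (α a) = comulExt (α a) := by
  obtain ⟨Φ, Ψ, hΦ, hΨ, h⟩ := hα.coassociative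
  have h1 : Φ = mapRight (IsUCP.of_starAlgHom α) := minTensor_clm_ext fun c a => by
    rw [hΦ, mapRight_ofAlg]; rfl
  have h2 : Ψ = comulExt := minTensor_clm_ext fun c a => by
    obtain ⟨k, c₁, c₂, hc⟩ := exists_comul_eq_sum c
    rw [hΨ, comulExt_ofAlg, comulAlg_tmul _ hc, hc, map_sum]
    rfl
  rw [← h1, ← h2, h]

/-- Slice the coassociativity identity in the outer leg. In particular every slice of α(b) is
regular. -/
lemma IsAction.apply_minSlice (hα : IsAction α) (b : A) {x : H} {ι : Type*} [Fintype ι]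
    {x₁ x₂ : ι → H} (hx : comul (R := ℂ) x = ∑ i, x₁ i ⊗ₜ[ℂ] x₂ i) :
    α (minSlice x (α b)) = ofAlg (∑ i, antipode ℂ (x₂ i) ⊗ₜ[ℂ] minSlice (x₁ i) (α b)) := by
  rw [← minSlice_comulExt x hx, ← hα.mapRight_eq, minSlice_mapRight]
  rfl

/-- The adjoint of (x ⊗ 1)α(a) is α(a*)(x* ⊗ 1), whose slice by h is a slice of α(a*). The Podleś
condition lets these approximate 1 ⊗ a. -/
lemma IsAction.dense_minSlice (hα : IsAction α) :
    Dense (Submodule.span ℂ {a : A | ∃ (x : H) (b : A), a = minSlice x (α b)} : Set A) := by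
  set K := Submodule.span ℂ {a : A | ∃ (x : H) (b : A), a = minSlice x (α b)}
  have h : ∀ w : MinTensor H A, minSlice 1 (star w) ∈ K.topologicalClosure := by
    intro w
    have hc : Continuous fun w : MinTensor H A => (minSlice (1 : H) (star w) : A) :=
      (minSlice (1 : H)).continuous.comp continuous_star
    have h1 := closure_minimal (t := {w : MinTensor H A | minSlice 1 (star w) ∈ K.topologicalClosure})
      (s := (Submodule.span ℂ {t : MinTensor H A | ∃ (x : H) (a : A),
        t = ofAlg (x ⊗ₜ[ℂ] (1 : A)) * α a} : Set (MinTensor H A)))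
      (fun w hw => ?_) (K.isClosed_topologicalClosure.preimage hc)
    · exact h1 (hα.podles w)
    · refine Submodule.span_induction (p := fun w _ => minSlice 1 (star w) ∈ K.topologicalClosure)
        ?_ ?_ ?_ ?_ hw
      · rintro _ ⟨x, a, rfl⟩
        rw [star_mul, ← StarHomClass.map_star, ← StarHomClass.map_star, TensorProduct.star_tmul,
          star_one, minSlice_one_mul]
        exact K.le_topologicalClosure (Submodule.subset_span ⟨_, _, rfl⟩)
      · rw [star_zero, map_zero]; exact zero_mem _
      · intro x y _ _ hx hy
        rw [star_add, map_add]; exact add_mem hx hy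
      · intro r x _ hx
        rw [star_smul, map_smul]; exact Submodule.smul_mem _ _ hx
  intro a
  have h2 := h (star (ofAlg ((1 : H) ⊗ₜ[ℂ] a)))
  rw [star_star, minSlice_ofAlg, mul_one, (haar_spec H).map_one, one_smul] at h2
  exact h2

/-- The counit law is not among the axioms. Applying ε to the outer leg of coassociativity gives it
after α, and α is injective. -/
lemma IsAction.slice_counit (hα : IsAction α) {a : A} {z : H ⊗[ℂ] A} (hz : α a = ofAlg z) :
    slice counit z = a := by
  apply hα.injective
  have h1 := hα.mapRight_eq a
  rw [hz, mapRight_ofAlg, comulExt_ofAlg] at h1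
  have h2 := congrArg (slice (counit (R := ℂ))) (ofAlg_injective h1)
  have h3 : ∀ z : H ⊗[ℂ] A, slice (counit (R := ℂ)) (LinearMap.lTensor H
      (α : A →ₗ[ℂ] MinTensor H A) z) = α (slice (counit (R := ℂ)) z) := by
    intro z
    induction z using TensorProduct.induction_on with
    | zero => simp
    | add x y hx hy => simp only [map_add, hx, hy]
    | tmul c a => simp
  have h4 : ∀ z : H ⊗[ℂ] A, slice (counit (R := ℂ)) (comulAlg
      (ofAlg : H ⊗[ℂ] A →⋆ₐ[ℂ] MinTensor H A) z) = ofAlg z := by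
    intro z
    induction z using TensorProduct.induction_on with
    | zero => simp
    | add x y hx hy => simp only [map_add, hx, hy]
    | tmul c a =>
      obtain ⟨k, c₁, c₂, hc⟩ := exists_comul_eq_sum c
      rw [comulAlg_tmul _ hc]
      simp only [map_sum, slice_tmul, ← map_smul, TensorProduct.smul_tmul']
      rw [← map_sum, ← TensorProduct.sum_tmul, sum_counit_smul_right hc]
  rw [h3, h4] at h2
  rw [h2, hz]

/-- On the finitely many left legs of α(a) the counit agrees with some h(· x). -/
lemma IsAction.exists_minSlice_eq (hα : IsAction α) {a : A} {z : H ⊗[ℂ] A} (hz : α a = ofAlg z) :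
    ∃ x : H, a = minSlice x (α a) := by
  obtain ⟨n, e, b, -, he⟩ := exists_orthonormal_expansion z
  obtain ⟨x, hx⟩ := exists_haar_mul_eq_counit e
  refine ⟨x, ?_⟩
  conv_lhs => rw [← hα.slice_counit hz]
  rw [hz, he]
  simp only [map_sum, minSlice_ofAlg, hx, slice_tmul]

/-- A regular element is one of its own slices, and `apply_minSlice` expresses the coaction on
slices again by slices, which φ respects. -/
lemma IsAction.map_of_commute {β : B →⋆ₐ[ℂ] MinTensor H B} (hα : IsAction α) (hβ : IsAction β)
    {φ : A →ₗ[ℂ] B} (h : ∀ a x, φ (minSlice x (α a)) = minSlice x (β (φ a))) {a : A}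
    {z : H ⊗[ℂ] A} (hz : α a = ofAlg z) : β (φ a) = ofAlg (φ.lTensor H z) := by
  obtain ⟨x, hx⟩ := hα.exists_minSlice_eq hz
  obtain ⟨n, x₁, x₂, hx'⟩ := exists_comul_eq_sum x
  have h1 := hα.apply_minSlice a hx'
  rw [← hx] at h1
  rw [ofAlg_injective (hz.symm.trans h1)]
  conv_lhs => rw [hx, h, hβ.apply_minSlice _ hx']
  simp [h]

/-- A criterion for an injective homomorphism to be an action. -/
lemma isAction_of (hinj : Function.Injective α)
    (h : ∀ (b : A) (x : H) (n : ℕ) (x₁ x₂ : Fin n → H), comul (R := ℂ) x = ∑ i, x₁ i ⊗ₜ[ℂ] x₂ i →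
      α (minSlice x (α b)) = ofAlg (∑ i, antipode ℂ (x₂ i) ⊗ₜ[ℂ] minSlice (x₁ i) (α b)))
    (hd : Dense (Submodule.span ℂ {a : A | ∃ (x : H) (b : A), a = minSlice x (α b)} : Set A)) :
    IsAction α where
  injective := hinj
  coassociative := by
    refine ⟨mapRight (IsUCP.of_starAlgHom α), comulExt, fun x a => ?_, fun x a => ?_, fun a => ?_⟩
    · rw [mapRight_ofAlg]; rfl
    · obtain ⟨k, c₁, c₂, hc⟩ := exists_comul_eq_sum x
      rw [comulExt_ofAlg, comulAlg_tmul _ hc, hc, map_sum, map_sum, map_sum]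
      rfl
    · have hcα := continuous_starAlgHom α
      have hcl : IsClosed {a : A | mapRight (IsUCP.of_starAlgHom α) (α a) = comulExt (α a)} :=
        isClosed_eq ((mapRight _).continuous.comp hcα) (comulExt.continuous.comp hcα)
      refine closure_minimal (fun a ha => ?_) hcl (hd a)
      -- On a slice both sides are computed by the slice formula `h`; they agree by coassociativity
      -- and `comul_antipode`.
      refine Submodule.span_induction
        (p := fun a _ => mapRight (IsUCP.of_starAlgHom α) (α a) = comulExt (α a)) ?_ ?_ ?_ ?_ ha
      · rintro _ ⟨x, b, rfl⟩
        obtain ⟨n, x₁, x₂, hx⟩ := exists_comul_eq_sum x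
        choose k p q hpq using fun i => exists_comul_eq_sum (x₁ i)
        choose l c d hcd using fun i => exists_comul_eq_sum (x₂ i)
        let T : H →ₗ[ℂ] H →ₗ[ℂ] H →ₗ[ℂ] H ⊗[ℂ] MinTensor H A :=
          LinearMap.mk₂ ℂ (fun p q => (TensorProduct.mk ℂ H (MinTensor H A)).flip
            (ofAlg (antipode ℂ q ⊗ₜ[ℂ] minSliceₗ (α b) p)) ∘ₗ antipode ℂ)
            (by intros; ext; simp [TensorProduct.tmul_add]) (by intros; ext; simp)
            (by intros; ext; simp [TensorProduct.add_tmul])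
            (by intros; ext; simp [← TensorProduct.smul_tmul'])
        have h1 := sum_coassoc (trilift T) hx hpq hcd
        simp only [trilift_tmul, T, LinearMap.mk₂_apply, LinearMap.comp_apply,
          LinearMap.flip_apply, TensorProduct.mk_apply, minSliceₗ_apply] at h1
        rw [h b x n x₁ x₂ hx, mapRight_ofAlg, comulExt_ofAlg]
        congr 1
        simp only [map_sum, LinearMap.lTensor_tmul]
        have h2 : ∀ i, (α : A →ₗ[ℂ] MinTensor H A) (minSlice (x₁ i) (α b)) =
            ofAlg (∑ j, antipode ℂ (q i j) ⊗ₜ[ℂ] minSlice (p i j) (α b)) :=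
          fun i => h b _ _ _ _ (hpq i)
        simp only [h2, map_sum, TensorProduct.tmul_sum, comulAlg_tmul _ (comul_antipode (hcd _))]
        exact h1
      · simp
      · intro x y _ _ hx hy
        rw [map_add, map_add, map_add, hx, hy]
      · intro r x _ hx
        rw [map_smul, map_smul, map_smul, hx]
  podles := by
    set K := Submodule.span ℂ
      {t : MinTensor H A | ∃ (x : H) (a : A), t = ofAlg (x ⊗ₜ[ℂ] (1 : A)) * α a}
    have h1 : ∀ (c : H) (a : A), (ofAlg (c ⊗ₜ[ℂ] a) : MinTensor H A) ∈ K.topologicalClosure := by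
      intro c a
      refine closure_minimal (t := {a : A | (ofAlg (c ⊗ₜ[ℂ] a) : MinTensor H A) ∈
        K.topologicalClosure}) (fun a ha => ?_)
        (K.isClosed_topologicalClosure.preimage (continuous_ofAlg_tmul H c)) (hd a)
      refine Submodule.span_induction
        (p := fun a _ => (ofAlg (c ⊗ₜ[ℂ] a) : MinTensor H A) ∈ K.topologicalClosure) ?_ ?_ ?_ ?_ ha
      · rintro _ ⟨x, b, rfl⟩
        obtain ⟨n, x₁, x₂, hx⟩ := exists_comul_eq_sum x
        choose k p q hpq using fun i => exists_comul_eq_sum (x₁ i)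
        choose l s d hcd using fun i => exists_comul_eq_sum (x₂ i)
        let T : H →ₗ[ℂ] H →ₗ[ℂ] H →ₗ[ℂ] H ⊗[ℂ] A :=
          LinearMap.mk₂ ℂ (fun p q => (TensorProduct.mk ℂ H A).flip (minSliceₗ (α b) p) ∘ₗ
            LinearMap.mulRight ℂ (antipode ℂ q) ∘ₗ LinearMap.mulLeft ℂ c ∘ₗ antipode ℂ ∘ₗ
            antipode ℂ)
            (by intros; ext; simp) (by intros; ext; simp)
            (by intros; ext; simp [mul_add])
            (by intros; ext; simp)
        have h1 := sum_coassoc (trilift T) hx hpq hcd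
        simp only [trilift_tmul, T, LinearMap.mk₂_apply, LinearMap.comp_apply,
          LinearMap.flip_apply, TensorProduct.mk_apply, minSliceₗ_apply, LinearMap.mulRight_apply,
          LinearMap.mulLeft_apply] at h1
        -- To recover c ⊗ a for a slice a, multiply α of the slice at x₍₁₎ by cS²(x₍₂₎) ⊗ 1: the
        -- first legs combine to cS²(x₍₃₎)S(x₍₂₎) = cS(x₍₂₎S(x₍₃₎)), which collapses by the counit.
        have h2 : ∀ i, ∑ j, (c * antipode ℂ (antipode ℂ (d i j)) * antipode ℂ (s i j)) =
            counit (R := ℂ) (x₂ i) • c := by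
          intro i
          simp only [mul_assoc, ← antipode_mul_antidistrib]
          rw [← Finset.mul_sum, ← map_sum, sum_mul_antipode (hcd i)]
          simp
        simp only [← TensorProduct.sum_tmul, h2, TensorProduct.smul_tmul] at h1
        rw [← TensorProduct.tmul_sum] at h1
        have h3 : ∑ i, counit (R := ℂ) (x₂ i) • minSlice (x₁ i) (α b) = minSlice x (α b) := by
          have := congrArg (minSliceₗ (α b)) (sum_counit_smul_left hx)
          rw [map_sum] at this
          simpa using this
        rw [h3] at h1
        rw [← h1]
        refine K.le_topologicalClosure ?_
        rw [map_sum]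
        refine Submodule.sum_mem _ fun i _ => Submodule.subset_span
          ⟨c * antipode ℂ (antipode ℂ (x₂ i)), minSlice (x₁ i) (α b), ?_⟩
        rw [h b _ _ _ _ (hpq i), ← map_mul, Finset.mul_sum]
        simp
      · simp
      · intro x y _ _ hx hy
        rw [TensorProduct.tmul_add, map_add]; exact add_mem hx hy
      · intro r x _ hx
        rw [TensorProduct.tmul_smul, map_smul]; exact Submodule.smul_mem _ _ hx
    intro w
    refine closure_minimal (t := (K.topologicalClosure : Set (MinTensor H A))) ?_
      K.isClosed_topologicalClosure (denseRange_ofAlg w)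
    rintro _ ⟨z, rfl⟩
    induction z using TensorProduct.induction_on with
    | zero => rw [map_zero]; exact zero_mem _
    | add x y hx hy => rw [map_add]; exact add_mem hx hy
    | tmul c a => exact h1 c a

/-- The average of a state over the action is an invariant state. -/
lemma IsAction.exists_invariant_state (hα : IsAction α) {s : A →ₗ[ℂ] ℂ} (hs : IsState s) :
    ∃ θ : A →ₗ[ℂ] ℂ, IsState θ ∧ (∀ b x, θ (minSlice x (α b)) = haar H x * θ b) ∧
      ∀ b, θ b = s (minSlice (1 : H) (α b)) := by
  refine ⟨s ∘ₗ (minSlice (1 : H)).toLinearMap ∘ₗ (α : A →ₗ[ℂ] MinTensor H A), ⟨?_, fun b => ?_⟩,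
    fun b x => ?_, fun b => rfl⟩
  · have : α 1 = ofAlg ((1 : H) ⊗ₜ[ℂ] (1 : A)) := by
      rw [map_one, ← Algebra.TensorProduct.one_def, map_one]
    change s (minSlice (1 : H) (α 1)) = 1
    rw [this, minSlice_ofAlg, mul_one, (haar_spec H).map_one, one_smul, hs.map_one]
  · apply hs.map_nonneg
    change 0 ≤ minSlice (1 : H) (α (star b * b))
    rw [map_mul, StarHomClass.map_star]
    refine nonneg_of_nonneg_ofAlg _ (fun w => ?_) _
    rw [minSlice_ofAlg_eq]
    have := modInner_self_nonneg w
    simpa [modInner, LinearMap.mulRight_one] using this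
  · obtain ⟨n, x₁, x₂, hx⟩ := exists_comul_eq_sum x
    change s (minSlice (1 : H) (α (minSlice x (α b)))) = haar H x * s (minSlice (1 : H) (α b))
    have h1 := congrArg (minSliceₗ (α b)) (sum_haar_smul_left hx)
    rw [hα.apply_minSlice b hx]
    simp only [map_sum, minSlice_ofAlg, mul_one, haar_antipode]
    simp only [map_sum, map_smul, minSliceₗ_apply] at h1
    have h2 := congrArg s h1
    simpa using h2

end ActionFacts
end
end QG

namespace QG
noncomputable section
open scoped TensorProduct ComplexOrder CStarAlgebra
open Coalgebra HopfAlgebra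

/-! ### The Hilbert space L²(G) and the operators on it that have a symbol -/

section L2
variable (H : Type u) [Ring H] [StarRing H] [HopfAlgebra ℂ H] [StarModule ℂ H]
  [CompactQuantumGroup H]

/-- `ℂ[G]` with the inner product `h(x* y)`. -/
def PreL2 := H

instance : NormedAddCommGroup (PreL2 H) := (innerCore (H := H)).toNormedAddCommGroup

instance : InnerProductSpace ℂ (PreL2 H) := InnerProductSpace.ofCore (innerCore (H := H)).toCore

/-- The Hilbert space `L²(G)`. -/
def L2 := UniformSpace.Completion (PreL2 H)

instance : NormedAddCommGroup (L2 H) :=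
  inferInstanceAs (NormedAddCommGroup (UniformSpace.Completion (PreL2 H)))

instance : InnerProductSpace ℂ (L2 H) :=
  inferInstanceAs (InnerProductSpace ℂ (UniformSpace.Completion (PreL2 H)))

instance : CompleteSpace (L2 H) :=
  inferInstanceAs (CompleteSpace (UniformSpace.Completion (PreL2 H)))

variable {H}

/-- The inclusion `ℂ[G] → L²(G)`. -/
def toL2 : H →ₗ[ℂ] L2 H where
  toFun x := ((show PreL2 H from x : PreL2 H) : UniformSpace.Completion (PreL2 H))
  map_add' x y := UniformSpace.Completion.coe_add (α := PreL2 H) x y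
  map_smul' r x := UniformSpace.Completion.coe_smul (X := PreL2 H) r x

lemma inner_toL2 (x y : H) : inner ℂ (toL2 x) (toL2 y) = haar H (star x * y) :=
  UniformSpace.Completion.inner_coe (E := PreL2 H) x y

lemma denseRange_toL2 : DenseRange (toL2 : H → L2 H) :=
  UniformSpace.Completion.denseRange_coe (α := PreL2 H)

lemma norm_toL2_sq (x : H) : ‖toL2 x‖ ^ 2 = (haar H (star x * x)).re := by
  rw [← inner_toL2, inner_self_eq_norm_sq_to_K]
  norm_cast

lemma haar_star_mul_self (x : H) : haar H (star x * x) = ((‖toL2 x‖ ^ 2 : ℝ) : ℂ) := by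
  rw [← inner_toL2, inner_self_eq_norm_sq_to_K]
  norm_cast

lemma toL2_injective : Function.Injective (toL2 : H → L2 H) :=
  UniformSpace.Completion.coe_injective (PreL2 H)

lemma exists_clm_toL2 (g : H →ₗ[ℂ] H) {C : ℝ} (hC : 0 ≤ C)
    (h : ∀ x, ‖toL2 (g x)‖ ≤ C * ‖toL2 x‖) :
    ∃ T : L2 H →L[ℂ] L2 H, (∀ x, T (toL2 x) = toL2 (g x)) ∧ ‖T‖ ≤ C := by
  let g' : PreL2 H →L[ℂ] L2 H := LinearMap.mkContinuous (toL2 ∘ₗ g : PreL2 H →ₗ[ℂ] L2 H) C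
    (fun z => (h z).trans_eq (congrArg (C * ·) (UniformSpace.Completion.norm_coe (E := PreL2 H) z)))
  let T := g'.extend (UniformSpace.Completion.toComplL (𝕜 := ℂ) (E := PreL2 H))
  have hT : ∀ x, T (toL2 x) = toL2 (g x) := fun x =>
    g'.extend_eq (e := UniformSpace.Completion.toComplL (𝕜 := ℂ) (E := PreL2 H))
    (UniformSpace.Completion.denseRange_coe)
    (UniformSpace.Completion.isUniformInducing_coe _) (show PreL2 H from x)
  refine ⟨T, hT, T.opNorm_le_bound hC fun v => ?_⟩
  refine denseRange_toL2.induction_on v ?_ fun x => by rw [hT]; exact h x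
  exact isClosed_le (by fun_prop) (by fun_prop)

lemma clm_L2_ext {T U : L2 H →L[ℂ] L2 H} (h : ∀ x, T (toL2 x) = U (toL2 x)) : T = U :=
  DFunLike.coe_injective (denseRange_toL2.equalizer T.continuous U.continuous (funext h))

lemma L2_ext_inner {v w : L2 H} (h : ∀ x, inner ℂ (toL2 x) v = inner ℂ (toL2 x) w) : v = w := by
  refine ext_inner_left ℂ fun u => ?_
  exact denseRange_toL2.induction_on u (isClosed_eq (by fun_prop) (by fun_prop)) h

/-- The operator `T` on `L²(G)` is given by `x ↦ x₍₁₎ f(x₍₂₎)`. -/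
def HasSymbol (T : L2 H →L[ℂ] L2 H) (f : H →ₗ[ℂ] ℂ) : Prop :=
  ∀ x, T (toL2 x) = toL2 (convRight f x)

/-- The symbol of the adjoint operator, `x ↦ f(S(x)*)` conjugated. -/
def symbolStar (f : H →ₗ[ℂ] ℂ) : H →ₗ[ℂ] ℂ where
  toFun x := star (f (star (antipode ℂ x)))
  map_add' x y := by simp
  map_smul' r x := by simp [star_smul]

@[simp] lemma symbolStar_apply (f : H →ₗ[ℂ] ℂ) (x : H) :
    symbolStar f x = star (f (star (antipode ℂ x))) := rfl

/-- This is strong invariance with f applied to the second leg; it shows that symbols are stable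
under adjoints. -/
lemma haar_mul_convRight (f : H →ₗ[ℂ] ℂ) (x y : H) :
    haar H (star (convRight (symbolStar f) x) * y) = haar H (star x * convRight f y) := by
  obtain ⟨n, x₁, x₂, hx⟩ := exists_comul_eq_sum x
  obtain ⟨m, y₁, y₂, hy⟩ := exists_comul_eq_sum y
  have h := congrArg f (haar_strong_invariance_left (comul_star_of_eq hx) hy)
  simp only [map_sum, map_smul, smul_eq_mul, antipodeInv_apply, star_star] at h
  rw [convRight_apply_of_eq hx, convRight_apply_of_eq hy]
  simp only [star_sum, star_smul, Finset.sum_mul, Finset.mul_sum, smul_mul_assoc, mul_smul_comm,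
    map_sum, map_smul, smul_eq_mul, symbolStar_apply, star_star]
  simp only [mul_comm (haar H _)] at h
  exact h.symm

namespace HasSymbol
variable {T U : L2 H →L[ℂ] L2 H} {f g : H →ₗ[ℂ] ℂ}

lemma eq_symbol (hf : HasSymbol T f) (hg : HasSymbol T g) : f = g := by
  apply convRight_injective
  ext x
  exact toL2_injective ((hf x).symm.trans (hg x))

lemma eq_operator (hT : HasSymbol T f) (hU : HasSymbol U f) : T = U :=
  clm_L2_ext fun x => (hT x).trans (hU x).symm

lemma one : HasSymbol (1 : L2 H →L[ℂ] L2 H) counit := fun x => by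
  rw [convRight_counit]; rfl

lemma mul (hT : HasSymbol T f) (hU : HasSymbol U g) : HasSymbol (T * U) (f ∘ₗ convRight g) := by
  intro x
  rw [← convRight_comp, LinearMap.comp_apply, ← hT, ← hU]
  rfl

lemma add (hT : HasSymbol T f) (hU : HasSymbol U g) : HasSymbol (T + U) (f + g) := by
  intro x
  obtain ⟨n, x₁, x₂, hx⟩ := exists_comul_eq_sum x
  have h1 := hT x
  have h2 := hU x
  rw [convRight_apply_of_eq hx] at h1 h2 ⊢
  simp [h1, h2, add_smul, Finset.sum_add_distrib]

lemma smul (r : ℂ) (hT : HasSymbol T f) : HasSymbol (r • T) (r • f) := by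
  intro x
  obtain ⟨n, x₁, x₂, hx⟩ := exists_comul_eq_sum x
  have h1 := hT x
  rw [convRight_apply_of_eq hx] at h1 ⊢
  simp [h1, Finset.smul_sum, mul_smul]

lemma star (hT : HasSymbol T f) : HasSymbol (star T) (symbolStar f) := by
  intro x
  refine L2_ext_inner fun y => ?_
  rw [ContinuousLinearMap.star_eq_adjoint, ContinuousLinearMap.adjoint_inner_right, hT,
    inner_toL2, inner_toL2]
  have h := congrArg Star.star (haar_mul_convRight f x y)
  rw [← haar_star, ← haar_star] at h
  simpa using h.symm

end HasSymbol

/-- A continuous functional that recovers the value at `x` of the symbol of an operator. -/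
lemma exists_symbol_functional (x : H) : ∃ F : (L2 H →L[ℂ] L2 H) →L[ℂ] ℂ,
    ∀ T f, HasSymbol T f → F T = f x := by
  obtain ⟨n, e, y, he, hx⟩ := exists_orthonormal_expansion (comul (R := ℂ) x)
  -- With Δ(x) = ∑ eᵢ ⊗ yᵢ and orthonormal eᵢ, pairing T x with eᵢ gives f(yᵢ), and ∑ ε(eᵢ)f(yᵢ) =
  -- f(x).
  refine ⟨∑ i, counit (R := ℂ) (e i) • (innerSL ℂ (toL2 (e i))).comp
    (ContinuousLinearMap.apply ℂ (L2 H) (toL2 x)), fun T f hf => ?_⟩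
  have h1 := congrArg f (sum_counit_smul_right hx)
  simp only [map_sum, map_smul, smul_eq_mul] at h1
  have h2 : ∀ i, inner ℂ (toL2 (e i)) (T (toL2 x)) = f (y i) := by
    intro i
    rw [hf, inner_toL2, convRight_apply_of_eq hx]
    simp [Finset.mul_sum, he]
  simp [h2, h1]

/-- A functional that recovers the value at `x` of the symbol of an operator. -/
def symbolAt (x : H) : (L2 H →L[ℂ] L2 H) →L[ℂ] ℂ := (exists_symbol_functional x).choose

lemma HasSymbol.symbolAt_eq {T : L2 H →L[ℂ] L2 H} {f : H →ₗ[ℂ] ℂ} (h : HasSymbol T f) (x : H) :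
    symbolAt x T = f x := (exists_symbol_functional x).choose_spec T f h

/-- Through the functionals `symbolAt x`, having a symbol becomes a family of closed conditions:
additivity and homogeneity in x, and the formula for T on ℂ[G]. This makes `LInf H` a C*-algebra. -/
lemma isClosed_setOf_hasSymbol : IsClosed {T : L2 H →L[ℂ] L2 H | ∃ f, HasSymbol T f} := by
  choose n a b hx using fun x : H => exists_comul_eq_sum x
  have : {T : L2 H →L[ℂ] L2 H | ∃ f, HasSymbol T f} =
      {T | ∀ x y, symbolAt (x + y) T = symbolAt x T + symbolAt y T} ∩
      ({T | ∀ (r : ℂ) x, symbolAt (r • x) T = r • symbolAt x T} ∩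
      {T | ∀ x, T (toL2 x) = ∑ i, symbolAt (b x i) T • toL2 (a x i)}) := by
    ext T
    constructor
    · rintro ⟨f, hf⟩
      refine ⟨fun x y => ?_, fun r x => ?_, fun x => ?_⟩
      · simp [hf.symbolAt_eq]
      · simp [hf.symbolAt_eq]
      · simp [hf.symbolAt_eq, hf x, convRight_apply_of_eq (hx x)]
    · rintro ⟨h1, h2, h3⟩
      refine ⟨⟨⟨fun x => symbolAt x T, h1⟩, h2⟩, fun x => ?_⟩
      rw [h3, convRight_apply_of_eq (hx x)]
      simp
  rw [this]
  refine IsClosed.inter ?_ (IsClosed.inter ?_ ?_)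
  · simp only [Set.ofPred_forall]
    exact isClosed_iInter fun x => isClosed_iInter fun y => isClosed_eq (by fun_prop) (by fun_prop)
  · simp only [Set.ofPred_forall]
    exact isClosed_iInter fun x => isClosed_iInter fun y => isClosed_eq (by fun_prop) (by fun_prop)
  · simp only [Set.ofPred_forall]
    exact isClosed_iInter fun x => isClosed_eq (by fun_prop) (by fun_prop)

instance : CStarAlgebra (L2 H →L[ℂ] L2 H) where

variable (H) in
/-- The operators on `L²(G)` that have a symbol, that is, the von Neumann algebra of the dual
discrete quantum group. -/
def symbolAlgebra : StarSubalgebra ℂ (L2 H →L[ℂ] L2 H) where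
  carrier := {T | ∃ f, HasSymbol T f}
  mul_mem' := fun ⟨_, hf⟩ ⟨_, hg⟩ => ⟨_, hf.mul hg⟩
  one_mem' := ⟨_, HasSymbol.one⟩
  add_mem' := fun ⟨_, hf⟩ ⟨_, hg⟩ => ⟨_, hf.add hg⟩
  zero_mem' := ⟨0, fun x => by
    obtain ⟨n, x₁, x₂, hx⟩ := exists_comul_eq_sum x
    simp [convRight_apply_of_eq hx]⟩
  algebraMap_mem' r := ⟨r • counit, by
    rw [Algebra.algebraMap_eq_smul_one]; exact HasSymbol.one.smul r⟩
  star_mem' := fun ⟨_, hf⟩ => ⟨_, hf.star⟩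

variable (H) in
/-- The von Neumann algebra `ℓ^∞` of the dual discrete quantum group. -/
def LInf : Type u := symbolAlgebra H

instance : IsClosed (symbolAlgebra H : Set (L2 H →L[ℂ] L2 H)) := isClosed_setOf_hasSymbol

instance instCStarAlgebraLInf : CStarAlgebra (LInf H) :=
  inferInstanceAs (CStarAlgebra (symbolAlgebra H))

/-- The operator on `L²(G)` defined by an element of `LInf H`. -/
def LInf.val : LInf H →⋆ₐ[ℂ] (L2 H →L[ℂ] L2 H) := (symbolAlgebra H).subtype

lemma LInf.val_injective : Function.Injective (LInf.val (H := H)) := Subtype.val_injective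

lemma LInf.norm_val (T : LInf H) : ‖LInf.val T‖ = ‖T‖ := rfl

lemma LInf.continuous_val : Continuous (LInf.val (H := H)) := continuous_subtype_val

lemma LInf.exists_hasSymbol (T : LInf H) : ∃ f, HasSymbol (LInf.val T) f := T.2

lemma LInf.exists_val_eq {T : L2 H →L[ℂ] L2 H} {f : H →ₗ[ℂ] ℂ} (h : HasSymbol T f) :
    ∃ U : LInf H, LInf.val U = T := ⟨⟨T, f, h⟩, rfl⟩

end L2
end
end QG

namespace QG
noncomputable section
open scoped TensorProduct ComplexOrder CStarAlgebra
open Coalgebra HopfAlgebra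

/-! ### Algebraic identities for the coaction on symbols -/

section SymbolCalculus
variable {H : Type u} [Ring H] [HopfAlgebra ℂ H]

lemma scalar_comp_convRight (R : Type*) [Ring R] [Algebra ℂ R] (f g : H →ₗ[ℂ] ℂ) :
    scalar R (f ∘ₗ convRight g) = conv (scalar R f) (scalar R g) := by
  rw [conv_scalar]; rfl

lemma conv_conv_apply_of_eq {R : Type*} [Ring R] [Algebra ℂ R] {ι : Type*} [Fintype ι] {x : H}
    {x₁ x₂ x₃ : ι → H} (h : (comul (R := ℂ)).lTensor H (comul (R := ℂ) x) =
      ∑ i, x₁ i ⊗ₜ[ℂ] (x₂ i ⊗ₜ[ℂ] x₃ i)) (f g k : H →ₗ[ℂ] R) :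
    conv f (conv g k) x = ∑ i, f (x₁ i) * (g (x₂ i) * k (x₃ i)) := by
  let T : H ⊗[ℂ] (H ⊗[ℂ] H) →ₗ[ℂ] R := LinearMap.mul' ℂ R ∘ₗ
    TensorProduct.map f (LinearMap.mul' ℂ R ∘ₗ TensorProduct.map g k)
  have h1 : conv f (conv g k) x = T ((comul (R := ℂ)).lTensor H (comul (R := ℂ) x)) := by
    obtain ⟨n, a, b, hx⟩ := exists_comul_eq_sum x
    rw [conv_apply_of_eq hx, hx]
    simp [T, conv_apply]
  rw [h1, h]
  simp [T]

lemma convRight_add (f g : H →ₗ[ℂ] ℂ) (x : H) :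
    convRight (f + g) x = convRight f x + convRight g x := by
  obtain ⟨n, a, b, hx⟩ := exists_comul_eq_sum x
  simp [convRight_apply_of_eq hx, add_smul, Finset.sum_add_distrib]

lemma convRight_smul (r : ℂ) (f : H →ₗ[ℂ] ℂ) (x : H) :
    convRight (r • f) x = r • convRight f x := by
  obtain ⟨n, a, b, hx⟩ := exists_comul_eq_sum x
  simp [convRight_apply_of_eq hx, mul_smul, Finset.smul_sum]

lemma convRight_zero (x : H) : convRight (0 : H →ₗ[ℂ] ℂ) x = 0 := by
  obtain ⟨n, a, b, hx⟩ := exists_comul_eq_sum x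
  simp [convRight_apply_of_eq hx]

/-- The coaction on symbols, `x ↦ S(x₍₁₎) f(x₍₂₎) x₍₃₎`. -/
def coact (f : H →ₗ[ℂ] ℂ) : H →ₗ[ℂ] H :=
  conv (antipode ℂ) (conv (scalar H f) LinearMap.id)

lemma coact_eq (f : H →ₗ[ℂ] ℂ) :
    coact f = conv (conv (antipode ℂ) (scalar H f)) LinearMap.id := (conv_assoc _ _ _).symm

/-- The value of `coact f` at v depends on finitely many values of f at points chosen independently
of f. Linearity and continuity in f follow. -/
lemma exists_coact_eq_sum (v : H) : ∃ (n : ℕ) (p q : Fin n → H),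
    ∀ f : H →ₗ[ℂ] ℂ, coact f v = ∑ i, f (p i) • q i := by
  obtain ⟨n, a, b, h⟩ := exists_comul_eq_sum v
  choose k c d hcd using fun i => exists_comul_eq_sum (b i)
  refine ⟨_, fun i => c (finSigmaFinEquiv.symm i).1 (finSigmaFinEquiv.symm i).2,
    fun i => antipode ℂ (a (finSigmaFinEquiv.symm i).1) *
      d (finSigmaFinEquiv.symm i).1 (finSigmaFinEquiv.symm i).2, fun f => ?_⟩
  rw [finSigmaFinEquiv.symm.sum_comp (fun j : (i : Fin n) × Fin (k i) =>
    f (c j.1 j.2) • (antipode ℂ (a j.1) * d j.1 j.2)), Fintype.sum_sigma, coact,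
    conv_apply_of_eq h]
  refine Finset.sum_congr rfl fun i _ => ?_
  rw [conv_apply_of_eq (hcd i), Finset.mul_sum]
  simp

lemma coact_counit : coact (counit (R := ℂ) (A := H)) = scalar H counit := by
  rw [coact, counit_conv, antipode_conv_id]

/-- In S(x₍₁₎)f(x₍₂₎)x₍₃₎S(x₍₄₎)g(x₍₅₎)x₍₆₎ the middle product x₍₃₎S(x₍₄₎) cancels. This is
multiplicativity of the coaction. -/
lemma coact_comp_convRight (f g : H →ₗ[ℂ] ℂ) :
    coact (f ∘ₗ convRight g) = conv (coact f) (coact g) := by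
  have h : conv LinearMap.id (coact g) = conv (scalar H g) LinearMap.id := by
    rw [coact, ← conv_assoc, id_conv_antipode, counit_conv]
  rw [coact_eq f, conv_assoc, h, coact, scalar_comp_convRight]
  simp only [conv_assoc]

lemma counit_coact (f : H →ₗ[ℂ] ℂ) (x : H) : counit (R := ℂ) (coact f x) = f x := by
  obtain ⟨n, a, b, h⟩ := exists_comul_eq_sum x
  choose k c d hcd using fun i => exists_comul_eq_sum (b i)
  have h1 : ∀ i, ∑ j, counit (R := ℂ) (d i j) • c i j = b i := fun i => sum_counit_smul_left (hcd i)
  have h2 := sum_counit_smul_right h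
  rw [coact, conv_apply_of_eq h]
  simp only [conv_apply_of_eq (hcd _), scalar_apply, LinearMap.id_apply, smul_mul_assoc, one_mul,
    map_sum, map_smul, Bialgebra.counit_mul, counit_antipode, smul_eq_mul]
  conv_rhs => rw [← h2, map_sum]
  refine Finset.sum_congr rfl fun i _ => ?_
  rw [map_smul, smul_eq_mul]
  conv_rhs => rw [← h1 i]
  simp [mul_comm]

/-- Apply Δ to S(x₍₁₎)f(x₍₂₎)x₍₃₎: the inner factors reassemble to `coact f` in the first leg, with
an antipode and a factor left over in the second. It is coassociativity of the coaction at the level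
of symbols. -/
lemma comul_coact (f : H →ₗ[ℂ] ℂ) : comul (R := ℂ) ∘ₗ coact f =
    conv ((Algebra.TensorProduct.includeRight (R := ℂ) (A := H) (B := H)).toLinearMap ∘ₗ
      antipode ℂ)
    (conv ((Algebra.TensorProduct.includeLeft (R := ℂ) (S := ℂ) (A := H) (B := H)).toLinearMap ∘ₗ
      coact f) (Algebra.TensorProduct.includeRight (R := ℂ) (A := H) (B := H)).toLinearMap) := by
  set i₁ := Algebra.TensorProduct.includeLeft (R := ℂ) (S := ℂ) (A := H) (B := H)
  set i₂ := Algebra.TensorProduct.includeRight (R := ℂ) (A := H) (B := H)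
  have h1 : comul (R := ℂ) ∘ₗ antipode ℂ (A := H) =
      conv (i₂.toLinearMap ∘ₗ antipode ℂ) (i₁.toLinearMap ∘ₗ antipode ℂ) := by
    ext x
    obtain ⟨n, a, b, h⟩ := exists_comul_eq_sum x
    rw [LinearMap.comp_apply, comul_antipode h, conv_apply_of_eq h]
    simp [i₁, i₂]
  have h2 := algHom_comp_conv (Bialgebra.comulAlgHom ℂ H) (antipode ℂ)
    (conv (scalar H f) LinearMap.id)
  rw [algHom_comp_conv _ (scalar H f), algHom_comp_scalar] at h2
  have h3 : i₁.toLinearMap ∘ₗ coact f = conv (i₁.toLinearMap ∘ₗ antipode ℂ)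
      (conv (scalar _ f) i₁.toLinearMap) := by
    rw [coact, algHom_comp_conv, algHom_comp_conv, algHom_comp_scalar]; rfl
  refine h2.trans ?_
  have h4 : (Bialgebra.comulAlgHom ℂ H).toLinearMap = comul (R := ℂ) := rfl
  rw [h4, LinearMap.comp_id, h1, h3, comul_eq_conv]
  simp only [conv_assoc]
  rfl

/-- The Yetter–Drinfeld identity on symbols. -/
lemma coact_comp_mulRight (f : H →ₗ[ℂ] ℂ) {y : H} {ι : Type*} [Fintype ι] {y₁ y₂ y₃ : ι → H}
    (hy : (comul (R := ℂ)).lTensor H (comul (R := ℂ) y) = ∑ i, y₁ i ⊗ₜ[ℂ] (y₂ i ⊗ₜ[ℂ] y₃ i))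
    (v : H) : coact (f ∘ₗ LinearMap.mulRight ℂ y) v =
      ∑ i, y₁ i * (coact f (v * y₂ i) * antipode ℂ (y₃ i)) := by
  obtain ⟨n, a, b, hv⟩ := exists_comul_eq_sum v
  choose k c d hcd using fun i => exists_comul_eq_sum (b i)
  -- L is the left side as a function of y. By antimultiplicativity of S, the map y ↦ coact f (vy)
  -- is S * L * id for convolution; convolving with id on the left and S on the right isolates L.
  let L : H →ₗ[ℂ] H := ∑ i, ∑ j, LinearMap.mulRight ℂ (d i j) ∘ₗ
    LinearMap.mulLeft ℂ (antipode ℂ (a i)) ∘ₗ scalar H (f ∘ₗ LinearMap.mulLeft ℂ (c i j))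
  have hL : ∀ y, coact (f ∘ₗ LinearMap.mulRight ℂ y) v = L y := by
    intro y
    rw [coact, conv_apply_of_eq hv]
    simp [L, conv_apply_of_eq (hcd _), Finset.mul_sum]
  have hE : coact f ∘ₗ LinearMap.mulLeft ℂ v = conv (antipode ℂ) (conv L LinearMap.id) := by
    ext y
    obtain ⟨m, p, q, hy⟩ := exists_comul_eq_sum y
    choose l s t hst using fun i => exists_comul_eq_sum (q i)
    have h1 : comul (R := ℂ) (v * y) = ∑ r : Fin n × Fin m, (a r.1 * p r.2) ⊗ₜ[ℂ] (b r.1 * q r.2) := by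
      rw [Bialgebra.comul_mul, hv, hy, Finset.sum_mul_sum, Fintype.sum_prod_type]
      simp
    have h2 : ∀ r : Fin n × Fin m, comul (R := ℂ) (b r.1 * q r.2) =
        ∑ w : Fin (k r.1) × Fin (l r.2), (c r.1 w.1 * s r.2 w.2) ⊗ₜ[ℂ] (d r.1 w.1 * t r.2 w.2) := by
      intro r
      rw [Bialgebra.comul_mul, hcd, hst, Finset.sum_mul_sum, Fintype.sum_prod_type]
      simp
    rw [LinearMap.comp_apply, LinearMap.mulLeft_apply, coact, conv_apply_of_eq h1,
      conv_apply_of_eq hy]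
    simp only [conv_apply_of_eq (h2 _), conv_apply_of_eq (hst _), Fintype.sum_prod_type]
    rw [Finset.sum_comm]
    refine Finset.sum_congr rfl fun i _ => ?_
    have hL' : ∀ s, L s = ∑ i, ∑ j, f (c i j * s) • (antipode ℂ (a i) * d i j) := by
      intro s; simp [L]
    simp only [hL', scalar_apply, LinearMap.id_apply, antipode_mul_antidistrib, Finset.mul_sum,
      Finset.sum_mul]
    rw [Finset.sum_comm (s := Finset.univ (α := Fin (l i)))]
    refine Finset.sum_congr rfl fun r _ => ?_
    rw [Finset.sum_comm]
    simp [mul_assoc]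
  have h3 := LinearMap.congr_fun (show conv LinearMap.id (conv (coact f ∘ₗ LinearMap.mulLeft ℂ v)
      (antipode ℂ)) = L by
    rw [hE, conv_assoc, conv_assoc, id_conv_antipode, conv_counit, ← conv_assoc, id_conv_antipode,
      counit_conv]) y
  rw [hL, ← h3, conv_conv_apply_of_eq hy]
  simp

end SymbolCalculus

/-! ### The C*-algebra ℓ^∞(Ĝ) and the action of ℂ[G] on it -/

section LInf
attribute [local instance] CStarAlgebra.spectralOrder CStarAlgebra.spectralOrderedRing
attribute [local irreducible] instCStarAlgebraLInf
variable {H : Type u} [Ring H] [StarRing H] [HopfAlgebra ℂ H] [StarModule ℂ H]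
  [CompactQuantumGroup H]

lemma coact_symbolStar (f : H →ₗ[ℂ] ℂ) (x : H) :
    coact (symbolStar f) x = star (coact f (star (antipode ℂ x))) := by
  obtain ⟨n, a, b, hx⟩ := exists_comul_eq_sum x
  choose k c d hcd using fun i => exists_comul_eq_sum (a i)
  rw [coact_eq, conv_apply_of_eq hx, coact, conv_apply_of_eq (comul_star_of_eq (comul_antipode hx))]
  simp only [conv_apply_of_eq (hcd _), conv_apply_of_eq (comul_star_of_eq (comul_antipode (hcd _))),
    star_sum, antipode_star_antipode]
  simp [star_smul, star_sum, Finset.sum_mul, Finset.mul_sum]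

/-- Since h need not be a trace, boundedness of right multiplication needs an argument: in
`exists_right_expansion` the squares ‖x wᵢ‖² add up to ‖y‖²‖x‖², so each wᵢ acts boundedly, and y is
a combination of them. -/
lemma exists_norm_mul_right_le (y : H) : ∃ C : ℝ, 0 ≤ C ∧ ∀ x, ‖toL2 (x * y)‖ ≤ C * ‖toL2 x‖ := by
  obtain ⟨n, c, w, hy, hw⟩ := exists_right_expansion y
  refine ⟨∑ i, ‖c i‖ * ‖toL2 y‖, by positivity, fun x => ?_⟩
  have h1 : ∀ i, ‖toL2 (x * w i)‖ ≤ ‖toL2 y‖ * ‖toL2 x‖ := by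
    intro i
    refine abs_le_of_sq_le_sq' ?_ (by positivity) |>.2
    have h2 := congrArg Complex.re (hw (star x * x))
    rw [haar_star_mul_self y, haar_star_mul_self x, ← Complex.ofReal_mul, Complex.ofReal_re,
      Complex.re_sum] at h2
    have h3 : ∀ i, (haar H (star (w i) * (star x * x) * w i)).re = ‖toL2 (x * w i)‖ ^ 2 := by
      intro i
      rw [norm_toL2_sq, star_mul]; simp only [mul_assoc]
    rw [mul_pow, ← h2, ← h3]
    exact Finset.single_le_sum (f := fun i => (haar H (star (w i) * (star x * x) * w i)).re)
      (fun i _ => by rw [h3]; positivity) (Finset.mem_univ i)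
  conv_lhs => rw [hy]
  rw [Finset.mul_sum, map_sum, Finset.sum_mul]
  refine (norm_sum_le _ _).trans (Finset.sum_le_sum fun i _ => ?_)
  rw [mul_smul_comm, map_smul, norm_smul, mul_assoc]
  exact mul_le_mul_of_nonneg_left (h1 i) (norm_nonneg _)

namespace LInf

/-- The symbol of an element of `LInf H`. -/
def sym : LInf H →ₗ[ℂ] H →ₗ[ℂ] ℂ where
  toFun T := (exists_hasSymbol T).choose
  map_add' T U := (exists_hasSymbol (T + U)).choose_spec.eq_symbol (by
    rw [map_add]; exact (exists_hasSymbol T).choose_spec.add (exists_hasSymbol U).choose_spec)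
  map_smul' r T := (exists_hasSymbol (r • T)).choose_spec.eq_symbol (by
    rw [map_smul]; exact (exists_hasSymbol T).choose_spec.smul r)

lemma hasSymbol_sym (T : LInf H) : HasSymbol (val T) (sym T) := (exists_hasSymbol T).choose_spec

lemma sym_injective : Function.Injective (sym (H := H)) := fun T U h =>
  val_injective ((hasSymbol_sym T).eq_operator (h ▸ hasSymbol_sym U))

lemma sym_one : sym (1 : LInf H) = counit :=
  (hasSymbol_sym 1).eq_symbol (by rw [map_one]; exact HasSymbol.one)

lemma sym_mul (T U : LInf H) : sym (T * U) = sym T ∘ₗ convRight (sym U) :=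
  (hasSymbol_sym _).eq_symbol (by
    rw [map_mul]; exact (hasSymbol_sym T).mul (hasSymbol_sym U))

lemma sym_star (T : LInf H) : sym (star T) = symbolStar (sym T) :=
  (hasSymbol_sym _).eq_symbol (by
    rw [StarHomClass.map_star]; exact (hasSymbol_sym T).star)

lemma continuous_sym (x : H) : Continuous fun T : LInf H => sym T x := by
  have : (fun T : LInf H => sym T x) = fun T => symbolAt x (val T) :=
    funext fun T => ((hasSymbol_sym T).symbolAt_eq x).symm
  rw [this]
  exact (symbolAt x).continuous.comp continuous_val

lemma norm_convRight_le (T : LInf H) (x : H) :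
    ‖toL2 (convRight (sym T) x)‖ ≤ ‖T‖ * ‖toL2 x‖ := by
  rw [← hasSymbol_sym T x, ← norm_val]
  exact (val T).le_opNorm _

lemma exists_sym_eq (f : H →ₗ[ℂ] ℂ) {C : ℝ} (hC : 0 ≤ C)
    (h : ∀ x, ‖toL2 (convRight f x)‖ ≤ C * ‖toL2 x‖) : ∃ T : LInf H, sym T = f ∧ ‖T‖ ≤ C := by
  obtain ⟨T, hT, hTC⟩ := exists_clm_toL2 (convRight f) hC h
  obtain ⟨U, rfl⟩ := exists_val_eq hT
  exact ⟨U, (hasSymbol_sym U).eq_symbol hT, by rw [← norm_val]; exact hTC⟩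

lemma haar_star_mul_convRight (T U : LInf H) (v w : H) :
    haar H (star v * convRight (sym (star T * U)) w) =
      haar H (star (convRight (sym T) v) * convRight (sym U) w) := by
  have h : sym T = symbolStar (sym (star T)) := by rw [← sym_star, star_star]
  rw [sym_mul, ← convRight_comp, LinearMap.comp_apply, h, haar_mul_convRight]

lemma isSelfAdjoint_of_real {X : LInf H}
    (h : ∀ v, star (haar H (star v * convRight (sym X) v)) = haar H (star v * convRight (sym X) v)) :
    IsSelfAdjoint X := by
  have h1 : IsSelfAdjoint (val X) := by
    rw [ContinuousLinearMap.isSelfAdjoint_iff_isSymmetric,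
      LinearMap.isSymmetric_iff_inner_map_self_real]
    intro v
    refine denseRange_toL2.induction_on v ?_ fun x => ?_
    · exact isClosed_eq (by simp only [ContinuousLinearMap.coe_coe]; fun_prop)
        (by simp only [ContinuousLinearMap.coe_coe]; fun_prop)
    · have h2 := h x
      rw [← inner_toL2, ← hasSymbol_sym X x] at h2
      rw [ContinuousLinearMap.coe_coe, inner_conj_symm, ← h2]
      exact inner_conj_symm (𝕜 := ℂ) _ _
  apply val_injective
  rw [StarHomClass.map_star]
  exact h1

lemma nonneg_of_eq_star_mul_self {E : Type*} [CStarAlgebra E] {e s : E} (h : e = star s * s) :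
    0 ≤ e := by
  rw [h]; exact star_mul_self_nonneg s

lemma complex_ofReal_eq {r : ℝ} (hr : 0 ≤ r) :
    (r : ℂ) = star ((√r : ℝ) : ℂ) * ((√r : ℝ) : ℂ) := by
  rw [Complex.star_def, Complex.conj_ofReal, ← Complex.ofReal_mul, Real.mul_self_sqrt hr]

/-- Positivity in a C*-subalgebra of `LInf H` can be tested on vectors in `ℂ[G]`. -/
lemma nonneg_of_haar {D : Type*} [CStarAlgebra D] (j : D →⋆ₐ[ℂ] LInf H)
    (hj : Function.Injective j) {X : D}
    (h : ∀ v, ∃ r : ℝ, 0 ≤ r ∧ haar H (star v * convRight (sym (j X)) v) = r) : 0 ≤ X := by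
  let F : H → D →ₗ[ℂ] ℂ := fun v =>
    { toFun := fun d => haar H (star v * convRight (sym (j d)) v)
      map_add' := fun d d' => by
        obtain ⟨n, x₁, x₂, hx⟩ := exists_comul_eq_sum v
        simp only [convRight_apply_of_eq hx, map_add, LinearMap.add_apply, add_smul,
          Finset.sum_add_distrib, mul_add]
      map_smul' := fun r d => by
        obtain ⟨n, x₁, x₂, hx⟩ := exists_comul_eq_sum v
        simp only [convRight_apply_of_eq hx, map_smul, LinearMap.smul_apply, smul_assoc,
          ← Finset.smul_sum, mul_smul_comm, RingHom.id_apply] }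
  have hF : ∀ v d, F v (star d * d) = ((‖toL2 (convRight (sym (j d)) v)‖ ^ 2 : ℝ) : ℂ) := by
    intro v d
    rw [← haar_star_mul_self, ← haar_star_mul_convRight, ← StarHomClass.map_star, ← map_mul]
    rfl
  refine nonneg_of_separating F (fun v c => ⟨convRight (sym (j c)) v, fun d => ?_⟩)
    (fun v d => ?_) (fun d hd => ?_) ?_ (fun v => ?_)
  · change haar H (star v * convRight (sym (j (star c * d * c))) v) =
      haar H (star (convRight (sym (j c)) v) * convRight (sym (j d)) (convRight (sym (j c)) v))
    rw [mul_assoc, map_mul j, StarHomClass.map_star j, haar_star_mul_convRight, map_mul j, sym_mul,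
      ← convRight_comp]
    rfl
  · rw [hF]
    exact nonneg_of_eq_star_mul_self (complex_ofReal_eq (sq_nonneg _))
  · apply hj
    rw [map_zero]
    apply sym_injective
    apply convRight_injective
    ext v
    have h1 := hd v
    rw [hF, Complex.ofReal_eq_zero, sq_eq_zero_iff, norm_eq_zero] at h1
    obtain ⟨n, x₁, x₂, hx⟩ := exists_comul_eq_sum v
    rw [toL2_injective (h1.trans (map_zero toL2).symm), convRight_apply_of_eq hx]
    simp
  · have h1 : IsSelfAdjoint (j X) := isSelfAdjoint_of_real fun v => by
      obtain ⟨r, -, hr⟩ := h v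
      rw [hr, Complex.star_def, Complex.conj_ofReal]
    apply hj
    rw [StarHomClass.map_star]
    exact h1
  · obtain ⟨r, hr0, hr⟩ := h v
    have h1 : F v X = r := hr
    rw [h1]
    exact nonneg_of_eq_star_mul_self (complex_ofReal_eq hr0)

/-- The factors y₍₂₎ and S⁻¹(y₍₁₎) cancel. Thus the operator with symbol f(· y) is a sum of products
of the operator of f with right multiplications, hence bounded. -/
lemma convRight_comp_mulRight (f : H →ₗ[ℂ] ℂ) (x : H) {y : H} {n : ℕ} {y₁ y₂ : Fin n → H}
    (hy : comul (R := ℂ) y = ∑ i, y₁ i ⊗ₜ[ℂ] y₂ i) :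
    convRight (f ∘ₗ LinearMap.mulRight ℂ y) x =
      ∑ i, convRight f (x * y₂ i) * antipodeInv H (y₁ i) := by
  obtain ⟨m, a, b, hx⟩ := exists_comul_eq_sum x
  choose k p q hpq using fun i => exists_comul_eq_sum (y₁ i)
  choose l s t hst using fun i => exists_comul_eq_sum (y₂ i)
  let T : H →ₗ[ℂ] H →ₗ[ℂ] H →ₗ[ℂ] H :=
    ∑ i, LinearMap.mk₂ ℂ (fun p q => (LinearMap.toSpanSingleton ℂ H
      (a i * q * antipodeInv H p)) ∘ₗ f ∘ₗ LinearMap.mulLeft ℂ (b i))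
      (by intros; ext; simp [mul_add]) (by intros; ext; simp [smul_smul, mul_comm])
      (by intros; ext; simp [mul_add, add_mul]) (by intros; ext; simp [smul_smul, mul_comm])
  have hT : ∀ p q r, T p q r = ∑ i, f (b i * r) • (a i * q * antipodeInv H p) := by
    intro p q r; simp [T]
  have h1 := sum_coassoc (trilift T) hy hpq hst
  simp only [trilift_tmul, hT] at h1
  have h2 : ∀ i, convRight f (x * y₂ i) * antipodeInv H (y₁ i) =
      ∑ j, ∑ r, f (b r * t i j) • (a r * s i j * antipodeInv H (y₁ i)) := by
    intro i
    have h3 : comul (R := ℂ) (x * y₂ i) =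
        ∑ r : Fin (l i) × Fin m, (a r.2 * s i r.1) ⊗ₜ[ℂ] (b r.2 * t i r.1) := by
      rw [Bialgebra.comul_mul, hx, hst, Finset.sum_mul_sum, Fintype.sum_prod_type, Finset.sum_comm]
      simp
    rw [convRight_apply_of_eq h3, Fintype.sum_prod_type]
    simp [Finset.sum_mul]
  simp only [h2]
  rw [← h1, convRight_apply_of_eq hx]
  have h4 : ∀ i r, ∑ j, f (b r * y₂ i) • (a r * q i j * antipodeInv H (p i j)) =
      f (b r * (counit (R := ℂ) (y₁ i) • y₂ i)) • a r := by
    intro i r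
    simp only [mul_assoc]
    rw [← Finset.smul_sum, ← Finset.mul_sum, sum_mul_antipodeInv (hpq i)]
    simp [smul_smul, mul_comm]
  have h5 : ∀ i, ∑ j, ∑ r, f (b r * y₂ i) • (a r * q i j * antipodeInv H (p i j)) =
      ∑ r, f (b r * (counit (R := ℂ) (y₁ i) • y₂ i)) • a r := by
    intro i
    rw [Finset.sum_comm]
    exact Finset.sum_congr rfl fun r _ => h4 i r
  simp only [h5]
  rw [Finset.sum_comm]
  refine Finset.sum_congr rfl fun r _ => ?_
  rw [← Finset.sum_smul, ← map_sum, ← Finset.mul_sum, sum_counit_smul_right hy]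
  rfl

lemma exists_act_bound (y : H) : ∃ C : ℝ, 0 ≤ C ∧ ∀ T : LInf H, ∃ U : LInf H,
    sym U = sym T ∘ₗ LinearMap.mulRight ℂ y ∧ ‖U‖ ≤ C * ‖T‖ := by
  obtain ⟨n, y₁, y₂, hy⟩ := exists_comul_eq_sum y
  choose C hC hC' using fun i => exists_norm_mul_right_le (antipodeInv H (y₁ i))
  choose D hD hD' using fun i => exists_norm_mul_right_le (y₂ i)
  refine ⟨∑ i, C i * D i, Finset.sum_nonneg fun i _ => mul_nonneg (hC i) (hD i), fun T => ?_⟩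
  refine exists_sym_eq _ (mul_nonneg (Finset.sum_nonneg fun i _ => mul_nonneg (hC i) (hD i))
    (norm_nonneg _)) fun x => ?_
  rw [convRight_comp_mulRight _ x hy, map_sum, Finset.sum_mul, Finset.sum_mul]
  refine (norm_sum_le _ _).trans (Finset.sum_le_sum fun i _ => ?_)
  calc _ ≤ C i * (‖T‖ * (D i * ‖toL2 x‖)) := (hC' i _).trans (mul_le_mul_of_nonneg_left
        ((norm_convRight_le _ _).trans (mul_le_mul_of_nonneg_left (hD' i x) (norm_nonneg _))) (hC i))
    _ = _ := by ring

/-- The element with symbol `f(· y)`, where `f` is the symbol of `T`. -/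
def actFun (y : H) (T : LInf H) : LInf H := ((exists_act_bound y).choose_spec.2 T).choose

lemma sym_actFun (y : H) (T : LInf H) : sym (actFun y T) = sym T ∘ₗ LinearMap.mulRight ℂ y :=
  ((exists_act_bound y).choose_spec.2 T).choose_spec.1

/-- The action of `ℂ[G]`, on symbols given by `f ↦ f(· y)`. -/
def act : H →ₗ[ℂ] LInf H →ₗ[ℂ] LInf H :=
  LinearMap.mk₂ ℂ actFun
    (fun y y' T => sym_injective (by ext; simp [sym_actFun, mul_add]))
    (fun r y T => sym_injective (by ext; simp [sym_actFun]))
    (fun y T T' => sym_injective (by ext; simp [sym_actFun]))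
    (fun r y T => sym_injective (by ext; simp [sym_actFun]))

lemma sym_act (y : H) (T : LInf H) : sym (act y T) = sym T ∘ₗ LinearMap.mulRight ℂ y :=
  sym_actFun y T

lemma continuous_act (y : H) : Continuous (act (H := H) y) :=
  AddMonoidHomClass.continuous_of_bound (act y) (exists_act_bound y).choose fun T =>
    ((exists_act_bound y).choose_spec.2 T).choose_spec.2

lemma isDualAction_act : IsDualAction (act (H := H)) where
  one_act T := sym_injective (by rw [sym_act]; ext; simp)
  mul_act x y T := sym_injective (by rw [sym_act, sym_act, sym_act]; ext; simp [mul_assoc])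
  act_one x := sym_injective (by
    rw [sym_act, map_smul, sym_one]; ext; simp [Bialgebra.counit_mul, mul_comm])
  act_mul x T U := by
    obtain ⟨n, x₁, x₂, hx⟩ := exists_comul_eq_sum x
    rw [hx]
    simp only [map_sum, TensorProduct.map_tmul, LinearMap.flip_apply, LinearMap.mul'_apply]
    apply sym_injective
    ext v
    obtain ⟨m, a, b, hv⟩ := exists_comul_eq_sum v
    have h3 : comul (R := ℂ) (v * x) =
        ∑ r : Fin n × Fin m, (a r.2 * x₁ r.1) ⊗ₜ[ℂ] (b r.2 * x₂ r.1) := by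
      rw [Bialgebra.comul_mul, hv, hx, Finset.sum_mul_sum, Fintype.sum_prod_type, Finset.sum_comm]
      simp
    rw [map_sum, sym_act, sym_mul]
    simp only [sym_mul, sym_act, LinearMap.comp_apply, LinearMap.mulRight_apply,
      LinearMap.sum_apply, convRight_apply_of_eq h3, convRight_apply_of_eq hv,
      Fintype.sum_prod_type, map_sum, map_smul]
  act_star x T := sym_injective (by
    rw [sym_act, sym_star, sym_star, sym_act]
    ext v
    simp [antipode_mul_antidistrib])

end LInf

end LInf
end
end QG

namespace QG
noncomputable section
open scoped TensorProduct ComplexOrder CStarAlgebra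
open Coalgebra HopfAlgebra

/-! ### Extension of contractive homomorphisms, and the regular part of ℓ^∞(Ĝ) -/

section Extension
variable {D : Type*} [Ring D] [StarRing D] [Algebra ℂ D]
  {A : Type*} [CStarAlgebra A] {B : Type*} [CStarAlgebra B]

/-- A contractive homomorphism on a dense subalgebra extends. -/
lemma exists_starAlgHom_extension (i : D →⋆ₐ[ℂ] A) (hi : DenseRange i) (g : D →⋆ₐ[ℂ] B)
    (h : ∀ d, ‖g d‖ ≤ ‖i d‖) : ∃ G : A →⋆ₐ[ℂ] B, ∀ d, G (i d) = g d := by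
  let V : Submodule ℂ A := LinearMap.range (i : D →ₗ[ℂ] A)
  have hV : ∀ v : V, ∃ d, i d = v := fun v => v.2
  choose s hs using hV
  -- The norm bound makes g factor through the image of i, which need not be injective.
  have hg : ∀ d d', i d = i d' → g d = g d' := by
    intro d d' hd
    have h1 := h (d - d')
    rw [map_sub, map_sub, hd, sub_self, norm_zero] at h1
    exact sub_eq_zero.mp (norm_le_zero_iff.mp h1)
  let g' : V →L[ℂ] B := LinearMap.mkContinuous
    { toFun := fun v => g (s v)
      map_add' := fun v w => by
        rw [← map_add]; apply hg; rw [map_add, hs, hs, hs]; rfl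
      map_smul' := fun r v => by
        rw [RingHom.id_apply, ← map_smul]; apply hg; rw [map_smul, hs, hs]; rfl } 1
    (fun v => by
      rw [one_mul]
      refine (h (s v)).trans ?_
      rw [hs]; rfl)
  have hdense : DenseRange V.subtypeL := by
    have : Set.range V.subtypeL = Set.range i := by
      ext a
      simp [V]
    rw [DenseRange, this]; exact hi
  let G := g'.extend V.subtypeL
  have hG : ∀ d, G (i d) = g d := by
    intro d
    have h1 := g'.extend_eq (e := V.subtypeL) hdense
      (isometry_subtype_coe.isUniformInducing) ⟨i d, ⟨d, rfl⟩⟩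
    exact h1.trans (hg _ _ (hs _))
  have hmul : ∀ a b, G (a * b) = G a * G b := by
    intro a b
    refine hi.induction_on₂ (p := fun a b => G (a * b) = G a * G b) ?_ (fun d d' => ?_) a b
    · exact isClosed_eq (by fun_prop) (by fun_prop)
    · rw [← map_mul, hG, hG, hG, map_mul]
  have hstar : ∀ a, G (star a) = star (G a) := by
    intro a
    refine hi.induction_on a (isClosed_eq (by fun_prop) (by fun_prop)) fun d => ?_
    rw [← StarHomClass.map_star, hG, hG, StarHomClass.map_star]
  have hone : G 1 = 1 := by rw [← map_one i, hG, map_one]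
  let G' : A →⋆ₐ[ℂ] B :=
    { toFun := G
      map_one' := hone
      map_mul' := hmul
      map_zero' := map_zero G
      map_add' := map_add G
      commutes' := fun r => by simp only [Algebra.algebraMap_eq_smul_one, map_smul, hone]
      map_star' := hstar }
  exact ⟨G', hG⟩

end Extension

section Regular
attribute [local instance] CStarAlgebra.spectralOrder CStarAlgebra.spectralOrderedRing
attribute [local irreducible] instCStarAlgebraLInf instCStarAlgebraMinTensor
variable {H : Type u} [Ring H] [StarRing H] [HopfAlgebra ℂ H] [StarModule ℂ H]
  [CompactQuantumGroup H]

namespace LInf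

/-- The map `H → H` defined by an element of `H ⊗ LInf H`. -/
def evalSym : H ⊗[ℂ] LInf H →ₗ[ℂ] H →ₗ[ℂ] H :=
  TensorProduct.lift (LinearMap.mk₂ ℂ (fun e T => (sym T).smulRight e)
    (by intros; ext; simp) (by intros; ext; simp [smul_smul, mul_comm])
    (by intros; ext; simp [add_smul]) (by intros; ext; simp [smul_smul]))

@[simp] lemma evalSym_tmul (e : H) (T : LInf H) (x : H) :
    evalSym (e ⊗ₜ[ℂ] T) x = sym T x • e := rfl

lemma evalSym_injective : Function.Injective (evalSym (H := H)) := by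
  rw [← LinearMap.ker_eq_bot, LinearMap.ker_eq_bot']
  intro z hz
  obtain ⟨n, e, T, he, rfl⟩ := exists_orthonormal_expansion z
  refine Finset.sum_eq_zero fun i _ => ?_
  have h1 : T i = 0 := by
    apply sym_injective
    ext x
    have h2 := congrArg (fun y => haar H (star (e i) * y)) (LinearMap.congr_fun hz x)
    simp only [map_sum, LinearMap.sum_apply, evalSym_tmul, LinearMap.zero_apply, mul_zero,
      map_zero, Finset.mul_sum, mul_smul_comm, map_smul, he] at h2
    simpa using h2
  rw [h1, TensorProduct.tmul_zero]

lemma evalSym_one : evalSym (1 : H ⊗[ℂ] LInf H) = scalar H counit := by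
  ext x
  rw [Algebra.TensorProduct.one_def, evalSym_tmul, sym_one, scalar_apply]

lemma evalSym_mul (z w : H ⊗[ℂ] LInf H) : evalSym (z * w) = conv (evalSym z) (evalSym w) := by
  ext x
  obtain ⟨n, x₁, x₂, hx⟩ := exists_comul_eq_sum x
  rw [conv_apply_of_eq hx]
  induction z using TensorProduct.induction_on with
  | zero => simp
  | add p q hp hq => simp only [map_add, add_mul, LinearMap.add_apply, hp, hq, Finset.sum_add_distrib]
  | tmul e T =>
    induction w using TensorProduct.induction_on with
    | zero => simp
    | add p q hp hq => simp only [map_add, mul_add, LinearMap.add_apply, hp, hq, Finset.sum_add_distrib]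
    | tmul e' T' =>
      rw [Algebra.TensorProduct.tmul_mul_tmul, evalSym_tmul, sym_mul, LinearMap.comp_apply,
        convRight_apply_of_eq hx]
      simp [Finset.sum_smul, smul_smul, mul_comm]

lemma evalSym_star (z : H ⊗[ℂ] LInf H) (x : H) :
    evalSym (star z) x = star (evalSym z (star (antipode ℂ x))) := by
  induction z using TensorProduct.induction_on with
  | zero => simp
  | add p q hp hq => simp only [map_add, star_add, LinearMap.add_apply, hp, hq]
  | tmul e T => simp [sym_star, star_smul]

variable (H) in
/-- The regular elements of `LInf H`. -/
def regular : StarSubalgebra ℂ (LInf H) where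
  carrier := {T | ∃ z, evalSym z = coact (sym T)}
  mul_mem' := by
    rintro T U ⟨z, hz⟩ ⟨w, hw⟩
    exact ⟨z * w, by rw [evalSym_mul, hz, hw, sym_mul, coact_comp_convRight]⟩
  one_mem' := ⟨1, by rw [evalSym_one, sym_one, coact_counit]⟩
  add_mem' := by
    rintro T U ⟨z, hz⟩ ⟨w, hw⟩
    refine ⟨z + w, ?_⟩
    ext v
    obtain ⟨n, p, q, h⟩ := exists_coact_eq_sum v
    rw [map_add, hz, hw, LinearMap.add_apply, h, h, h, map_add, ← Finset.sum_add_distrib]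
    simp [add_smul]
  zero_mem' := ⟨0, by
    ext v
    obtain ⟨n, p, q, h⟩ := exists_coact_eq_sum v
    rw [h]; simp⟩
  algebraMap_mem' r := ⟨r • 1, by
    ext v
    obtain ⟨n, p, q, h⟩ := exists_coact_eq_sum v
    have h1 := LinearMap.congr_fun (coact_counit (H := H)) v
    rw [h] at h1
    rw [map_smul, evalSym_one, Algebra.algebraMap_eq_smul_one, map_smul, sym_one, h,
      LinearMap.smul_apply, ← h1, Finset.smul_sum]
    simp [smul_smul]⟩
  star_mem' := by
    rintro T ⟨z, hz⟩
    refine ⟨star z, ?_⟩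
    ext v
    rw [evalSym_star, hz, sym_star, coact_symbolStar]

lemma act_mem_regular {T : LInf H} (hT : T ∈ regular H) (y : H) : act y T ∈ regular H := by
  obtain ⟨z, hz⟩ := hT
  obtain ⟨n, a, b, hy⟩ := exists_comul_eq_sum y
  choose k c d hcd using fun i => exists_comul_eq_sum (b i)
  obtain ⟨m, e, U, -, rfl⟩ := exists_orthonormal_expansion z
  refine ⟨∑ i : (i : Fin n) × Fin (k i), ∑ j, (a i.1 * e j * antipode ℂ (d i.1 i.2)) ⊗ₜ[ℂ]
    act (c i.1 i.2) (U j), ?_⟩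
  have h1 : (comul (R := ℂ)).lTensor H (comul (R := ℂ) y) = ∑ i : (i : Fin n) × Fin (k i),
      a i.1 ⊗ₜ[ℂ] (c i.1 i.2 ⊗ₜ[ℂ] d i.1 i.2) := by
    rw [hy, Fintype.sum_sigma]
    simp [hcd, TensorProduct.tmul_sum]
  ext v
  rw [sym_act, coact_comp_mulRight _ h1, ← hz]
  simp [map_sum, LinearMap.sum_apply, sym_act, Finset.mul_sum, Finset.sum_mul, mul_assoc]

/-- The coaction on the slices of the coaction. -/
lemma coact_slice {f g : H →ₗ[ℂ] ℂ} (ω : H →ₗ[ℂ] ℂ) (hg : ∀ v, g v = ω (coact f v)) (v : H) :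
    coact g v = TensorProduct.lid ℂ H (ω.rTensor H (comul (R := ℂ) (coact f v))) := by
  have h1 := LinearMap.congr_fun (comul_coact f) v
  obtain ⟨n, a, b, hx⟩ := exists_comul_eq_sum v
  choose k c d hcd using fun i => exists_comul_eq_sum (b i)
  rw [LinearMap.comp_apply, conv_apply_of_eq hx] at h1
  rw [h1, coact, conv_apply_of_eq hx]
  simp [conv_apply_of_eq (hcd _), hg, Finset.mul_sum]

/-- The right legs are slices of `coact (sym T)`, and `comul_coact` expresses the coaction of a
slice by slices. Hence the coaction of a regular element stays in ℂ[G] tensored with regular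
elements. -/
lemma leg_mem_regular {T : LInf H} {n : ℕ} {e : Fin n → H} {U : Fin n → LInf H}
    (he : ∀ i j, haar H (star (e i) * e j) = if i = j then 1 else 0)
    (hT : evalSym (∑ i, e i ⊗ₜ[ℂ] U i) = coact (sym T)) (i : Fin n) : U i ∈ regular H := by
  let ω : H →ₗ[ℂ] ℂ := haar H ∘ₗ LinearMap.mulLeft ℂ (star (e i))
  have h1 : ∀ v, sym (U i) v = ω (coact (sym T) v) := by
    intro v
    rw [← hT]
    simp [ω, LinearMap.sum_apply, he]
  refine ⟨∑ k, TensorProduct.lid ℂ H (ω.rTensor H (comul (R := ℂ) (e k))) ⊗ₜ[ℂ] U k, ?_⟩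
  ext v
  rw [coact_slice ω h1, ← hT]
  simp [LinearMap.sum_apply]

end LInf

variable (H) in
/-- The regular part of `LInf H`, a C*-algebra. -/
def RegInf : Type u := (LInf.regular H).topologicalClosure

instance : IsClosed ((LInf.regular H).topologicalClosure : Set (LInf H)) :=
  (LInf.regular H).isClosed_topologicalClosure

instance instCStarAlgebraRegInf : CStarAlgebra (RegInf H) :=
  inferInstanceAs (CStarAlgebra (LInf.regular H).topologicalClosure)

namespace RegInf
open LInf

/-- The inclusion into `LInf H`. -/
def incl : RegInf H →⋆ₐ[ℂ] LInf H := (LInf.regular H).topologicalClosure.subtype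

lemma incl_injective : Function.Injective (incl (H := H)) := Subtype.val_injective

lemma norm_incl (T : RegInf H) : ‖incl T‖ = ‖T‖ := rfl

lemma continuous_incl : Continuous (incl (H := H)) := continuous_subtype_val

/-- The inclusion of the regular elements. -/
def ofRegular : LInf.regular H →⋆ₐ[ℂ] RegInf H :=
  StarSubalgebra.inclusion (LInf.regular H).le_topologicalClosure

@[simp] lemma incl_ofRegular (T : LInf.regular H) : incl (ofRegular T) = T := rfl

lemma denseRange_ofRegular : DenseRange (ofRegular (H := H)) := by
  have h : Topology.IsInducing (incl (H := H)) := Topology.IsInducing.subtypeVal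
  intro T
  rw [h.closure_eq_preimage_closure_image, Set.mem_preimage]
  have : incl '' Set.range (ofRegular (H := H)) = (LInf.regular H : Set (LInf H)) := by
    ext U
    constructor
    · rintro ⟨_, ⟨V, rfl⟩, rfl⟩
      exact V.2
    · intro hU
      exact ⟨_, ⟨⟨U, hU⟩, rfl⟩, rfl⟩
  rw [this]
  exact T.2

lemma exists_incl_eq {T : LInf H} (h : T ∈ closure (LInf.regular H : Set (LInf H))) :
    ∃ U : RegInf H, incl U = T := ⟨⟨T, h⟩, rfl⟩

end RegInf

end Regular
end
end QG

namespace QG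
noncomputable section
open scoped TensorProduct ComplexOrder CStarAlgebra
open Coalgebra HopfAlgebra

/-! ### Boundedness of the coaction on the regular part -/

section Haar₂
variable {H : Type u} [Ring H] [StarRing H] [HopfAlgebra ℂ H] [StarModule ℂ H]
  [CompactQuantumGroup H]

lemma exists_orthonormal_expansion_right (ξ : H ⊗[ℂ] H) :
    ∃ (n : ℕ) (g : Fin n → H) (w : Fin n → H),
      (∀ i j, haar H (star (g i) * g j) = if i = j then 1 else 0) ∧
      ξ = ∑ i, w i ⊗ₜ[ℂ] g i := by
  obtain ⟨n, g, w, hg, h⟩ := exists_orthonormal_expansion (TensorProduct.comm ℂ H H ξ)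
  refine ⟨n, g, w, hg, ?_⟩
  have := congrArg (TensorProduct.comm ℂ H H) h
  simpa using this

lemma haar₂_expansion {n : ℕ} {g : Fin n → H}
    (hg : ∀ i j, haar H (star (g i) * g j) = if i = j then 1 else 0) (w : Fin n → H) :
    haar₂ H (star (∑ i, w i ⊗ₜ[ℂ] g i) * ∑ i, w i ⊗ₜ[ℂ] g i) =
      ((∑ i, ‖toL2 (w i)‖ ^ 2 : ℝ) : ℂ) := by
  simp [star_sum, Finset.sum_mul, Finset.mul_sum, hg, haar_star_mul_self]

/-- An operator on the first leg is bounded for the Hilbert norm of `H ⊗ H`. -/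
lemma exists_haar₂_rTensor_le (g : H →ₗ[ℂ] H) {C : ℝ}
    (h : ∀ x, ‖toL2 (g x)‖ ≤ C * ‖toL2 x‖) (ξ : H ⊗[ℂ] H) :
    ∃ r s : ℝ, haar₂ H (star (g.rTensor H ξ) * g.rTensor H ξ) = r ∧ haar₂ H (star ξ * ξ) = s ∧
      r ≤ C ^ 2 * s := by
  obtain ⟨n, e, w, he, rfl⟩ := exists_orthonormal_expansion_right ξ
  refine ⟨∑ i, ‖toL2 (g (w i))‖ ^ 2, _, ?_, haar₂_expansion he w, ?_⟩
  · rw [map_sum]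
    simp only [LinearMap.rTensor_tmul]
    exact haar₂_expansion he _
  · rw [Finset.mul_sum]
    refine Finset.sum_le_sum fun i _ => ?_
    rw [← mul_pow]
    exact pow_le_pow_left₀ (norm_nonneg _) (h _) 2

/-- From x₍₁₎ coact f (x₍₂₎) = f(x₍₁₎)x₍₂₎ it follows that the fundamental isometry intertwines the
coaction with T ⊗ 1, the Hopf-algebraic form of α(T) = W*(T ⊗ 1)W. -/
lemma fundamentalIsometry_coact (f : H →ₗ[ℂ] ℂ) {u : H} {n : ℕ} {u₁ u₂ : Fin n → H}
    (hu : comul (R := ℂ) u = ∑ i, u₁ i ⊗ₜ[ℂ] u₂ i) (e : H) :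
    fundamentalIsometry H (∑ i, u₁ i ⊗ₜ[ℂ] (coact f (u₂ i) * e)) =
      (convRight f).rTensor H (fundamentalIsometry H (u ⊗ₜ[ℂ] e)) := by
  let i₁ := Algebra.TensorProduct.includeLeft (R := ℂ) (S := ℂ) (A := H) (B := H)
  let i₂ := Algebra.TensorProduct.includeRight (R := ℂ) (A := H) (B := H)
  have h1 : conv (comul (R := ℂ)) (i₂.toLinearMap ∘ₗ coact f) =
      conv (i₁.toLinearMap ∘ₗ convRight f) i₂.toLinearMap := by
    have h2 := algHom_comp_conv i₂ LinearMap.id (antipode ℂ)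
    rw [id_conv_antipode, algHom_comp_scalar, LinearMap.comp_id] at h2
    have h3 : i₁.toLinearMap ∘ₗ convRight f = conv i₁.toLinearMap (scalar _ f) := by
      rw [convRight, algHom_comp_conv, algHom_comp_scalar]; rfl
    have h4 : i₂.toLinearMap ∘ₗ coact f = conv (i₂.toLinearMap ∘ₗ antipode ℂ)
        (conv (scalar _ f) i₂.toLinearMap) := by
      rw [coact, algHom_comp_conv, algHom_comp_conv, algHom_comp_scalar]; rfl
    have h5 : conv i₂.toLinearMap (i₂.toLinearMap ∘ₗ coact f) =
        conv (scalar _ f) i₂.toLinearMap := by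
      rw [h4, ← conv_assoc, ← h2, counit_conv]
    rw [comul_eq_conv, conv_assoc, h3, conv_assoc]
    exact congrArg (conv i₁.toLinearMap) h5
  have h6 := LinearMap.congr_fun h1 u
  rw [conv_apply_of_eq hu, conv_apply_of_eq hu] at h6
  have h7 : ∀ t : H ⊗[ℂ] H, (convRight f).rTensor H (t * ((1 : H) ⊗ₜ[ℂ] e)) =
      (convRight f).rTensor H t * ((1 : H) ⊗ₜ[ℂ] e) := by
    intro t
    induction t using TensorProduct.induction_on with
    | zero => simp
    | add x y hx hy => simp only [map_add, add_mul, hx, hy]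
    | tmul x y => simp
  have h8 : ∀ x y : H, (1 : H) ⊗ₜ[ℂ] (x * y) = ((1 : H) ⊗ₜ[ℂ] x) * ((1 : H) ⊗ₜ[ℂ] y) := by
    intro x y; simp
  rw [map_sum, fundamentalIsometry_tmul, h7]
  simp only [fundamentalIsometry_tmul, h8, ← mul_assoc]
  rw [← Finset.sum_mul]
  congr 1
  refine h6.trans ?_
  rw [hu, map_sum]
  simp [i₁, i₂]

end Haar₂

section Coaction
attribute [local instance] CStarAlgebra.spectralOrder CStarAlgebra.spectralOrderedRing
attribute [local irreducible] instCStarAlgebraLInf instCStarAlgebraMinTensor instCStarAlgebraRegInf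
variable {H : Type u} [Ring H] [StarRing H] [HopfAlgebra ℂ H] [StarModule ℂ H]
  [CompactQuantumGroup H]

namespace RegInf
open LInf

/-- The symbol of an element of `RegInf H`. -/
def symbol : RegInf H →ₗ[ℂ] H →ₗ[ℂ] ℂ := sym ∘ₗ (incl (H := H) : RegInf H →ₗ[ℂ] LInf H)

lemma symbol_def (T : RegInf H) : symbol T = sym (incl T) := rfl

lemma symbol_injective : Function.Injective (symbol (H := H)) :=
  sym_injective.comp incl_injective

lemma symbol_one : symbol (1 : RegInf H) = counit := by
  rw [symbol_def, map_one, sym_one]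

lemma symbol_mul (T U : RegInf H) : symbol (T * U) = symbol T ∘ₗ convRight (symbol U) := by
  rw [symbol_def, map_mul, sym_mul]; rfl

lemma symbol_star (T : RegInf H) : symbol (star T) = symbolStar (symbol T) := by
  rw [symbol_def, StarHomClass.map_star, sym_star]; rfl

lemma continuous_symbol (x : H) : Continuous fun T : RegInf H => symbol T x :=
  (continuous_sym x).comp continuous_incl

/-- The map `H → H` defined by an element of `H ⊗ RegInf H`. -/
def eval : H ⊗[ℂ] RegInf H →ₗ[ℂ] H →ₗ[ℂ] H :=
  evalSym ∘ₗ (incl (H := H) : RegInf H →ₗ[ℂ] LInf H).lTensor H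

@[simp] lemma eval_tmul (e : H) (T : RegInf H) (x : H) :
    eval (e ⊗ₜ[ℂ] T) x = symbol T x • e := rfl

lemma eval_injective : Function.Injective (eval (H := H)) :=
  evalSym_injective.comp (Module.Flat.lTensor_preserves_injective_linearMap _ incl_injective)

lemma eval_one : eval (1 : H ⊗[ℂ] RegInf H) = scalar H counit := by
  ext x
  rw [Algebra.TensorProduct.one_def, eval_tmul, symbol_one, scalar_apply]

lemma eval_mul (z w : H ⊗[ℂ] RegInf H) : eval (z * w) = conv (eval z) (eval w) := by
  have h : ∀ z w : H ⊗[ℂ] RegInf H, (incl (H := H) : RegInf H →ₗ[ℂ] LInf H).lTensor H (z * w) =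
      (incl (H := H) : RegInf H →ₗ[ℂ] LInf H).lTensor H z * (incl (H := H) : RegInf H →ₗ[ℂ] LInf H).lTensor H w := by
    intro z w
    induction z using TensorProduct.induction_on with
    | zero => simp
    | add p q hp hq => simp only [map_add, add_mul, hp, hq]
    | tmul e T =>
      induction w using TensorProduct.induction_on with
      | zero => simp
      | add p q hp hq => simp only [map_add, mul_add, hp, hq]
      | tmul e' T' => simp
  rw [eval, LinearMap.comp_apply, h, evalSym_mul]
  rfl

lemma eval_star (z : H ⊗[ℂ] RegInf H) (x : H) :
    eval (star z) x = star (eval z (star (antipode ℂ x))) := by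
  induction z using TensorProduct.induction_on with
  | zero => simp
  | add p q hp hq => simp only [map_add, star_add, LinearMap.add_apply, hp, hq]
  | tmul e T => simp [symbol_star, star_smul]

lemma exists_eval_eq {T : LInf H} (hT : T ∈ regular H) :
    ∃ z : H ⊗[ℂ] RegInf H, eval z = coact (sym T) := by
  obtain ⟨z, hz⟩ := hT
  obtain ⟨n, e, U, he, rfl⟩ := exists_orthonormal_expansion z
  refine ⟨∑ i, e i ⊗ₜ[ℂ] ofRegular ⟨U i, leg_mem_regular he hz i⟩, ?_⟩
  rw [← hz]
  ext x
  simp [LinearMap.sum_apply, symbol_def]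

lemma mem_regular_of_eval {T : RegInf H} {z : H ⊗[ℂ] RegInf H} (h : eval z = coact (symbol T)) :
    incl T ∈ regular H := ⟨_, h⟩

lemma coact_add_smul (f g : H →ₗ[ℂ] ℂ) (r : ℂ) : coact (f + r • g) = coact f + r • coact g := by
  ext v
  obtain ⟨n, p, q, h⟩ := exists_coact_eq_sum v
  simp [h, add_smul, Finset.sum_add_distrib, Finset.smul_sum, smul_smul]

/-- The coaction on the regular elements. -/
def coactHom : regular H →⋆ₐ[ℂ] H ⊗[ℂ] RegInf H :=
  have hs : ∀ T : regular H, eval (exists_eval_eq T.2).choose = coact (sym T.1) :=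
    fun T => (exists_eval_eq T.2).choose_spec
  { toFun := fun T => (exists_eval_eq T.2).choose
    map_one' := eval_injective ((hs 1).trans (by
      rw [eval_one, OneMemClass.coe_one, sym_one, coact_counit]))
    map_mul' := fun T U => eval_injective ((hs _).trans (by
      rw [eval_mul, hs, hs, MulMemClass.coe_mul, sym_mul, coact_comp_convRight]))
    map_zero' := eval_injective ((hs 0).trans (by
      have := coact_add_smul (H := H) 0 0 (-1)
      simpa using this))
    map_add' := fun T U => eval_injective ((hs _).trans (by
      have := coact_add_smul (H := H) (sym T.1) (sym U.1) 1
      rw [map_add, hs, hs, AddMemClass.coe_add, map_add]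
      simpa using this))
    commutes' := fun r => eval_injective ((hs _).trans (by
      have := coact_add_smul (H := H) 0 counit r
      have h0 : coact (0 : H →ₗ[ℂ] ℂ) = 0 := by
        have := coact_add_smul (H := H) 0 0 (-1)
        simpa using this
      rw [zero_add, h0, zero_add] at this
      rw [show ((algebraMap ℂ (regular H) r : regular H) : LInf H) = algebraMap ℂ (LInf H) r from rfl,
        Algebra.algebraMap_eq_smul_one, map_smul, sym_one, this,
        Algebra.algebraMap_eq_smul_one, map_smul, eval_one, coact_counit]))
    map_star' := fun T => eval_injective ((hs _).trans (by
      ext x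
      rw [eval_star, hs]
      exact (congrArg (fun f => coact f x) (sym_star T.1)).trans (coact_symbolStar _ _))) }

lemma eval_coactHom (T : regular H) : eval (coactHom T) = coact (sym T.1) :=
  (exists_eval_eq T.2).choose_spec

/-- The map `e ⊗ T ↦ T v ⊗ e`. -/
def applyVec (v : H) : H ⊗[ℂ] RegInf H →ₗ[ℂ] H ⊗[ℂ] H :=
  TensorProduct.lift (LinearMap.mk₂ ℂ (fun e T => convRight (symbol T) v ⊗ₜ[ℂ] e)
    (by intros; simp [TensorProduct.tmul_add]) (by intros; simp)
    (by intros; simp [convRight_add, TensorProduct.add_tmul])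
    (by intros; simp [convRight_smul, TensorProduct.smul_tmul']))

@[simp] lemma applyVec_tmul (v e : H) (T : RegInf H) :
    applyVec v (e ⊗ₜ[ℂ] T) = convRight (symbol T) v ⊗ₜ[ℂ] e := rfl

/-- Vector states turn the inner product with values in `RegInf H` into the scalar inner product of
ℂ[G] ⊗ ℂ[G], where the fundamental isometry acts. -/
lemma haar_modInner (v : H) (y z : H ⊗[ℂ] RegInf H) :
    haar H (star v * convRight (symbol (modInner y z)) v) =
      haar₂ H (star (applyVec v y) * applyVec v z) := by
  induction y using TensorProduct.induction_on with
  | zero => simp [modInner, convRight_zero]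
  | add p q hp hq =>
    simp only [modInner_add_left, map_add, star_add, add_mul, convRight_add, mul_add, hp, hq]
  | tmul e T =>
    induction z using TensorProduct.induction_on with
    | zero => simp [modInner, convRight_zero]
    | add p q hp hq =>
      simp only [modInner_add_right, map_add, convRight_add, mul_add, hp, hq]
    | tmul e' T' =>
      have h := haar_star_mul_convRight (incl T) (incl T') v v
      rw [← StarHomClass.map_star, ← map_mul] at h
      rw [modInner_tmul, map_smul, convRight_smul, mul_smul_comm, map_smul]
      simp only [symbol_def, applyVec_tmul, h]
      simp [mul_comm]

lemma applyVec_mul_tmul (v : H) (z : H ⊗[ℂ] RegInf H) (e : H) (U : RegInf H) {n : ℕ}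
    {u₁ u₂ : Fin n → H} (hu : comul (R := ℂ) (convRight (symbol U) v) = ∑ i, u₁ i ⊗ₜ[ℂ] u₂ i) :
    applyVec v (z * (e ⊗ₜ[ℂ] U)) = ∑ i, u₁ i ⊗ₜ[ℂ] (eval z (u₂ i) * e) := by
  induction z using TensorProduct.induction_on with
  | zero => simp
  | add p q hp hq =>
    simp only [add_mul, map_add, hp, hq, LinearMap.add_apply, TensorProduct.tmul_add,
      Finset.sum_add_distrib]
  | tmul e' T =>
    rw [Algebra.TensorProduct.tmul_mul_tmul, applyVec_tmul, symbol_mul, ← convRight_comp,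
      LinearMap.comp_apply, convRight_apply_of_eq hu, TensorProduct.sum_tmul]
    simp [TensorProduct.smul_tmul]

lemma fundamentalIsometry_applyVec (v : H) {z : H ⊗[ℂ] RegInf H} {f : H →ₗ[ℂ] ℂ}
    (hz : eval z = coact f) (y : H ⊗[ℂ] RegInf H) :
    fundamentalIsometry H (applyVec v (z * y)) =
      (convRight f).rTensor H (fundamentalIsometry H (applyVec v y)) := by
  induction y using TensorProduct.induction_on with
  | zero => simp
  | add p q hp hq => simp only [mul_add, map_add, hp, hq]
  | tmul e U =>
    obtain ⟨n, u₁, u₂, hu⟩ := exists_comul_eq_sum (convRight (symbol U) v)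
    rw [applyVec_mul_tmul v z e U hu, hz, fundamentalIsometry_coact f hu, applyVec_tmul]

/-- Positivity in `RegInf H` is tested on vectors v. After the fundamental isometry, multiplication
by `coactHom T` becomes T on the first leg, which has norm at most ‖T‖. -/
lemma norm_coactHom_le (T : regular H) :
    ‖(ofAlg (coactHom T) : MinTensor H (RegInf H))‖ ≤ ‖ofRegular T‖ := by
  refine norm_ofAlg_le (norm_nonneg _) fun y => ?_
  apply modNorm_le_of_le (norm_nonneg _)
  rw [← sub_nonneg]
  refine nonneg_of_haar incl incl_injective fun v => ?_
  obtain ⟨r, s, hr, hs, hrs⟩ := exists_haar₂_rTensor_le (convRight (sym T.1))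
    (C := ‖ofRegular T‖) (fun x => by rw [← norm_incl]; exact norm_convRight_le T.1 x)
    (fundamentalIsometry H (applyVec v y))
  rw [← fundamentalIsometry_applyVec v (eval_coactHom T), haar₂_fundamentalIsometry,
    ← haar_modInner] at hr
  rw [haar₂_fundamentalIsometry, ← haar_modInner] at hs
  refine ⟨‖ofRegular T‖ ^ 2 * s - r, sub_nonneg.mpr hrs, ?_⟩
  have h1 : symbol ((‖ofRegular T‖ ^ 2 : ℝ) • modInner y y -
      modInner (coactHom T * y) (coactHom T * y)) =
      ((‖ofRegular T‖ ^ 2 : ℝ) : ℂ) • symbol (modInner y y) +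
        (-1 : ℂ) • symbol (modInner (coactHom T * y) (coactHom T * y)) := by
    rw [map_sub, ← Complex.coe_smul, map_smul, neg_one_smul, sub_eq_add_neg]
  change haar H (star v * convRight (symbol _) v) = _
  rw [h1, convRight_add, convRight_smul, convRight_smul, mul_add, mul_smul_comm, mul_smul_comm,
    map_add, map_smul, map_smul, hr, hs]
  push_cast
  simp [sub_eq_add_neg]

/-- The coaction on the regular elements, with values in the C*-tensor product. -/
def coactMin : regular H →⋆ₐ[ℂ] MinTensor H (RegInf H) := StarAlgHom.comp ofAlg coactHom

lemma coactMin_apply (T : regular H) : coactMin T = ofAlg (coactHom T) := rfl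

lemma norm_coactMin_le (T : regular H) : ‖coactMin T‖ ≤ ‖ofRegular T‖ := by
  rw [coactMin_apply]; exact norm_coactHom_le T

lemma exists_coaction : ∃ G : RegInf H →⋆ₐ[ℂ] MinTensor H (RegInf H),
    ∀ T : regular H, G (ofRegular T) = coactMin T :=
  exists_starAlgHom_extension (D := regular H) (A := RegInf H) (B := MinTensor H (RegInf H))
    ofRegular denseRange_ofRegular coactMin norm_coactMin_le

/-- The coaction on `RegInf H`. -/
def coaction : RegInf H →⋆ₐ[ℂ] MinTensor H (RegInf H) := exists_coaction.choose

lemma coaction_ofRegular (T : regular H) : coaction (ofRegular T) = ofAlg (coactHom T) :=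
  exists_coaction.choose_spec T

lemma symbol_slice (ω : H →ₗ[ℂ] ℂ) (z : H ⊗[ℂ] RegInf H) (v : H) :
    symbol (slice ω z) v = ω (eval z v) := by
  induction z using TensorProduct.induction_on with
  | zero => simp
  | add p q hp hq => simp only [map_add, LinearMap.add_apply, hp, hq]
  | tmul e T => simp [mul_comm]

lemma symbol_minSlice (x : H) (T : RegInf H) (v : H) :
    symbol (minSlice x (coaction T)) v = haar H (coact (symbol T) v * x) := by
  obtain ⟨n, p, q, h⟩ := exists_coact_eq_sum v
  refine denseRange_ofRegular.induction_on T (isClosed_eq ?_ ?_) fun U => ?_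
  · exact (continuous_symbol v).comp ((minSlice x).continuous.comp (continuous_starAlgHom _))
  · simp only [h, Finset.sum_mul, smul_mul_assoc, map_sum, map_smul, smul_eq_mul]
    exact continuous_finsetSum _ fun i _ => (continuous_symbol _).mul continuous_const
  · rw [coaction_ofRegular, minSlice_ofAlg_eq, symbol_slice, eval_coactHom]
    rfl

/-- Slices by h(· x) separate, because h is faithful, so the coaction can be read off symbols. With
this, identities for `coaction` reduce to identities for `coact`. -/
lemma coaction_eq_iff {T : RegInf H} {z : H ⊗[ℂ] RegInf H} :
    coaction T = ofAlg z ↔ eval z = coact (symbol T) := by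
  constructor
  · intro h
    ext v
    rw [← sub_eq_zero]
    apply eq_zero_of_haar_mul_eq_zero
    intro x
    have h1 := symbol_minSlice x T v
    rw [h, minSlice_ofAlg_eq, symbol_slice] at h1
    rw [sub_mul, map_sub, ← h1]
    simp
  · intro h
    have h1 := coaction_ofRegular ⟨incl T, mem_regular_of_eval h⟩
    have h2 : ofRegular ⟨incl T, mem_regular_of_eval h⟩ = T := incl_injective rfl
    rw [h2] at h1
    rw [h1]
    congr 1
    apply eval_injective
    rw [eval_coactHom, h]
    rfl

lemma coaction_minSlice (b : RegInf H) {x : H} {n : ℕ} {x₁ x₂ : Fin n → H}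
    (hx : comul (R := ℂ) x = ∑ i, x₁ i ⊗ₜ[ℂ] x₂ i) :
    coaction (minSlice x (coaction b)) =
      ofAlg (∑ i, antipode ℂ (x₂ i) ⊗ₜ[ℂ] minSlice (x₁ i) (coaction b)) := by
  rw [coaction_eq_iff]
  ext v
  rw [coact_slice (haar H ∘ₗ LinearMap.mulRight ℂ x) (symbol_minSlice x b) v]
  obtain ⟨m, a, c, hc⟩ := exists_comul_eq_sum (coact (symbol b) v)
  have h1 := haar_strong_invariance_right hx hc
  rw [hc]
  simp only [map_sum, LinearMap.rTensor_tmul, TensorProduct.lid_tmul, LinearMap.comp_apply,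
    LinearMap.mulRight_apply, h1, LinearMap.sum_apply, eval_tmul, symbol_minSlice]

lemma isAction_coaction : IsAction (coaction (H := H)) := by
  refine isAction_of ?_ (fun b x n x₁ x₂ hx => coaction_minSlice b hx) ?_
  -- If α(T) = 0, all slices of `coact (symbol T)` vanish; hence it is zero, and the counit recovers
  -- the symbol from it.
  · rw [injective_iff_map_eq_zero]
    intro T hT
    apply symbol_injective
    ext v
    rw [← counit_coact]
    have : coact (symbol T) v = 0 := by
      apply eq_zero_of_haar_mul_eq_zero
      intro x
      rw [← symbol_minSlice, hT]
      simp
    rw [this]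
    simp
  · refine denseRange_ofRegular.mono ?_
    rintro _ ⟨T, rfl⟩
    apply Submodule.subset_span
    obtain ⟨n, e, U, -, hz⟩ := exists_orthonormal_expansion (coactHom T)
    -- Choosing h(· x) equal to ε on the left legs exhibits a regular element as its own slice.
    obtain ⟨x, hx⟩ := exists_haar_mul_eq_counit e
    refine ⟨x, ofRegular T, symbol_injective ?_⟩
    ext v
    rw [symbol_minSlice, ← counit_coact]
    have h1 : coact (symbol (ofRegular T)) v = ∑ i, symbol (U i) v • e i := by
      have := LinearMap.congr_fun (eval_coactHom T) v
      rw [hz] at this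
      rw [symbol_def, incl_ofRegular, ← this]
      simp [LinearMap.sum_apply]
    rw [h1]
    simp [Finset.sum_mul, hx]

end RegInf
end Coaction
end
end QG

namespace QG
noncomputable section
open scoped TensorProduct ComplexOrder CStarAlgebra
open Coalgebra HopfAlgebra

/-! ### The Yetter–Drinfeld structure and braided commutativity of `regYD H` -/

section RegYD
attribute [local irreducible] instCStarAlgebraLInf instCStarAlgebraMinTensor instCStarAlgebraRegInf
variable {H : Type u} [Ring H] [StarRing H] [HopfAlgebra ℂ H] [StarModule ℂ H]
  [CompactQuantumGroup H]

namespace RegInf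
open LInf

lemma exists_incl_eq_act (y : H) (T : RegInf H) : ∃ U : RegInf H, incl U = LInf.act y (incl T) := by
  have hT : incl T ∈ closure (regular H : Set (LInf H)) := T.2
  exact exists_incl_eq (map_mem_closure (continuous_act y) hT fun _ hU => act_mem_regular hU y)

/-- The element with symbol `f(· y)`, where `f` is the symbol of `T`. -/
def actFun (y : H) (T : RegInf H) : RegInf H := (exists_incl_eq_act y T).choose

lemma incl_actFun (y : H) (T : RegInf H) : incl (actFun y T) = LInf.act y (incl T) :=
  (exists_incl_eq_act y T).choose_spec

/-- The action of `ℂ[G]`, on symbols given by `f ↦ f(· y)`. -/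
def act : H →ₗ[ℂ] RegInf H →ₗ[ℂ] RegInf H :=
  LinearMap.mk₂ ℂ actFun
    (fun y y' T => incl_injective (by simp [incl_actFun]))
    (fun r y T => incl_injective (by simp [incl_actFun]))
    (fun y T T' => incl_injective (by simp [incl_actFun]))
    (fun r y T => incl_injective (by simp [incl_actFun]))

lemma incl_act (y : H) (T : RegInf H) : incl (act y T) = LInf.act y (incl T) := incl_actFun y T

lemma symbol_act (y : H) (T : RegInf H) : symbol (act y T) = symbol T ∘ₗ LinearMap.mulRight ℂ y := by
  rw [symbol_def, incl_act, sym_act]; rfl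

lemma isDualAction_act : IsDualAction (act (H := H)) where
  one_act T := incl_injective (by rw [incl_act, LInf.isDualAction_act.one_act])
  mul_act x y T := incl_injective (by
    rw [incl_act, incl_act, incl_act, LInf.isDualAction_act.mul_act])
  act_one x := incl_injective (by
    rw [incl_act, map_one, LInf.isDualAction_act.act_one, map_smul, map_one])
  act_mul x T U := incl_injective (by
    obtain ⟨n, x₁, x₂, hx⟩ := exists_comul_eq_sum x
    rw [incl_act, map_mul, LInf.isDualAction_act.act_mul, hx]
    simp [incl_act])
  act_star x T := incl_injective (by
    rw [incl_act, StarHomClass.map_star incl, LInf.isDualAction_act.act_star,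
      StarHomClass.map_star incl, incl_act])

lemma yetterDrinfeld (x : H) (a : RegInf H) (n : ℕ) (x₁ x₂ x₃ : Fin n → H) (m : ℕ)
    (a₁ : Fin m → H) (a₂ : Fin m → RegInf H)
    (hx : (comul (R := ℂ)).lTensor H (comul (R := ℂ) x) = ∑ i, x₁ i ⊗ₜ[ℂ] (x₂ i ⊗ₜ[ℂ] x₃ i))
    (ha : coaction a = ofAlg (∑ j, a₁ j ⊗ₜ[ℂ] a₂ j)) :
    coaction (act x a) = ofAlg (∑ i, ∑ j,
      (x₁ i * a₁ j * antipode ℂ (x₃ i)) ⊗ₜ[ℂ] act (x₂ i) (a₂ j)) := by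
  rw [coaction_eq_iff] at ha ⊢
  ext v
  rw [symbol_act, coact_comp_mulRight _ hx, ← ha]
  simp [LinearMap.sum_apply, symbol_act, Finset.mul_sum, Finset.sum_mul, mul_assoc]

instance : Nontrivial (RegInf H) := by
  refine ⟨1, 0, fun h => ?_⟩
  have h1 := congrArg (fun T => symbol T (1 : H)) h
  simp [symbol_one] at h1

/-- After applying S this says coact g (x₍₁₎)S(x₍₂₎) = S(x₍₁₎)g(x₍₂₎), where x₍₃₎S(x₍₄₎) cancels. It
is the identity behind braided commutativity. -/
lemma sum_mul_antipodeInv_coact (g : H →ₗ[ℂ] ℂ) {x : H} {n : ℕ} {x₁ x₂ : Fin n → H}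
    (hx : comul (R := ℂ) x = ∑ i, x₁ i ⊗ₜ[ℂ] x₂ i) :
    ∑ i, x₂ i * antipodeInv H (coact g (x₁ i)) = convRight g x := by
  apply antipode_injective
  have h1 : conv (coact g) (antipode ℂ) = antipode ℂ ∘ₗ convRight g := by
    rw [coact_eq, conv_assoc, id_conv_antipode, conv_counit, conv_scalar]
    rfl
  have h2 := LinearMap.congr_fun h1 x
  rw [conv_apply_of_eq hx] at h2
  rw [map_sum]
  simpa [antipode_mul_antidistrib] using h2

/-- The symbol of ab at x is the symbol of a at `convRight (symbol b) x`. Rewriting the latter by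
`sum_mul_antipodeInv_coact` lets S⁻¹(b₍₁₎) act on a from the right inside the symbol. -/
lemma braidedCommutative (a b : RegInf H) {m : ℕ} {b₁ : Fin m → H} {b₂ : Fin m → RegInf H}
    (hb : coaction b = ofAlg (∑ j, b₁ j ⊗ₜ[ℂ] b₂ j)) :
    a * b = ∑ j, b₂ j * act (star (antipode ℂ (star (b₁ j)))) a := by
  rw [coaction_eq_iff] at hb
  apply symbol_injective
  ext x
  obtain ⟨n, x₁, x₂, hx⟩ := exists_comul_eq_sum x
  have h1 := congrArg (symbol a) (sum_mul_antipodeInv_coact (symbol b) hx)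
  rw [symbol_mul, LinearMap.comp_apply, ← h1, ← hb, map_sum symbol, LinearMap.sum_apply]
  simp only [symbol_mul, LinearMap.comp_apply, convRight_apply_of_eq hx, symbol_act, map_sum,
    LinearMap.sum_apply, eval_tmul, map_smul, Finset.mul_sum, mul_smul_comm,
    LinearMap.mulRight_apply, antipodeInv_apply, smul_eq_mul]
  rw [Finset.sum_comm]
  refine Finset.sum_congr rfl fun j _ => Finset.sum_congr rfl fun i _ => ?_
  rw [mul_comm]

end RegInf

variable (H) in
/-- The regular part of `ℓ^∞` of the dual discrete quantum group, as a Yetter–Drinfeld algebra. -/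
abbrev regYD : YDAlgebra.{u, u} H where
  carrier := RegInf H
  α := RegInf.coaction
  isAction := RegInf.isAction_coaction
  act := RegInf.act
  isDualAction := RegInf.isDualAction_act
  yetterDrinfeld := RegInf.yetterDrinfeld

end RegYD

/-! ### Poisson maps of invariant states -/

section Poisson
attribute [local irreducible] instCStarAlgebraLInf instCStarAlgebraMinTensor instCStarAlgebraRegInf
variable {H : Type u} [Ring H] [StarRing H] [HopfAlgebra ℂ H] [StarModule ℂ H]
  [CompactQuantumGroup H]

section DualAction
attribute [local instance] CStarAlgebra.spectralOrder CStarAlgebra.spectralOrderedRing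
variable {B : Type w} [CStarAlgebra B] {act : H →ₗ[ℂ] B →ₗ[ℂ] B}

lemma IsDualAction.star_act (h : IsDualAction act) (x : H) (b : B) :
    star (act x b) = act (star (antipode ℂ x)) (star b) := by
  have h1 := h.act_star (star (antipode ℂ x)) b
  rw [h1, antipode_star_antipode, star_star]

/-- The element `x₍₁₎ ⊗ (x₍₂₎ ▷ b)`. -/
def comulAct (act : H →ₗ[ℂ] B →ₗ[ℂ] B) (b : B) (x : H) : H ⊗[ℂ] B :=
  (act.flip b).lTensor H (comul (R := ℂ) x)

lemma comulAct_of_eq (b : B) {x : H} {n : ℕ} {x₁ x₂ : Fin n → H}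
    (hx : comul (R := ℂ) x = ∑ i, x₁ i ⊗ₜ[ℂ] x₂ i) :
    comulAct act b x = ∑ i, x₁ i ⊗ₜ[ℂ] act (x₂ i) b := by
  simp [comulAct, hx]

/-- Strong invariance moves the coproduct from x to y, and compatibility with the involution turns
the resulting S⁻¹ into the adjoint of y₍₂₎ ▷ a. The dependence on a*b alone gives the positivity of
Poisson maps. -/
lemma modInner_comulAct (h : IsDualAction act) (a b : B) (x y : H) :
    modInner (comulAct act a y) (comulAct act b x) =
      modInner (y ⊗ₜ[ℂ] (1 : B)) (comulAct act (star a * b) x) := by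
  obtain ⟨n, y₁, y₂, hy⟩ := exists_comul_eq_sum y
  obtain ⟨m, x₁, x₂, hx⟩ := exists_comul_eq_sum x
  choose k p q hpq using fun i => exists_comul_eq_sum (x₁ i)
  choose l s t hst using fun i => exists_comul_eq_sum (x₂ i)
  let T : H →ₗ[ℂ] H →ₗ[ℂ] H →ₗ[ℂ] B := LinearMap.mk₂ ℂ (fun p q =>
    LinearMap.mulLeft ℂ (haar H (star y * p) • act q (star a)) ∘ₗ act.flip b)
    (by intros; ext; simp [mul_add, add_smul, add_mul]) (by intros; ext; simp [mul_smul])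
    (by intros; ext; simp [add_mul]) (by intros; ext; simp [smul_smul, mul_comm])
  have h1 := sum_coassoc (trilift T) hx hpq hst
  simp only [trilift_tmul, T, LinearMap.mk₂_apply, LinearMap.comp_apply, LinearMap.mulLeft_apply,
    LinearMap.flip_apply] at h1
  have h2 : ∀ i, ∑ j, haar H (star y * p i j) • act (q i j) (star a) =
      ∑ j, haar H (star (y₁ j) * x₁ i) • star (act (y₂ j) a) := by
    intro i
    have h3 := congrArg (fun v => act v (star a))
      (haar_strong_invariance_left (comul_star_of_eq hy) (hpq i))
    simp only [map_sum, map_smul, LinearMap.sum_apply, LinearMap.smul_apply, antipodeInv_apply,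
      star_star, ← h.star_act] at h3
    exact h3
  simp only [← Finset.sum_mul, h2] at h1
  rw [comulAct_of_eq _ hy, comulAct_of_eq _ hx, comulAct_of_eq _ hx]
  simp only [modInner, star_sum, Finset.sum_mul, Finset.mul_sum, map_sum, TensorProduct.star_tmul,
    Algebra.TensorProduct.tmul_mul_tmul, slice_tmul, h.act_mul, hst, star_one, one_mul,
    TensorProduct.map_tmul, LinearMap.mul'_apply, LinearMap.flip_apply, Finset.smul_sum] at h1 ⊢
  simp only [smul_mul_assoc] at h1
  rw [← h1]

/-- The symbol `x ↦ θ(x ▷ b)`. -/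
def poissonSymbol (act : H →ₗ[ℂ] B →ₗ[ℂ] B) (θ : B →ₗ[ℂ] ℂ) (b : B) : H →ₗ[ℂ] ℂ :=
  θ ∘ₗ act.flip b

@[simp] lemma poissonSymbol_apply (θ : B →ₗ[ℂ] ℂ) (b : B) (x : H) :
    poissonSymbol act θ b x = θ (act x b) := rfl

lemma haar_poissonSymbol (h : IsDualAction act) (θ : B →ₗ[ℂ] ℂ) (a b : B) (x y : H) :
    haar H (star y * convRight (poissonSymbol act θ (star a * b)) x) =
      θ (modInner (comulAct act a y) (comulAct act b x)) := by
  rw [modInner_comulAct h]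
  obtain ⟨m, x₁, x₂, hx⟩ := exists_comul_eq_sum x
  rw [comulAct_of_eq _ hx, convRight_apply_of_eq hx]
  simp [modInner, Finset.mul_sum, mul_comm]

lemma norm_convRight_poissonSymbol_le (h : IsDualAction act) {θ : B →ₗ[ℂ] ℂ} (hθ : IsState θ)
    (b : B) (x : H) : ‖toL2 (convRight (poissonSymbol act θ b) x)‖ ≤ ‖b‖ * ‖toL2 x‖ := by
  refine abs_le_of_sq_le_sq' ?_ (by positivity) |>.2
  obtain ⟨n, e, c, he, hz⟩ := exists_orthonormal_expansion (comulAct act b x)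
  have h1 : convRight (poissonSymbol act θ b) x = ∑ i, θ (c i) • e i := by
    have h2 := congrArg (fun t => TensorProduct.rid ℂ H (θ.lTensor H t)) hz
    obtain ⟨m, x₁, x₂, hx⟩ := exists_comul_eq_sum x
    rw [comulAct_of_eq _ hx] at h2
    rw [convRight_apply_of_eq hx]
    simpa using h2
  have h3 : ‖toL2 (convRight (poissonSymbol act θ b) x)‖ ^ 2 = ∑ i, ‖θ (c i)‖ ^ 2 := by
    rw [norm_toL2_sq, h1]
    simp only [star_sum, star_smul, Finset.sum_mul, Finset.mul_sum, smul_mul_assoc, mul_smul_comm,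
      map_sum, map_smul, he, smul_eq_mul, mul_ite, mul_one, mul_zero, Finset.mem_univ, if_true, Finset.sum_ite_eq']
    rw [Complex.re_sum]
    refine Finset.sum_congr rfl fun i _ => ?_
    rw [Complex.star_def, Complex.mul_conj, Complex.ofReal_re, Complex.normSq_eq_norm_sq]
  -- The bound has two halves: the Schwarz inequality for θ on the legs, and `h5`, which compares
  -- b*b with ‖b‖² through ‖b‖² − b*b = r*r.
  have h4 : (((∑ i, ‖θ (c i)‖ ^ 2 : ℝ)) : ℂ) ≤ θ (modInner (comulAct act b x) (comulAct act b x)) := by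
    rw [hz, modInner_expansion he, map_sum, Complex.ofReal_sum]
    exact Finset.sum_le_sum fun i _ => hθ.normSq_le (c i)
  obtain ⟨r, hr⟩ := exists_norm_sq_sub_eq b
  have h5 : 0 ≤ θ (modInner (comulAct act r x) (comulAct act r x)) :=
    hθ.map_nonneg (modInner_self_nonneg _)
  have h6 : poissonSymbol act θ (1 : B) = counit := by
    ext v; simp [h.act_one, hθ.map_one]
  have h7 : poissonSymbol act θ (star r * r) = ((‖b‖ ^ 2 : ℝ) : ℂ) • counit +
      (-1 : ℂ) • poissonSymbol act θ (star b * b) := by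
    rw [← hr, ← h6]; ext v; simp [sub_eq_add_neg]
  rw [← haar_poissonSymbol h, h7, convRight_add, convRight_smul, convRight_smul, convRight_counit,
    LinearMap.id_apply, mul_add, mul_smul_comm, mul_smul_comm, map_add, map_smul, map_smul,
    haar_poissonSymbol h, haar_star_mul_self, neg_one_smul, ← sub_eq_add_neg, sub_nonneg,
    smul_eq_mul, ← Complex.ofReal_mul] at h5
  have h8 := h4.trans h5
  rw [h3, mul_pow]
  exact_mod_cast h8

/-- The Poisson map into `LInf H`. -/
lemma exists_poisson (h : IsDualAction act) {θ : B →ₗ[ℂ] ℂ} (hθ : IsState θ) (b : B) :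
    ∃ T : LInf H, LInf.sym T = poissonSymbol act θ b ∧ ‖T‖ ≤ ‖b‖ :=
  LInf.exists_sym_eq _ (norm_nonneg _) (norm_convRight_poissonSymbol_le h hθ b)

end DualAction

/-- A state that is invariant under the action of `G`. -/
structure IsInvariantState (B : YDAlgebra.{u, w} H) (θ : B →ₗ[ℂ] ℂ) : Prop where
  isState : IsState θ
  invariant : ∀ (b : B) (x : H), θ (B.dualAct b x) = haar H x * θ b

variable {B : YDAlgebra.{u, w} H}

lemma YDAlgebra.exists_expansion {b : B} (hb : B.IsRegular b) : ∃ (n : ℕ) (e : Fin n → H)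
    (c : Fin n → B), B.α b = ofAlg (∑ i, e i ⊗ₜ[ℂ] c i) := by
  obtain ⟨z, hz⟩ := hb
  obtain ⟨n, e, c, -, rfl⟩ := exists_orthonormal_expansion z
  exact ⟨n, e, c, hz⟩

lemma YDAlgebra.dense_isRegular (B : YDAlgebra.{u, w} H) : Dense {b : B | B.IsRegular b} := by
  refine B.isAction.dense_minSlice.mono ?_
  intro b hb
  refine Submodule.span_induction (p := fun b _ => B.IsRegular b) ?_ ?_ ?_ ?_ hb
  · rintro _ ⟨x, c, rfl⟩
    obtain ⟨n, x₁, x₂, hx⟩ := exists_comul_eq_sum x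
    exact ⟨_, B.isAction.apply_minSlice c hx⟩
  · exact ⟨0, by rw [map_zero, map_zero]⟩
  · rintro x y - - ⟨z, hz⟩ ⟨w, hw⟩
    exact ⟨z + w, by rw [map_add, map_add, hz, hw]⟩
  · rintro r x - ⟨z, hz⟩
    exact ⟨r • z, by rw [map_smul, map_smul, hz]⟩

variable {θ : B →ₗ[ℂ] ℂ}

/-- Invariance is assumed only after pairing with h(· x); faithfulness of h upgrades it to (ι ⊗
θ)α(b) = θ(b)1. -/
lemma IsInvariantState.apply_of_eq (hθ : IsInvariantState B θ) {b : B} {n : ℕ} {e : Fin n → H}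
    {c : Fin n → B} (hb : B.α b = ofAlg (∑ i, e i ⊗ₜ[ℂ] c i)) :
    ∑ i, θ (c i) • e i = θ b • (1 : H) := by
  rw [← sub_eq_zero]
  apply eq_zero_of_haar_mul_eq_zero
  intro x
  have h1 := hθ.invariant b x
  rw [YDAlgebra.dualAct, hb] at h1
  simp only [map_sum, minSlice_ofAlg, map_smul, smul_eq_mul] at h1
  simp only [sub_mul, Finset.sum_mul, smul_mul_assoc, one_mul, map_sub, map_sum, map_smul,
    smul_eq_mul]
  rw [sub_eq_zero, mul_comm, ← h1]
  exact Finset.sum_congr rfl fun i _ => mul_comm _ _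

/-- Here the Yetter–Drinfeld condition enters: it makes the Poisson map G-equivariant and sends
regular elements to regular ones. -/
lemma IsInvariantState.coact_poissonSymbol (hθ : IsInvariantState B θ) {b : B} {n : ℕ}
    {e : Fin n → H} {c : Fin n → B} (hb : B.α b = ofAlg (∑ i, e i ⊗ₜ[ℂ] c i)) (v : H) :
    coact (poissonSymbol B.act θ b) v = ∑ i, θ (B.act v (c i)) • e i := by
  let E : H →ₗ[ℂ] H := ∑ i, (poissonSymbol B.act θ (c i)).smulRight (e i)
  -- Applying ι ⊗ θ to the Yetter–Drinfeld condition gives x₍₁₎E(x₍₂₎)S(x₍₃₎) = θ(x ▷ b)1.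
  -- Convolving with S on the left and id on the right then solves for E.
  have h1 : conv LinearMap.id (conv E (antipode ℂ)) = scalar H (poissonSymbol B.act θ b) := by
    ext x
    obtain ⟨m, x₁, x₂, hx⟩ := exists_comul_eq_sum x
    choose k p q hpq using fun i => exists_comul_eq_sum (x₂ i)
    have h2 : (comul (R := ℂ)).lTensor H (comul (R := ℂ) x) =
        ∑ i : Fin (∑ i, k i), x₁ (finSigmaFinEquiv.symm i).1 ⊗ₜ[ℂ]
          (p (finSigmaFinEquiv.symm i).1 (finSigmaFinEquiv.symm i).2 ⊗ₜ[ℂ]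
          q (finSigmaFinEquiv.symm i).1 (finSigmaFinEquiv.symm i).2) := by
      rw [finSigmaFinEquiv.symm.sum_comp (fun j : (i : Fin m) × Fin (k i) =>
        x₁ j.1 ⊗ₜ[ℂ] (p j.1 j.2 ⊗ₜ[ℂ] q j.1 j.2)), Fintype.sum_sigma, hx]
      simp [hpq, TensorProduct.tmul_sum]
    have h3 := B.yetterDrinfeld x b _ _ _ _ n e c h2 hb
    rw [← Fintype.sum_prod_type' (f := fun i j => (x₁ (finSigmaFinEquiv.symm i).1 * e j *
      antipode ℂ (q (finSigmaFinEquiv.symm i).1 (finSigmaFinEquiv.symm i).2)) ⊗ₜ[ℂ]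
      B.act (p (finSigmaFinEquiv.symm i).1 (finSigmaFinEquiv.symm i).2) (c j)),
      ← Fintype.equivFin _ |>.symm.sum_comp] at h3
    have h4 := hθ.apply_of_eq h3
    rw [scalar_apply, poissonSymbol_apply, ← h4, conv_conv_apply_of_eq h2,
      (Fintype.equivFin _).symm.sum_comp (fun i : Fin (∑ i, k i) × Fin n =>
        θ (B.act (p (finSigmaFinEquiv.symm i.1).1 (finSigmaFinEquiv.symm i.1).2) (c i.2)) •
        (x₁ (finSigmaFinEquiv.symm i.1).1 * e i.2 *
          antipode ℂ (q (finSigmaFinEquiv.symm i.1).1 (finSigmaFinEquiv.symm i.1).2))),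
      Fintype.sum_prod_type]
    refine Finset.sum_congr rfl fun i _ => ?_
    simp [E, LinearMap.sum_apply, Finset.sum_mul, Finset.mul_sum, mul_assoc]
  have h5 : coact (poissonSymbol B.act θ b) = E := by
    rw [coact, ← h1, ← conv_assoc, ← conv_assoc, antipode_conv_id, counit_conv, conv_assoc,
      antipode_conv_id, conv_counit]
  rw [h5]
  simp [E, LinearMap.sum_apply]

/-- The Poisson map of an invariant state, `b ↦ θ(· ▷ b)`. -/
lemma IsInvariantState.exists_poissonMap (hθ : IsInvariantState B θ) :
    ∃ P : B →ₗ[ℂ] RegInf H, IsUCP P ∧ YDAlgebra.IsEquivariant (A := B) (B := regYD H) P ∧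
      ∀ b, RegInf.symbol (P b) = poissonSymbol B.act θ b := by
  choose P₀ hP₀ hn using exists_poisson B.isDualAction hθ.isState
  let P₁ : B →ₗ[ℂ] LInf H :=
    { toFun := P₀
      map_add' := fun a b => LInf.sym_injective (by
        rw [map_add, hP₀, hP₀, hP₀]; ext; simp)
      map_smul' := fun r b => LInf.sym_injective (by
        rw [map_smul, hP₀, hP₀]; ext; simp) }
  have hP₁ : ∀ b, LInf.sym (P₁ b) = poissonSymbol B.act θ b := hP₀
  have hc : Continuous P₁ := AddMonoidHomClass.continuous_of_bound P₁ 1 fun b => by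
    rw [one_mul]; exact hn b
  have hreg : ∀ b, B.IsRegular b → P₁ b ∈ LInf.regular H := by
    intro b hb
    obtain ⟨n, e, c, hb⟩ := YDAlgebra.exists_expansion hb
    refine ⟨∑ i, e i ⊗ₜ[ℂ] P₁ (c i), ?_⟩
    ext v
    rw [hP₁, hθ.coact_poissonSymbol hb]
    simp [LinearMap.sum_apply, hP₁]
  have hex : ∀ b, ∃ T : RegInf H, RegInf.incl T = P₁ b := fun b =>
    RegInf.exists_incl_eq (map_mem_closure hc (B.dense_isRegular b) hreg)
  choose P₂ hP₂ using hex
  let P : B →ₗ[ℂ] RegInf H :=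
    { toFun := P₂
      map_add' := fun a b => RegInf.incl_injective (by
        rw [map_add, hP₂, hP₂, hP₂, map_add])
      map_smul' := fun r b => RegInf.incl_injective (by
        rw [map_smul, hP₂, hP₂, map_smul]; rfl) }
  have hP : ∀ b, RegInf.symbol (P b) = poissonSymbol B.act θ b := fun b => by
    rw [RegInf.symbol_def, ← hP₁, ← hP₂]; rfl
  have hucp : IsUCP P := by
    rw [isUCP_iff]
    constructor
    · apply RegInf.symbol_injective
      rw [hP, RegInf.symbol_one]
      ext v; simp [B.isDualAction.act_one, hθ.isState.map_one]
    · intro n a b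
      refine LInf.nonneg_of_haar RegInf.incl RegInf.incl_injective fun v => ?_
      -- With bᵢ acting as operators on L²(G), the quadratic form to be estimated is θ(⟨Z, Z⟩) for
      -- this single vector Z.
      set Z := ∑ i, comulAct B.act (a i) (convRight (RegInf.symbol (b i)) v) with hZ
      have h1 : haar H (star v * convRight (RegInf.symbol
          (∑ i, ∑ j, star (b i) * P (star (a i) * a j) * b j)) v) = θ (modInner Z Z) := by
        have e2 : ∀ (s : Fin n → H ⊗[ℂ] B) t, modInner (∑ j, s j) t = ∑ j, modInner (s j) t := by
          intro s t; simp [modInner, star_sum, Finset.sum_mul]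
        have e3 : ∀ (s : Fin n → H ⊗[ℂ] B) t, modInner t (∑ j, s j) = ∑ j, modInner t (s j) := by
          intro s t; simp [modInner, Finset.mul_sum]
        have e4 : ∀ {ι : Type} (s : Finset ι) (f : ι → H →ₗ[ℂ] ℂ) x,
            convRight (∑ i ∈ s, f i) x = ∑ i ∈ s, convRight (f i) x := by
          intro ι s f x
          obtain ⟨m, x₁, x₂, hx⟩ := exists_comul_eq_sum x
          simp only [convRight_apply_of_eq hx, LinearMap.sum_apply, Finset.sum_smul]
          rw [Finset.sum_comm]
        simp only [map_sum, e4, Finset.mul_sum, hZ, e2, e3]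
        refine Finset.sum_congr rfl fun i _ => Finset.sum_congr rfl fun j _ => ?_
        rw [← haar_poissonSymbol B.isDualAction, ← hP, mul_assoc]
        have h2 := LInf.haar_star_mul_convRight (RegInf.incl (b i))
          (RegInf.incl (P (star (a i) * a j) * b j)) v v
        rw [← StarHomClass.map_star, ← map_mul] at h2
        refine h2.trans ?_
        rw [map_mul RegInf.incl, LInf.sym_mul, ← convRight_comp]
        rfl
      have h3 : 0 ≤ θ (modInner Z Z) := hθ.isState.map_nonneg (modInner_self_nonneg _)
      refine ⟨(θ (modInner Z Z)).re, (Complex.nonneg_iff.mp h3).1, ?_⟩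
      refine h1.trans ?_
      apply Complex.ext
      · simp
      · simpa using (Complex.nonneg_iff.mp h3).2.symm
  refine ⟨P, hucp, ⟨fun b x => ?_, fun x b => ?_⟩, hP⟩
  · change P (minSlice x (B.α b)) = minSlice x (RegInf.coaction (P b))
    have hcα := continuous_starAlgHom B.α
    have hcβ := continuous_starAlgHom (RegInf.coaction (H := H))
    refine (B.dense_isRegular).induction (P := fun b => P (minSlice x (B.α b)) =
      minSlice x (RegInf.coaction (P b))) ?_ (isClosed_eq ?_ ?_) b
    · intro b hb
      obtain ⟨n, e, c, hb⟩ := YDAlgebra.exists_expansion hb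
      apply RegInf.symbol_injective
      ext v
      rw [RegInf.symbol_minSlice, hP, hP, hθ.coact_poissonSymbol hb, hb]
      simp [minSlice_ofAlg, Finset.sum_mul, mul_comm]
    · exact hucp.continuous.comp ((minSlice x).continuous.comp hcα)
    · exact (minSlice x).continuous.comp (hcβ.comp hucp.continuous)
  · change P (B.act x b) = RegInf.act x (P b)
    apply RegInf.symbol_injective
    rw [RegInf.symbol_act, hP, hP]
    ext v
    simp [B.isDualAction.mul_act]

end Poisson
end
end QG

namespace QG
noncomputable section
open scoped TensorProduct ComplexOrder CStarAlgebra
open Coalgebra HopfAlgebra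

/-! ### Equivariant maps to `regYD H` as invariant states, and injectivity -/

section Isometry
attribute [local instance] CStarAlgebra.spectralOrder CStarAlgebra.spectralOrderedRing
variable {A : Type v} {B : Type w} [CStarAlgebra A] [CStarAlgebra B]

lemma norm_le_of_isCompletelyIsometric {φ : A →ₗ[ℂ] B} (hφ : IsCompletelyIsometric φ) (a : A) :
    ‖a‖ ≤ ‖φ a‖ := by
  let f : B →⋆ₐ[ℂ] CStarMatrix (Fin 1) (Fin 1) B :=
    { toFun := fun b => CStarMatrix.ofMatrix (fun _ _ => b)
      map_one' := by ext i j; simp [CStarMatrix.one_apply, Subsingleton.elim i j]; rfl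
      map_mul' := fun x y => by ext i j; simp [CStarMatrix.mul_apply]; rfl
      map_zero' := by ext i j; rfl
      map_add' := fun x y => by ext i j; rfl
      commutes' := fun r => by
        ext i j; simp [CStarMatrix.algebraMap_apply, Subsingleton.elim i j]; rfl
      map_star' := fun x => by ext i j; rfl }
  let M : CStarMatrix (Fin 1) (Fin 1) A := CStarMatrix.ofMatrix (fun _ _ => a)
  calc ‖a‖ = ‖M 0 0‖ := rfl
    _ ≤ ‖M‖ := CStarMatrix.norm_entry_le_norm
    _ = ‖M.map φ‖ := (hφ 1 M).symm
    _ = ‖(f : B →ₗ[ℂ] CStarMatrix (Fin 1) (Fin 1) B) (φ a)‖ := rfl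
    _ ≤ ‖φ a‖ := (IsUCP.of_starAlgHom f).norm_le _

/-- A state extends along a completely isometric ucp map. -/
lemma IsState.exists_comp_eq {φ : A →ₗ[ℂ] B} (h1 : φ 1 = 1) (hφ : IsCompletelyIsometric φ)
    {θ : A →ₗ[ℂ] ℂ} (hθ : IsState θ) : ∃ s : B →ₗ[ℂ] ℂ, IsState s ∧ s ∘ₗ φ = θ := by
  have hle := norm_le_of_isCompletelyIsometric hφ
  have hinj : Function.Injective φ := by
    rw [injective_iff_map_eq_zero]
    intro a ha
    have := hle a
    rw [ha, norm_zero] at this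
    exact norm_le_zero_iff.mp this
  let e := LinearEquiv.ofInjective φ hinj
  have he : ∀ a, (e.symm ⟨φ a, LinearMap.mem_range_self φ a⟩) = a := fun a => by
    rw [LinearEquiv.symm_apply_eq]; rfl
  -- On the range of φ the state is transported by the inverse of φ, which is contractive because φ
  -- is isometric.
  obtain ⟨s, hs, hs'⟩ := IsState.exists_extension (LinearMap.range φ) (θ ∘ₗ e.symm.toLinearMap)
    ⟨1, h1⟩ (by
      have : (⟨1, ⟨1, h1⟩⟩ : LinearMap.range φ) = ⟨φ 1, LinearMap.mem_range_self φ 1⟩ :=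
        Subtype.ext h1.symm
      rw [this, LinearMap.comp_apply, LinearEquiv.coe_coe, he, hθ.map_one]) (by
      rintro ⟨_, a, rfl⟩
      rw [LinearMap.comp_apply, LinearEquiv.coe_coe, he]
      exact (hθ.norm_le a).trans (hle a))
  refine ⟨s, hs, LinearMap.ext fun a => ?_⟩
  have := hs' ⟨φ a, LinearMap.mem_range_self φ a⟩
  rw [LinearMap.comp_apply, LinearEquiv.coe_coe, he] at this
  exact this

end Isometry

section UnitSymbol
variable {H : Type u} [Ring H] [HopfAlgebra ℂ H]

lemma comul_one_eq_sum : comul (R := ℂ) (1 : H) = ∑ _i : Fin 1, (1 : H) ⊗ₜ[ℂ] (1 : H) := by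
  simp [Algebra.TensorProduct.one_def]

lemma convRight_one (f : H →ₗ[ℂ] ℂ) : convRight f 1 = f 1 • (1 : H) := by
  rw [convRight_apply_of_eq comul_one_eq_sum]; simp

lemma coact_one (f : H →ₗ[ℂ] ℂ) : coact f 1 = f 1 • (1 : H) := by
  rw [coact, conv_apply_of_eq comul_one_eq_sum, conv_apply_of_eq comul_one_eq_sum]; simp

end UnitSymbol

section Extension
attribute [local irreducible] instCStarAlgebraLInf instCStarAlgebraMinTensor instCStarAlgebraRegInf
variable {H : Type u} [Ring H] [StarRing H] [HopfAlgebra ℂ H] [StarModule ℂ H]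
  [CompactQuantumGroup H]

namespace RegInf

variable (H) in
/-- The value of the symbol at the unit. -/
def evalOne : RegInf H →ₗ[ℂ] ℂ := (symbol (H := H)).flip 1

@[simp] lemma evalOne_apply (T : RegInf H) : evalOne H T = symbol T 1 := rfl

/-- It is the vector state of 1 ∈ L²(G), that is, the counit of the dual quantum group; invariance
holds because `coact f` takes the value f(1)1 at 1. -/
lemma isInvariantState_evalOne : IsInvariantState (regYD H) (evalOne H) where
  isState :=
    { map_one := by rw [evalOne_apply, symbol_one]; simp
      nonneg := fun T => by
        have h1 := LInf.haar_star_mul_convRight (incl T) (incl T) (1 : H) 1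
        rw [← StarHomClass.map_star, ← map_mul, convRight_one, star_one, one_mul, map_smul,
          (haar_spec H).map_one, smul_eq_mul, mul_one] at h1
        have h2 : evalOne H (star T * T) = _ := h1
        rw [h2]
        exact (haar_spec H).nonneg _ }
  invariant T x := by
    change symbol (minSlice x (coaction T)) 1 = _
    rw [symbol_minSlice, coact_one, smul_mul_assoc, one_mul, map_smul, smul_eq_mul, mul_comm]
    rfl

end RegInf

variable {B : YDAlgebra.{u, w} H} {C : YDAlgebra.{u, v} H}

namespace YDAlgebra

lemma IsEquivariant.comp {D : YDAlgebra H} {φ : B →ₗ[ℂ] C} {ψ : C →ₗ[ℂ] D}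
    (hψ : IsEquivariant ψ) (hφ : IsEquivariant φ) : IsEquivariant (A := B) (B := D) (ψ ∘ₗ φ) where
  map_dualAct a x := by
    rw [LinearMap.comp_apply, hφ.map_dualAct, hψ.map_dualAct]; rfl
  map_act x a := by
    rw [LinearMap.comp_apply, hφ.map_act, hψ.map_act]; rfl

lemma IsEquivariant.id : IsEquivariant (A := B) (B := B) LinearMap.id where
  map_dualAct _ _ := rfl
  map_act _ _ := rfl

end YDAlgebra

open YDAlgebra

lemma IsInvariantState.comp {θ : C →ₗ[ℂ] ℂ} (hθ : IsInvariantState C θ) {φ : B →ₗ[ℂ] C}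
    (hφ : IsUCP φ) (hφ' : IsEquivariant φ) : IsInvariantState B (θ ∘ₗ φ) where
  isState := hθ.isState.comp hφ
  invariant b x := by
    rw [LinearMap.comp_apply, hφ'.map_dualAct, hθ.invariant]; rfl

/-- Since v ▷ shifts the symbol by v, evaluation at 1 after acting by v is evaluation at v. So φ is
determined by the state `evalOne H ∘ₗ φ`. -/
lemma symbol_apply_of_isEquivariant {φ : B →ₗ[ℂ] RegInf H}
    (hφ : IsEquivariant (A := B) (B := regYD H) φ) (b : B) (v : H) :
    RegInf.symbol (φ b) v = RegInf.evalOne H (φ (B.act v b)) := by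
  have h : φ (B.act v b) = RegInf.act v (φ b) := hφ.map_act v b
  rw [h, RegInf.evalOne_apply, RegInf.symbol_act]
  simp

lemma eq_of_evalOne_comp_eq {φ ψ : B →ₗ[ℂ] RegInf H}
    (hφ : IsEquivariant (A := B) (B := regYD H) φ) (hψ : IsEquivariant (A := B) (B := regYD H) ψ)
    (h : RegInf.evalOne H ∘ₗ φ = RegInf.evalOne H ∘ₗ ψ) : φ = ψ := by
  refine LinearMap.ext fun b => RegInf.symbol_injective (LinearMap.ext fun v => ?_)
  rw [symbol_apply_of_isEquivariant hφ, symbol_apply_of_isEquivariant hψ]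
  exact LinearMap.congr_fun h _

/-- Every invariant state comes from an equivariant ucp map to `regYD H`. -/
lemma IsInvariantState.exists_evalOne_comp_eq {θ : B →ₗ[ℂ] ℂ} (hθ : IsInvariantState B θ) :
    ∃ P : B →ₗ[ℂ] RegInf H, IsUCP P ∧ IsEquivariant (A := B) (B := regYD H) P ∧
      RegInf.evalOne H ∘ₗ P = θ := by
  obtain ⟨P, h1, h2, h3⟩ := hθ.exists_poissonMap
  refine ⟨P, h1, h2, LinearMap.ext fun b => ?_⟩
  rw [LinearMap.comp_apply, RegInf.evalOne_apply, h3, poissonSymbol_apply, B.isDualAction.one_act]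

lemma exists_isUCP_isEquivariant_regYD (B : YDAlgebra.{u, w} H) :
    ∃ P : B →ₗ[ℂ] RegInf H, IsUCP P ∧ IsEquivariant (A := B) (B := regYD H) P := by
  obtain ⟨s, hs⟩ := exists_isState (A := B)
  obtain ⟨θ, h1, h2, -⟩ := B.isAction.exists_invariant_state hs
  obtain ⟨P, h3, h4, -⟩ := IsInvariantState.exists_poissonMap (B := B) (θ := θ) ⟨h1, h2⟩
  exact ⟨P, h3, h4⟩

/-- `regYD H` is injective with respect to algebras in arbitrary universes. -/
lemma regYD_exists_extension {φ : B →ₗ[ℂ] C} {ψ : B →ₗ[ℂ] RegInf H} (hφ : IsUCP φ)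
    (hφ' : IsEquivariant φ) (hi : IsCompletelyIsometric φ) (hψ : IsUCP ψ)
    (hψ' : IsEquivariant (A := B) (B := regYD H) ψ) :
    ∃ ψ' : C →ₗ[ℂ] RegInf H, IsUCP ψ' ∧ IsEquivariant (A := C) (B := regYD H) ψ' ∧
      ψ' ∘ₗ φ = ψ := by
  have hθ := RegInf.isInvariantState_evalOne.comp hψ hψ'
  obtain ⟨s, hs, hsφ⟩ := hθ.isState.exists_comp_eq hφ.1 hi
  obtain ⟨θ, h1, h2, h3⟩ := C.isAction.exists_invariant_state hs
  obtain ⟨P, h4, h5, h6⟩ := IsInvariantState.exists_evalOne_comp_eq (B := C) (θ := θ) ⟨h1, h2⟩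
  refine ⟨P, h4, h5, eq_of_evalOne_comp_eq (h5.comp hφ') hψ' (LinearMap.ext fun b => ?_)⟩
  rw [← LinearMap.comp_assoc, h6, LinearMap.comp_apply, h3]
  -- Averaging s does not change it on φ(B): equivariance moves the slice into B, where s ∘ φ is
  -- already invariant.
  have e1 : minSlice (1 : H) (C.α (φ b)) = φ (B.dualAct b 1) := (hφ'.map_dualAct b 1).symm
  have e2 := LinearMap.congr_fun hsφ (B.dualAct b 1)
  rw [e1]
  refine e2.trans ((hθ.invariant b 1).trans ?_)
  rw [(haar_spec H).map_one, one_mul]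

end Extension
end
end QG

namespace QG
noncomputable section
open scoped TensorProduct ComplexOrder CStarAlgebra
open Coalgebra HopfAlgebra

/-! ### The compact monoid of equivariant self-maps and a minimal idempotent -/

/-- In a compact right topological monoid in which every element has a fixed point for right
multiplication, there is an element `p` with `p s p = p` for all `s`. -/
lemma exists_mul_mul_eq_self {M : Type*} [Monoid M] [TopologicalSpace M] [CompactSpace M]
    [T2Space M] (hM : ∀ r : M, Continuous (· * r)) (hfix : ∀ r : M, ∃ c : M, c * r = c) :
    ∃ p : M, ∀ s, p * s * p = p := by
  -- Nonempty closed left ideals; by compactness a minimal one exists.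
  let S : Set (Set M) := {N | IsClosed N ∧ N.Nonempty ∧ ∀ m, ∀ n ∈ N, m * n ∈ N}
  obtain ⟨L, hL⟩ : ∃ L, Minimal (· ∈ S) L := by
    refine zorn_superset _ fun c hcs hc => ?_
    refine ⟨⋂₀ c, ⟨isClosed_sInter fun t ht => (hcs ht).1, ?_, fun m n hn => ?_⟩, fun s hs =>
      Set.sInter_subset_of_mem hs⟩
    · obtain rfl | hne := c.eq_empty_or_nonempty
      · rw [Set.sInter_empty]
        exact Set.univ_nonempty
      have : Nonempty c := hne.coe_sort
      rw [Set.sInter_eq_iInter]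
      exact IsCompact.nonempty_iInter_of_directed_nonempty_isCompact_isClosed ((↑) : c → Set M)
        (DirectedOn.directed_val (IsChain.directedOn hc.symm)) (fun i => (hcs i.prop).2.1)
        (fun i => (hcs i.prop).1.isCompact) (fun i => (hcs i.prop).1)
    · rw [Set.mem_sInter] at hn ⊢
      exact fun t ht => (hcs ht).2.2 m n (hn t ht)
  obtain ⟨hcl, ⟨p, hp⟩, hmul⟩ := hL.prop
  refine ⟨p, fun s => ?_⟩
  -- As c = c(sp), it lies in the ideal L, so Mc = L by minimality and p = tc. Then psp = tc(sp) =
  -- tc = p.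
  obtain ⟨c, hc⟩ := hfix (s * p)
  have hcL : c ∈ L := by
    rw [← hc]
    exact hmul _ _ (hmul _ _ hp)
  have h1 : Set.range (· * c) = L := by
    refine hL.eq_of_subset ⟨(isCompact_range (hM c)).isClosed, ⟨_, 1, rfl⟩, ?_⟩ ?_
    · rintro m _ ⟨n, rfl⟩
      exact ⟨m * n, mul_assoc _ _ _⟩
    · rintro _ ⟨n, rfl⟩
      exact hmul _ _ hcL
  obtain ⟨t, ht⟩ : p ∈ Set.range (· * c) := h1 ▸ hp
  have ht' : t * c = p := ht
  rw [mul_assoc]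
  nth_rewrite 1 [← ht']
  rw [mul_assoc, hc, ht']

section Semigroup
attribute [local irreducible] instCStarAlgebraLInf instCStarAlgebraMinTensor instCStarAlgebraRegInf
variable {H : Type u} [Ring H] [StarRing H] [HopfAlgebra ℂ H] [StarModule ℂ H]
  [CompactQuantumGroup H]

open YDAlgebra

/-- The invariant states of `B`, as functions. -/
def invariantStates (B : YDAlgebra.{u, w} H) : Set (B → ℂ) :=
  {g | ∃ θ : B →ₗ[ℂ] ℂ, IsInvariantState B θ ∧ g = θ}

/-- Banach–Alaoglu through Tychonoff: `IsState.of_contractive` makes positivity a consequence of the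
norm bounds, which leaves closed conditions inside a product of discs. -/
lemma isCompact_invariantStates (B : YDAlgebra.{u, w} H) : IsCompact (invariantStates B) := by
  have h : invariantStates B = {g : B → ℂ | (∀ b, g b ∈ Metric.closedBall (0 : ℂ) ‖b‖) ∧
      (∀ a b, g (a + b) = g a + g b) ∧ (∀ (r : ℂ) b, g (r • b) = r • g b) ∧ g 1 = 1 ∧
      ∀ b x, g (B.dualAct b x) = haar H x * g b} := by
    ext g
    constructor
    · rintro ⟨θ, hθ, rfl⟩
      exact ⟨fun b => by simpa using hθ.isState.norm_le b, map_add θ, map_smul θ,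
        hθ.isState.map_one, hθ.invariant⟩
    · rintro ⟨h1, h2, h3, h4, h5⟩
      exact ⟨⟨⟨g, h2⟩, h3⟩, ⟨IsState.of_contractive h4 fun b => by simpa using h1 b, h5⟩, rfl⟩
  rw [h]
  refine IsCompact.of_isClosed_subset (isCompact_univ_pi fun b : B =>
    isCompact_closedBall (0 : ℂ) ‖b‖) ?_ fun g hg b _ => hg.1 b
  simp only [Set.ofPred_and, Set.ofPred_forall]
  have hc : ∀ b : B, Continuous fun g : B → ℂ => g b := fun b => continuous_apply b
  refine (isClosed_iInter fun b => Metric.isClosed_closedBall.preimage (hc b)).inter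
    ((isClosed_iInter fun a => isClosed_iInter fun b =>
      isClosed_eq (hc _) ((hc _).add (hc _))).inter
    ((isClosed_iInter fun r => isClosed_iInter fun b =>
      isClosed_eq (hc _) ((hc _).const_smul r)).inter
    ((isClosed_eq (hc _) continuous_const).inter
    (isClosed_iInter fun b => isClosed_iInter fun x =>
      isClosed_eq (hc _) (continuous_const.mul (hc _))))))

/-- An equivariant ucp map has an invariant state that it fixes. -/
lemma IsInvariantState.exists_comp_eq_self {B : YDAlgebra.{u, w} H} {θ : B →ₗ[ℂ] ℂ}
    (hθ : IsInvariantState B θ) {φ : B →ₗ[ℂ] B} (hφ : IsUCP φ) (hφ' : IsEquivariant φ) :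
    ∃ η : B →ₗ[ℂ] ℂ, IsInvariantState B η ∧ η ∘ₗ φ = η := by
  have hpow : ∀ k : ℕ, IsInvariantState B (θ ∘ₗ φ ^ k) := by
    intro k
    induction k with
    | zero => rw [pow_zero]; exact hθ
    | succ k ih =>
      have := ih.comp hφ hφ'
      rwa [LinearMap.comp_assoc, ← Module.End.mul_eq_comp, ← pow_succ] at this
  -- Cesàro means of the orbit of θ. A limit along an ultrafilter is fixed by φ, since c n ∘ φ − c n
  -- telescopes to size at most 2‖b‖/(n+1) at b.
  let c : ℕ → B →ₗ[ℂ] ℂ := fun n => ((n + 1 : ℕ) : ℂ)⁻¹ • ∑ k ∈ Finset.range (n + 1), θ ∘ₗ φ ^ k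
  have hc : ∀ n b, c n b = ((n + 1 : ℕ) : ℂ)⁻¹ * ∑ k ∈ Finset.range (n + 1), θ ((φ ^ k) b) := by
    intro n b; simp [c, LinearMap.sum_apply]
  have hcs : ∀ n, IsInvariantState B (c n) := by
    intro n
    have hn : ((n + 1 : ℕ) : ℂ) ≠ 0 := Nat.cast_ne_zero.mpr n.succ_ne_zero
    refine ⟨⟨?_, fun a => ?_⟩, fun b x => ?_⟩
    · have h1 : ∀ k, θ ((φ ^ k) 1) = 1 := fun k => (hpow k).isState.map_one
      rw [hc]
      simp only [h1, Finset.sum_const, Finset.card_range, nsmul_eq_mul, mul_one]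
      exact inv_mul_cancel₀ hn
    · rw [hc]
      refine mul_nonneg ?_ (Finset.sum_nonneg fun k _ => (hpow k).isState.nonneg a)
      have : (((n + 1 : ℕ) : ℂ))⁻¹ = (((((n + 1 : ℕ) : ℝ))⁻¹ : ℝ) : ℂ) := by push_cast; rfl
      rw [this]
      exact Complex.zero_le_real.mpr (by positivity)
    · have h1 : ∀ k, θ ((φ ^ k) (B.dualAct b x)) = haar H x * θ ((φ ^ k) b) :=
        fun k => (hpow k).invariant b x
      rw [hc, hc]
      simp only [h1]
      rw [← Finset.mul_sum]
      ring
  have hcomp : IsCompact (invariantStates B) := isCompact_invariantStates B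
  obtain ⟨g, ⟨η, hη, rfl⟩, hlim⟩ := hcomp.ultrafilter_le_nhds
    ((Filter.hyperfilter ℕ).map fun n => (c n : B → ℂ)) (by
      rw [Filter.le_principal_iff]
      exact Filter.mem_map.mpr (Filter.univ_mem' fun n => ⟨c n, hcs n, rfl⟩))
  have ht : Filter.Tendsto (fun n => (c n : B → ℂ)) (Filter.hyperfilter ℕ) (nhds η) := hlim
  rw [tendsto_pi_nhds] at ht
  refine ⟨η, hη, LinearMap.ext fun b => sub_eq_zero.mp ?_⟩
  refine tendsto_nhds_unique ((ht (φ b)).sub (ht b)) ?_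
  have hle : (Filter.hyperfilter ℕ : Filter ℕ) ≤ Filter.atTop := by
    rw [← Nat.cofinite_eq_atTop]; exact Filter.hyperfilter_le_cofinite
  refine Filter.Tendsto.mono_left ?_ hle
  have hz : Filter.Tendsto (fun n : ℕ => 2 * ‖b‖ * (1 / ((n : ℝ) + 1))) Filter.atTop (nhds 0) := by
    simpa using tendsto_one_div_add_atTop_nhds_zero_nat.const_mul (2 * ‖b‖)
  refine squeeze_zero_norm (fun n => ?_) hz
  have h1 : c n (φ b) - c n b = ((n + 1 : ℕ) : ℂ)⁻¹ * (θ ((φ ^ (n + 1)) b) - θ b) := by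
    rw [hc, hc, ← mul_sub, ← Finset.sum_sub_distrib]
    have : ∀ k, θ ((φ ^ k) (φ b)) = θ ((φ ^ (k + 1)) b) := fun k => by
      rw [pow_succ]; rfl
    simp only [this]
    rw [Finset.sum_range_sub (fun k => θ ((φ ^ k) b))]
    rfl
  rw [h1, norm_mul, norm_inv, Complex.norm_natCast, mul_comm, one_div]
  push_cast
  refine mul_le_mul_of_nonneg_right ?_ (by positivity)
  calc ‖θ ((φ ^ (n + 1)) b) - θ b‖ ≤ ‖θ ((φ ^ (n + 1)) b)‖ + ‖θ b‖ := norm_sub_le _ _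
    _ ≤ ‖b‖ + ‖b‖ := add_le_add ((hpow (n + 1)).isState.norm_le b) (hθ.isState.norm_le b)
    _ = 2 * ‖b‖ := by ring

variable (H) in
/-- The equivariant ucp maps of `regYD H` to itself. -/
def RegEnd : Type u :=
  {φ : RegInf H →ₗ[ℂ] RegInf H // IsUCP φ ∧ IsEquivariant (A := regYD H) (B := regYD H) φ}

instance : Monoid (RegEnd H) where
  mul φ ψ := ⟨φ.1 ∘ₗ ψ.1, φ.2.1.comp ψ.2.1, φ.2.2.comp ψ.2.2⟩
  mul_assoc _ _ _ := rfl
  one := ⟨LinearMap.id, IsUCP.id, IsEquivariant.id⟩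
  one_mul _ := rfl
  mul_one _ := rfl

/-- The invariant state that determines an equivariant ucp map. -/
def RegEnd.state (φ : RegEnd H) : RegInf H → ℂ := fun b => RegInf.evalOne H (φ.1 b)

lemma RegEnd.state_injective : Function.Injective (RegEnd.state (H := H)) := fun φ ψ h =>
  Subtype.ext (eq_of_evalOne_comp_eq φ.2.2 ψ.2.2 (LinearMap.ext fun b => congrFun h b))

/-- Poisson maps give surjectivity onto the invariant states; compactness of the monoid is inherited
from them. -/
lemma RegEnd.range_state : Set.range (RegEnd.state (H := H)) = invariantStates (regYD H) := by
  ext g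
  constructor
  · rintro ⟨φ, rfl⟩
    exact ⟨_, RegInf.isInvariantState_evalOne.comp φ.2.1 φ.2.2, rfl⟩
  · rintro ⟨θ, hθ, rfl⟩
    obtain ⟨P, h1, h2, h3⟩ := hθ.exists_evalOne_comp_eq
    exact ⟨⟨P, h1, h2⟩, funext fun b => LinearMap.congr_fun h3 b⟩

instance : TopologicalSpace (RegEnd H) := TopologicalSpace.induced RegEnd.state inferInstance

lemma RegEnd.isInducing_state : Topology.IsInducing (RegEnd.state (H := H)) := ⟨rfl⟩

instance : T2Space (RegEnd H) :=
  T2Space.of_injective_continuous RegEnd.state_injective RegEnd.isInducing_state.continuous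

instance : CompactSpace (RegEnd H) := by
  rw [← isCompact_univ_iff, RegEnd.isInducing_state.isCompact_iff, Set.image_univ,
    RegEnd.range_state]
  exact isCompact_invariantStates (regYD H)

lemma exists_minimal_idempotent : ∃ p : RegInf H →ₗ[ℂ] RegInf H, IsUCP p ∧
    IsEquivariant (A := regYD H) (B := regYD H) p ∧ ∀ s : RegInf H →ₗ[ℂ] RegInf H, IsUCP s →
      IsEquivariant (A := regYD H) (B := regYD H) s → p ∘ₗ s ∘ₗ p = p := by
  -- The state of φ r at b is the state of φ at r(b), so multiplication by a fixed right factor is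
  -- pointwise continuous.
  have hcont : ∀ r : RegEnd H, Continuous (· * r) := fun r => by
    rw [RegEnd.isInducing_state.continuous_iff]
    exact continuous_pi fun b =>
      (continuous_apply (r.1 b)).comp RegEnd.isInducing_state.continuous
  have hfix : ∀ r : RegEnd H, ∃ c : RegEnd H, c * r = c := fun r => by
    obtain ⟨η, h1, h2⟩ := RegInf.isInvariantState_evalOne.exists_comp_eq_self r.2.1 r.2.2
    obtain ⟨P, h3, h4, h5⟩ := h1.exists_evalOne_comp_eq
    refine ⟨⟨P, h3, h4⟩, Subtype.ext (eq_of_evalOne_comp_eq (h4.comp r.2.2) h4 ?_)⟩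
    rw [← LinearMap.comp_assoc, h5, h2]
  obtain ⟨p, hp⟩ := exists_mul_mul_eq_self hcont hfix
  exact ⟨p.1, p.2.1, p.2.2, fun s hs hs' => congrArg Subtype.val (hp ⟨s, hs, hs'⟩)⟩

end Semigroup
end
end QG

namespace QG
noncomputable section
open scoped TensorProduct ComplexOrder CStarAlgebra
open Coalgebra HopfAlgebra

/-! ### The Choi–Effros product on the range of an idempotent ucp map -/

section ChoiEffros
attribute [local instance] CStarAlgebra.spectralOrder CStarAlgebra.spectralOrderedRing
variable {I : Type w} [CStarAlgebra I] {A : Type v} [NormedAddCommGroup A] [NormedSpace ℂ A]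
  [CompleteSpace A]

/-- The Choi–Effros product on a retract of a C*-algebra. -/
abbrev choiEffrosAlgebra (j : A →ₗ[ℂ] I) (q : I →ₗ[ℂ] A) (hn : ∀ a, ‖j a‖ = ‖a‖)
    (hqj : ∀ a, q (j a) = a) (hp : IsUCP (j ∘ₗ q)) : CStarAlgebra A :=
  have hqp : ∀ x, q (j (q x)) = q x := fun x => hqj (q x)
  have hpp : ∀ x, (j ∘ₗ q) ((j ∘ₗ q) x) = (j ∘ₗ q) x := fun x => congrArg j (hqp x)
  have hfix : ∀ a, (j ∘ₗ q) (j a) = j a := fun a => congrArg j (hqj a)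
  -- An inner application of the idempotent inside a product is absorbed by the outer one;
  -- associativity of the new product rests on this and its mirror image.
  have hl : ∀ x a, q (j (q x) * j a) = q (x * j a) := fun x a => by
    have := congrArg q (hp.idempotent_map_map_mul hpp (hfix a) x)
    simpa only [LinearMap.comp_apply, hqj] using this
  have hr : ∀ x a, q (j a * j (q x)) = q (j a * x) := fun x a => by
    have := congrArg q (hp.idempotent_map_mul_map hpp (hfix a) x)
    simpa only [LinearMap.comp_apply, hqj] using this
  have hs : ∀ x, j (q (star x)) = star (j (q x)) := hp.map_star
  have h1 : j (q 1) = 1 := hp.1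
  have hle : ∀ x, ‖q x‖ ≤ ‖x‖ := fun x => (hn _).symm.trans_le (hp.norm_le x)
  letI : Ring A :=
    { (inferInstance : AddCommGroup A) with
      mul := fun a b => q (j a * j b)
      one := q 1
      left_distrib := fun a b c => by
        change q (j a * j (b + c)) = q (j a * j b) + q (j a * j c)
        rw [map_add, mul_add, map_add]
      right_distrib := fun a b c => by
        change q (j (a + b) * j c) = q (j a * j c) + q (j b * j c)
        rw [map_add, add_mul, map_add]
      zero_mul := fun a => by
        change q (j 0 * j a) = 0
        rw [map_zero, zero_mul, map_zero]
      mul_zero := fun a => by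
        change q (j a * j 0) = 0
        rw [map_zero, mul_zero, map_zero]
      mul_assoc := fun a b c => by
        change q (j (q (j a * j b)) * j c) = q (j a * j (q (j b * j c)))
        rw [hl, hr, mul_assoc]
      one_mul := fun a => by
        change q (j (q 1) * j a) = a
        rw [h1, one_mul, hqj]
      mul_one := fun a => by
        change q (j a * j (q 1)) = a
        rw [h1, mul_one, hqj] }
  letI : NormedRing A :=
    { (inferInstance : NormedAddCommGroup A), (inferInstance : Ring A) with
      norm_mul_le := fun a b => by
        change ‖q (j a * j b)‖ ≤ ‖a‖ * ‖b‖
        rw [← hn a, ← hn b]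
        exact (hle _).trans (norm_mul_le _ _) }
  letI : Algebra ℂ A := Algebra.ofModule
    (fun r a b => by
      change q (j (r • a) * j b) = r • q (j a * j b)
      rw [map_smul, smul_mul_assoc, map_smul])
    (fun r a b => by
      change q (j a * j (r • b)) = r • q (j a * j b)
      rw [map_smul, mul_smul_comm, map_smul])
  letI : NormedAlgebra ℂ A :=
    { (inferInstance : Algebra ℂ A) with norm_smul_le := fun r a => norm_smul_le r a }
  letI : StarRing A :=
    { star := fun a => q (star (j a))
      star_involutive := fun a => by
        change q (star (j (q (star (j a))))) = a
        rw [hs, hqj, star_star, hqj]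
      star_mul := fun a b => by
        change q (star (j (q (j a * j b)))) = q (j (q (star (j b))) * j (q (star (j a))))
        rw [← hs, hqj, hs, hqj, hs, hqj, star_mul]
      star_add := fun a b => by
        change q (star (j (a + b))) = q (star (j a)) + q (star (j b))
        rw [map_add, star_add, map_add] }
  haveI : CStarRing A :=
    { norm_mul_self_le := fun a => by
        change ‖a‖ * ‖a‖ ≤ ‖q (j (q (star (j a))) * j a)‖
        rw [hs, hqj, ← hn a, ← CStarRing.norm_star_mul_self (x := j a), ← hn (q _)]
        -- With p = j ∘ q this reads (ja)*(ja) ≤ p((ja)*(ja)), the lower bound in the C*-identity.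
        have h2 := hp.schwarz (j a)
        rw [hfix] at h2
        exact CStarAlgebra.norm_le_norm_of_nonneg_of_le (star_mul_self_nonneg _) h2 }
  haveI : StarModule ℂ A :=
    { star_smul := fun r a => by
        change q (star (j (r • a))) = star r • q (star (j a))
        rw [map_smul, star_smul, map_smul] }
  { }

end ChoiEffros

section ChoiEffrosMaps
attribute [local instance] CStarAlgebra.spectralOrder CStarAlgebra.spectralOrderedRing
variable {I : Type w} [CStarAlgebra I] {A : Type v} [CStarAlgebra A] {j : A →ₗ[ℂ] I}
  {q : I →ₗ[ℂ] A}

/-- Since j is not multiplicative, positivity in A has to be compared with positivity in I. The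
compressed maps X ↦ j(c*Xc) separate points, so j reflects positivity, and complete positivity of q
is pulled back from that of j ∘ q. -/
lemma choiEffros_isUCP (hqj : ∀ a, q (j a) = a) (hp : IsUCP (j ∘ₗ q))
    (hmul : ∀ a b, a * b = q (j a * j b)) (hstar : ∀ a, star a = q (star (j a)))
    (hone : (1 : A) = q 1) : IsUCP j ∧ IsUCP q := by
  have hpp : ∀ x, (j ∘ₗ q) ((j ∘ₗ q) x) = (j ∘ₗ q) x := fun x => congrArg j (hqj (q x))
  have hfix : ∀ a, (j ∘ₗ q) (j a) = j a := fun a => congrArg j (hqj a)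
  have hjs : ∀ a, j (star a) = star (j a) := fun a => by
    rw [hstar]
    exact (hp.map_star _).trans (congrArg star (hfix a))
  have hqs : ∀ x, q (star x) = star (q x) := fun x => by
    rw [hstar, ← LinearMap.comp_apply j q, ← hp.map_star, LinearMap.comp_apply, hqj]
  have hjm : ∀ a b, j (a * b) = (j ∘ₗ q) (j a * j b) := fun a b => congrArg j (hmul a b)
  have hj : IsUCP j := by
    refine isUCP_iff.mpr ⟨by rw [hone]; exact hp.1, fun n a b => ?_⟩
    have := hp.form_nonneg (fun i => j (a i)) b
    simpa only [hjm, hjs] using this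
  have hjmm : ∀ a b x, j (a * q x * b) = (j ∘ₗ q) (j a * x * j b) := fun a b x => by
    rw [hjm, hjm, hp.idempotent_map_map_mul hpp (hfix b), ← LinearMap.comp_apply j q]
    rw [← hp.idempotent_map_map_mul hpp (hfix b), hp.idempotent_map_mul_map hpp (hfix a),
      hp.idempotent_map_map_mul hpp (hfix b)]
  have hnonneg : ∀ X : A, IsSelfAdjoint X → 0 ≤ j X → 0 ≤ X := by
    intro X hX hjX
    refine nonneg_of_separating (D := A) (E := I) (fun c : A =>
      j ∘ₗ LinearMap.mulRight ℂ c ∘ₗ LinearMap.mulLeft ℂ (star c))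
      (fun c d => ⟨d * c, fun e => ?_⟩) (fun c d => ?_) (fun d hd => ?_) hX (fun c => ?_)
    · simp [mul_assoc]
    · have := hj.map_star_mul_self_nonneg (d * c)
      simpa [mul_assoc] using this
    · have h1 := congrArg q (hd 1)
      simp only [LinearMap.comp_apply, LinearMap.mulLeft_apply, LinearMap.mulRight_apply, star_one,
        one_mul, mul_one, hqj, map_zero] at h1
      exact (CStarRing.star_mul_self_eq_zero_iff d).mp h1
    · obtain ⟨s, hs⟩ := exists_star_mul_self_of_nonneg hjX
      have h1 := hjmm (star c) c (j X)
      rw [hqj, hs, hjs] at h1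
      change 0 ≤ j (star c * X * c)
      rw [h1]
      have := hp.map_star_mul_self_nonneg (s * j c)
      simpa [mul_assoc] using this
  refine ⟨hj, isUCP_iff.mpr ⟨hone.symm, fun n a b => hnonneg _ ?_ ?_⟩⟩
  · rw [isSelfAdjoint_iff, star_sum]
    simp only [star_sum, star_mul, star_star, ← hqs]
    rw [Finset.sum_comm]
    simp only [mul_assoc]
  · simp only [map_sum, hjmm, hjs]
    have h1 : 0 ≤ (j ∘ₗ q) (star (∑ i, a i * j (b i)) * ∑ i, a i * j (b i)) :=
      hp.map_star_mul_self_nonneg _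
    refine h1.trans_eq ?_
    simp only [star_sum, star_mul, Finset.sum_mul, Finset.mul_sum, map_sum, mul_assoc]
    rw [Finset.sum_comm]

end ChoiEffrosMaps

/-- The range of an idempotent ucp map is a C*-algebra. -/
lemma exists_choiEffros {I : Type w} [CStarAlgebra I] {p : I →ₗ[ℂ] I} (hp : IsUCP p)
    (hpp : ∀ x, p (p x) = p x) : ∃ (A : Type (max w v)) (_ : CStarAlgebra A) (j : A →ₗ[ℂ] I)
      (q : I →ₗ[ℂ] A), IsUCP j ∧ IsUCP q ∧ (∀ a, q (j a) = a) ∧ (∀ x, j (q x) = p x) ∧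
      ∀ a b, a * b = q (j a * j b) := by
  -- The lift places the algebra in the universe `max w v` in which boundaries are considered.
  let A := ULift.{v} (LinearMap.range p)
  let j : A →ₗ[ℂ] I := (LinearMap.range p).subtype ∘ₗ ULift.moduleEquiv.toLinearMap
  let q : I →ₗ[ℂ] A := ULift.moduleEquiv.symm.toLinearMap ∘ₗ p.rangeRestrict
  have hqj : ∀ a, q (j a) = a := by
    rintro ⟨⟨_, x, rfl⟩⟩
    exact congrArg ULift.up (Subtype.ext (hpp x))
  have hjq : j ∘ₗ q = p := rfl
  have hclosed : IsClosed (LinearMap.range p : Set I) := by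
    have : (LinearMap.range p : Set I) = {x | p x = x} := by
      ext x
      exact ⟨fun ⟨y, hy⟩ => by rw [← hy]; exact hpp y, fun hx => ⟨x, hx⟩⟩
    rw [this]
    exact isClosed_eq hp.continuous continuous_id
  have : CompleteSpace (LinearMap.range p) := hclosed.completeSpace_coe
  have : CompleteSpace A := inferInstance
  have hp' : IsUCP (j ∘ₗ q) := hp
  let inst : CStarAlgebra A := choiEffrosAlgebra j q (fun _ => rfl) hqj hp'
  have h := choiEffros_isUCP (j := j) (q := q) hqj hp' (fun _ _ => rfl) (fun _ => rfl) rfl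
  exact ⟨A, inst, j, q, h.1, h.2, hqj, fun _ => rfl, fun _ _ => rfl⟩

end
end QG

namespace QG
noncomputable section
open scoped TensorProduct ComplexOrder CStarAlgebra
open Coalgebra HopfAlgebra

/-! ### Functoriality of ι ⊗ φ, and retracts of Yetter–Drinfeld algebras -/

section MapRight
attribute [local irreducible] instCStarAlgebraMinTensor
variable {H : Type u} [Ring H] [StarRing H] [HopfAlgebra ℂ H] [StarModule ℂ H]
  [CompactQuantumGroup H]

lemma mapRight_comp {A B C : Type*} [CStarAlgebra A] [CStarAlgebra B] [CStarAlgebra C]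
    {φ : A →ₗ[ℂ] B} {ψ : B →ₗ[ℂ] C} (hφ : IsUCP φ) (hψ : IsUCP ψ) (w : MinTensor H A) :
    mapRight hψ (mapRight hφ w) = mapRight (hψ.comp hφ) w := by
  have : (mapRight hψ).comp (mapRight hφ) = mapRight (H := H) (hψ.comp hφ) :=
    minTensor_clm_ext fun c a => by simp [mapRight_ofAlg]
  exact DFunLike.congr_fun this w

lemma mapRight_congr {A B : Type*} [CStarAlgebra A] [CStarAlgebra B] {φ ψ : A →ₗ[ℂ] B}
    (hφ : IsUCP φ) (hψ : IsUCP ψ) (h : ∀ a, φ a = ψ a) (w : MinTensor H A) :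
    mapRight hφ w = mapRight hψ w := by
  obtain rfl : φ = ψ := LinearMap.ext h
  rfl

lemma mapRight_one {A B : Type*} [CStarAlgebra A] [CStarAlgebra B] {φ : A →ₗ[ℂ] B}
    (hφ : IsUCP φ) : mapRight hφ (1 : MinTensor H A) = 1 := by
  rw [← map_one (ofAlg (H := H) (A := A)), mapRight_ofAlg, Algebra.TensorProduct.one_def,
    LinearMap.lTensor_tmul, hφ.1, ← Algebra.TensorProduct.one_def, map_one]

lemma mapRight_star {A B : Type*} [CStarAlgebra A] [CStarAlgebra B] {φ : A →ₗ[ℂ] B}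
    (hφ : IsUCP φ) (w : MinTensor H A) : mapRight hφ (star w) = star (mapRight hφ w) := by
  refine denseRange_ofAlg.induction_on w (isClosed_eq ((mapRight hφ).continuous.comp
    continuous_star) (continuous_star.comp (mapRight hφ).continuous)) fun z => ?_
  rw [← StarHomClass.map_star ofAlg, mapRight_ofAlg, mapRight_ofAlg, ← StarHomClass.map_star ofAlg]
  congr 1
  induction z using TensorProduct.induction_on with
  | zero => simp
  | add x y hx hy => simp only [map_add, star_add, hx, hy]
  | tmul c a => simp [hφ.map_star]

/-- The retraction onto a Choi–Effros algebra is multiplicative only when one factor is projected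
first; this property passes to ι ⊗ φ and makes the induced coaction a homomorphism. -/
lemma mapRight_mul_of {A B : Type*} [CStarAlgebra A] [CStarAlgebra B] {p : A →ₗ[ℂ] A}
    {φ : A →ₗ[ℂ] B} (hp : IsUCP p) (hφ : IsUCP φ) (h : ∀ a b, φ (p a * b) = φ a * φ b)
    (w w' : MinTensor H A) : mapRight hφ (mapRight hp w * w') = mapRight hφ w * mapRight hφ w' := by
  have hc : Continuous (mapRight (H := H) hφ) := (mapRight hφ).continuous
  have hc' : Continuous (mapRight (H := H) hp) := (mapRight hp).continuous
  refine denseRange_ofAlg.induction_on₂ (p := fun w w' : MinTensor H A =>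
    mapRight hφ (mapRight hp w * w') = mapRight hφ w * mapRight hφ w')
    (isClosed_eq (hc.comp ((hc'.comp continuous_fst).mul continuous_snd))
      ((hc.comp continuous_fst).mul (hc.comp continuous_snd))) (fun z z' => ?_) w w'
  rw [mapRight_ofAlg, ← map_mul ofAlg, mapRight_ofAlg, mapRight_ofAlg, mapRight_ofAlg,
    ← map_mul ofAlg]
  congr 1
  induction z using TensorProduct.induction_on with
  | zero => simp
  | add x y hx hy => simp only [map_add, add_mul, hx, hy]
  | tmul c a =>
    induction z' using TensorProduct.induction_on with
    | zero => simp
    | add x y hx hy => simp only [map_add, mul_add, hx, hy]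
    | tmul d b => simp [h]

variable {B : YDAlgebra.{u, w} H} {C : YDAlgebra.{u, v} H}

/-- Commuting with slices gives the intertwining relation on regular elements, which are dense. -/
lemma YDAlgebra.IsEquivariant.mapRight_α {φ : B →ₗ[ℂ] C} (hφ : IsUCP φ)
    (h : YDAlgebra.IsEquivariant φ) (b : B) : mapRight hφ (B.α b) = C.α (φ b) := by
  refine B.dense_isRegular.induction (P := fun b => mapRight hφ (B.α b) = C.α (φ b)) ?_
    (isClosed_eq ((mapRight hφ).continuous.comp (continuous_starAlgHom B.α))
      ((continuous_starAlgHom C.α).comp hφ.continuous)) b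
  rintro b ⟨z, hz⟩
  rw [hz, mapRight_ofAlg, B.isAction.map_of_commute C.isAction h.map_dualAct hz]

end MapRight

section Retract
attribute [local irreducible] instCStarAlgebraMinTensor
variable {H : Type u} [Ring H] [StarRing H] [HopfAlgebra ℂ H] [StarModule ℂ H]
  [CompactQuantumGroup H]

open YDAlgebra

/-- The range of an idempotent equivariant ucp map is a Yetter–Drinfeld algebra. -/
lemma exists_retract (I : YDAlgebra.{u, w} H) {p : I →ₗ[ℂ] I} (hp : IsUCP p)
    (hpe : IsEquivariant p) (hpp : ∀ x, p (p x) = p x) :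
    ∃ (A : YDAlgebra.{u, max w v} H) (j : A →ₗ[ℂ] I) (q : I →ₗ[ℂ] A), IsUCP j ∧ IsUCP q ∧
      IsEquivariant j ∧ IsEquivariant q ∧ (∀ a, q (j a) = a) ∧ (∀ x, j (q x) = p x) ∧
      ∀ a b, a * b = q (j a * j b) := by
  obtain ⟨A, inst, j, q, hj, hq, hqj, hjq, hmul⟩ := exists_choiEffros.{v, w} hp hpp
  have hqp : ∀ x, q (p x) = q x := fun x => by rw [← hjq, hqj]
  have hfix : ∀ a, p (j a) = j a := fun a => by rw [← hjq, hqj]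
  have hnt : Nontrivial A := ⟨1, 0, fun h => one_ne_zero (α := I) (by rw [← hj.1, h, map_zero])⟩
  have hqmul : ∀ x y, q (p x * y) = q x * q y := fun x y => by
    rw [hmul, hjq, hjq, ← hqp (p x * p y), hp.idempotent_map_mul_map hpp (hpp x), hqp]
  have hpα := hpe.mapRight_α hp
  have hqpα : ∀ w : MinTensor H I, mapRight hq (mapRight hp w) = mapRight hq w := fun w => by
    rw [mapRight_comp]; exact mapRight_congr _ _ hqp w
  have hqα : ∀ x, mapRight hq (I.α (p x)) = mapRight hq (I.α x) := fun x => by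
    rw [← hpα, hqpα]
  -- The coaction is (ι ⊗ q)α_I j. It is multiplicative because p is equivariant, so that α_I(ja) is
  -- fixed by ι ⊗ p and `hqmul` applies.
  let α : A →⋆ₐ[ℂ] MinTensor H A :=
    { toFun := fun a => mapRight hq (I.α (j a))
      map_one' := by rw [hj.1, map_one, mapRight_one]
      map_mul' := fun a b => by
        rw [hmul, hjq, hqα, map_mul, ← mapRight_mul_of hp hq hqmul, hpα, hfix]
      map_zero' := by rw [map_zero, map_zero, map_zero]
      map_add' := fun a b => by rw [map_add, map_add, map_add]
      commutes' := fun r => by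
        rw [Algebra.algebraMap_eq_smul_one, map_smul, hj.1, map_smul, map_one, map_smul,
          mapRight_one, Algebra.algebraMap_eq_smul_one]
      map_star' := fun a => by
        rw [hj.map_star, StarHomClass.map_star, mapRight_star] }
  have hα : ∀ a, α a = mapRight hq (I.α (j a)) := fun _ => rfl
  have hslice : ∀ a x, minSlice x (α a) = q (minSlice x (I.α (j a))) := fun a x => by
    rw [hα, minSlice_mapRight]
  have hpslice : ∀ b x, p (minSlice x (I.α b)) = minSlice x (I.α (p b)) := hpe.map_dualAct
  have hjα : ∀ a, mapRight hj (α a) = I.α (j a) := fun a => by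
    rw [hα, mapRight_comp, mapRight_congr _ hp hjq, hpα, hfix]
  have hjslice : ∀ a x, j (minSlice x (α a)) = minSlice x (I.α (j a)) := fun a x => by
    rw [hslice, hjq, hpslice, hfix]
  have hqslice : ∀ b x, q (minSlice x (I.α b)) = minSlice x (α (q b)) := fun b x => by
    rw [hslice, hjq, ← hpslice, hqp]
  have hact : IsAction α := by
    refine isAction_of (fun a b h => ?_) (fun b x n x₁ x₂ hx => ?_) fun a => ?_
    · have h1 : I.α (j a) = I.α (j b) := by rw [← hjα, h, hjα]
      rw [← hqj a, I.isAction.injective h1, hqj]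
    · rw [hα, hjslice, I.isAction.apply_minSlice _ hx, mapRight_ofAlg]
      simp [hslice]
    · have h1 := map_mem_closure hq.continuous (I.isAction.dense_minSlice (j a))
        (t := (Submodule.span ℂ {a : A | ∃ (x : H) (b : A), a = minSlice x (α b)} : Set A)) (by
          intro b hb
          have h2 := Submodule.mem_map_of_mem (f := q) hb
          rw [Submodule.map_span] at h2
          refine Submodule.span_mono ?_ h2
          rintro _ ⟨_, ⟨x, c, rfl⟩, rfl⟩
          exact ⟨x, q c, hqslice c x⟩)
      rwa [hqj] at h1
  have hpact : ∀ x b, p (I.act x b) = I.act x (p b) := hpe.map_act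
  let act : H →ₗ[ℂ] A →ₗ[ℂ] A := LinearMap.mk₂ ℂ (fun x a => q (I.act x (j a)))
    (by intros; simp) (by intros; simp) (by intros; simp) (by intros; simp)
  have hactd : ∀ x a, act x a = q (I.act x (j a)) := fun _ _ => rfl
  have hjact : ∀ x a, j (act x a) = I.act x (j a) := fun x a => by
    rw [hactd, hjq, hpact, hfix]
  have hqact : ∀ x b, q (I.act x b) = act x (q b) := fun x b => by
    rw [hactd, hjq, ← hpact, hqp]
  have hdual : IsDualAction act :=
    { one_act := fun a => by rw [hactd, I.isDualAction.one_act, hqj]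
      mul_act := fun x y a => by rw [hactd, I.isDualAction.mul_act, hactd x, hjact]
      act_one := fun x => by rw [hactd, hj.1, I.isDualAction.act_one, map_smul, hq.1]
      act_mul := fun x a b => by
        obtain ⟨n, x₁, x₂, hx⟩ := exists_comul_eq_sum x
        rw [hactd, hmul, hjq, ← hpact, hqp, I.isDualAction.act_mul, hx]
        simp [hmul, hjact]
      act_star := fun x a => by
        rw [hactd, hj.map_star, I.isDualAction.act_star, hq.map_star, hactd] }
  let Y : YDAlgebra.{u, max w v} H :=
    { carrier := A
      α := α
      isAction := hact
      act := act
      isDualAction := hdual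
      yetterDrinfeld := fun x a n x₁ x₂ x₃ m a₁ a₂ hx ha => by
        have h1 : I.α (j a) = ofAlg (∑ i, a₁ i ⊗ₜ[ℂ] j (a₂ i)) := by
          rw [← hjα, ha, mapRight_ofAlg]; simp
        rw [hα, hjact, I.yetterDrinfeld x (j a) n x₁ x₂ x₃ m a₁ _ hx h1, mapRight_ofAlg]
        simp [hactd] }
  exact ⟨Y, j, q, hj, hq, ⟨hjslice, hjact⟩, ⟨hqslice, hqact⟩, hqj, hjq, hmul⟩

end Retract
end
end QG

namespace QG
noncomputable section
open scoped TensorProduct ComplexOrder CStarAlgebra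
open Coalgebra HopfAlgebra

/-! ### Rigidity, existence and uniqueness of the boundary -/

section Boundary
attribute [local irreducible] instCStarAlgebraLInf instCStarAlgebraMinTensor instCStarAlgebraRegInf
variable {H : Type u} [Ring H] [StarRing H] [HopfAlgebra ℂ H] [StarModule ℂ H]
  [CompactQuantumGroup H]

namespace YDAlgebra

/-- Mutually inverse equivariant ucp maps are isomorphisms. -/
lemma Isomorphic.of_inverse {A B : YDAlgebra.{u, w} H} {φ : A →ₗ[ℂ] B} {ψ : B →ₗ[ℂ] A}
    (hφ : IsUCP φ) (hψ : IsUCP ψ) (he : IsEquivariant φ) (h1 : ∀ a, ψ (φ a) = a)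
    (h2 : ∀ b, φ (ψ b) = b) : A.Isomorphic B := by
  let e : A ≃⋆ₐ[ℂ] B :=
    { toFun := φ
      invFun := ψ
      left_inv := h1
      right_inv := h2
      map_mul' := hφ.map_mul_of_inverse hψ h1 h2
      map_add' := map_add φ
      map_star' := hφ.map_star
      map_smul' := map_smul φ }
  exact ⟨e, he.map_dualAct, he.map_act⟩

/-- A retract of a braided-commutative algebra, with the Choi–Effros product, is
braided-commutative. -/
lemma IsBraidedCommutative.of_retract {A : YDAlgebra.{u, w} H} {j : A →ₗ[ℂ] RegInf H}
    {q : RegInf H →ₗ[ℂ] A} (hj : IsEquivariant (A := A) (B := regYD H) j)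
    (hmul : ∀ a b, a * b = q (j a * j b)) : A.IsBraidedCommutative := by
  intro a b _ m b₁ b₂ hb
  have h1 : RegInf.coaction (j b) = ofAlg (∑ i, b₁ i ⊗ₜ[ℂ] j (b₂ i)) := by
    have := A.isAction.map_of_commute (regYD H).isAction hj.map_dualAct hb
    simpa using this
  have h2 : ∀ x a, RegInf.act x (j a) = j (A.act x a) := fun x a => (hj.map_act x a).symm
  rw [hmul, RegInf.braidedCommutative _ _ h1, map_sum]
  refine Finset.sum_congr rfl fun i _ => ?_
  rw [h2, ← hmul]

variable {A : YDAlgebra.{u, w} H} {j : A →ₗ[ℂ] RegInf H} {q : RegInf H →ₗ[ℂ] A}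

/-- Extend j ∘ ψ with values in `regYD H` and retract by q. The algebras B and C live in another
universe than `regYD H`, so its extension property is needed across universes. -/
lemma isInjective_of_retract (hj : IsUCP j) (hq : IsUCP q)
    (hje : IsEquivariant (A := A) (B := regYD H) j)
    (hqe : IsEquivariant (A := regYD H) (B := A) q) (hqj : ∀ a, q (j a) = a) :
    A.IsInjective := by
  intro B C φ ψ hφ hφe hi hψ hψe
  obtain ⟨ψ', h1, h2, h3⟩ := regYD_exists_extension hφ hφe hi (hj.comp hψ) (hje.comp hψe)
  refine ⟨q ∘ₗ ψ', hq.comp h1, hqe.comp h2, LinearMap.ext fun b => ?_⟩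
  have := LinearMap.congr_fun h3 b
  simp only [LinearMap.comp_apply] at this ⊢
  rw [this, hqj]

/-- Any B maps back to A through `regYD H`. By rigidity the round trip is the identity, so ψ has a
ucp left inverse. -/
lemma isBoundary_of_rigid (hq : IsUCP q) (hqe : IsEquivariant (A := regYD H) (B := A) q)
    (hrigid : ∀ ψ : A →ₗ[ℂ] A, IsUCP ψ → IsEquivariant ψ → ψ = LinearMap.id) :
    A.IsBoundary := by
  intro B ψ hψ hψe
  obtain ⟨f, hf, hfe⟩ := exists_isUCP_isEquivariant_regYD B
  exact isCompletelyIsometric_of_comp_eq_id hψ (hq.comp hf)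
    (hrigid _ ((hq.comp hf).comp hψ) ((hqe.comp hfe).comp hψe))

variable (H) in
/-- The range of a minimal idempotent, in the universe `max u v`. -/
lemma exists_rigid_retract : ∃ (A : YDAlgebra.{u, max u v} H) (j : A →ₗ[ℂ] RegInf H)
    (q : RegInf H →ₗ[ℂ] A), IsUCP j ∧ IsUCP q ∧ IsEquivariant (A := A) (B := regYD H) j ∧
      IsEquivariant (A := regYD H) (B := A) q ∧ (∀ a, q (j a) = a) ∧
      (∀ a b, a * b = q (j a * j b)) ∧
      ∀ ψ : A →ₗ[ℂ] A, IsUCP ψ → IsEquivariant ψ → ψ = LinearMap.id := by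
  obtain ⟨p, hp, hpe, hmin⟩ := exists_minimal_idempotent (H := H)
  -- The case s = id of p s p = p is idempotency.
  have hpp : ∀ x, p (p x) = p x := fun x =>
    LinearMap.congr_fun (hmin LinearMap.id IsUCP.id IsEquivariant.id) x
  obtain ⟨A, j, q, hj, hq, hje, hqe, hqj, hjq, hmul⟩ :=
    exists_retract.{u, v, u} (regYD H) hp hpe hpp
  refine ⟨A, j, q, hj, hq, hje, hqe, hqj, hmul, fun ψ hψ hψe => LinearMap.ext fun a => ?_⟩
  -- A self-map ψ of the range lifts to jψq on `regYD H`. Then p(jψq)p = p, and compressing by q and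
  -- j gives ψ = id.
  have h1 := LinearMap.congr_fun
    (hmin (j ∘ₗ ψ ∘ₗ q) (hj.comp (hψ.comp hq)) (hje.comp (hψe.comp hqe))) (j a)
  have h2 := congrArg q h1
  simpa only [LinearMap.comp_apply, ← hjq, hqj, LinearMap.id_apply] using h2

/-- A Furstenberg–Hamana boundary is equivalent to every rigid retract of `regYD H`. -/
lemma IsFHBoundary.exists_inverse {A A₀ : YDAlgebra.{u, w} H} (hA : A.IsFHBoundary)
    {q : RegInf H →ₗ[ℂ] A₀} (hq : IsUCP q) (hqe : IsEquivariant (A := regYD H) (B := A₀) q)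
    (hrigid : ∀ ψ : A₀ →ₗ[ℂ] A₀, IsUCP ψ → IsEquivariant ψ → ψ = LinearMap.id) :
    ∃ (g : A →ₗ[ℂ] A₀) (g' : A₀ →ₗ[ℂ] A), IsUCP g ∧ IsUCP g' ∧ IsEquivariant g ∧
      IsEquivariant g' ∧ (∀ a, g' (g a) = a) ∧ ∀ a, g (g' a) = a := by
  obtain ⟨f, hf, hfe⟩ := exists_isUCP_isEquivariant_regYD A
  have hg := hq.comp hf
  have hge := hqe.comp hfe
  -- The boundary property makes A → A₀ completely isometric, so injectivity of A extends the
  -- identity of A along it to a left inverse.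
  obtain ⟨g', h1, h2, h3⟩ := hA.isInjective A A₀ (q ∘ₗ f) LinearMap.id hg hge
    (hA.isBoundary A₀ _ hg hge) IsUCP.id IsEquivariant.id
  exact ⟨q ∘ₗ f, g', hg, h1, hge, h2, LinearMap.congr_fun h3,
    LinearMap.congr_fun (hrigid _ (hg.comp h1) (hge.comp h2))⟩

end YDAlgebra
end Boundary
end
end QG

theorem theorem2p3 (H : Type u) [Ring H] [StarRing H] [HopfAlgebra ℂ H] [StarModule ℂ H]
    [QG.CompactQuantumGroup H] :
    (∃ A : QG.YDAlgebra.{u, max u v} H, A.IsFHBoundary) ∧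
    (∀ A₁ A₂ : QG.YDAlgebra.{u, max u v} H,
      A₁.IsFHBoundary → A₂.IsFHBoundary → A₁.Isomorphic A₂) ∧
    (∀ A : QG.YDAlgebra.{u, max u v} H, A.IsFHBoundary →
      (∀ ψ : A →ₗ[ℂ] A, QG.IsUCP ψ → QG.YDAlgebra.IsEquivariant ψ → ψ = LinearMap.id) ∧
      A.IsBraidedCommutative) := by
  obtain ⟨A₀, j, q, hj, hq, hje, hqe, hqj, hmul, hrigid⟩ :=
    QG.YDAlgebra.exists_rigid_retract.{u, v} H
  refine ⟨⟨A₀, QG.YDAlgebra.isBoundary_of_rigid hq hqe hrigid,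
    QG.YDAlgebra.isInjective_of_retract hj hq hje hqe hqj⟩, fun A₁ A₂ h₁ h₂ => ?_, fun A hA => ?_⟩
  · obtain ⟨g, g', hg, hg', hge, -, h1, h2⟩ := h₁.exists_inverse hq hqe hrigid
    obtain ⟨k, k', hk, hk', -, hke', h3, h4⟩ := h₂.exists_inverse hq hqe hrigid
    -- Both boundaries are compared with A₀; the isomorphism is the composition through it.
    refine QG.YDAlgebra.Isomorphic.of_inverse (hk'.comp hg) (hg'.comp hk) (hke'.comp hge)
      (fun a => ?_) (fun b => ?_)
    · simp only [LinearMap.comp_apply, h4, h1]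
    · simp only [LinearMap.comp_apply, h2, h3]
  · obtain ⟨g, g', hg, hg', hge, hge', h1, h2⟩ := hA.exists_inverse hq hqe hrigid
    refine ⟨fun ψ hψ hψe => LinearMap.ext fun a => ?_,
      QG.YDAlgebra.IsBraidedCommutative.of_retract (j := j ∘ₗ g) (q := g' ∘ₗ q) (hje.comp hge)
        fun a b => ?_⟩
    · have h3 := congrArg g' (LinearMap.congr_fun
        (hrigid _ (hg.comp (hψ.comp hg')) (hge.comp (hψe.comp hge'))) (g a))
      simpa only [LinearMap.comp_apply, h1, LinearMap.id_apply] using h3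
    -- A ucp map with ucp inverse is multiplicative, so the product of A is also the one induced
    -- from `regYD H` through A₀.
    · have h3 := congrArg g' (hg.map_mul_of_inverse hg' h1 h2 a b)
      rw [h1, hmul] at h3
      exact h3
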